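/- Let $\mathbb K$ be a field of characteristic $0$ and $V$ a finite-dimensional $\mathbb K$-vector space. "Dg-algebra" means a $\mathbb Z_-$-graded associative, not necessarily unital, differential graded $\mathbb K$-algebra (cohomological grading, components in degrees $\le 0$). A dg-algebra $B$ is quasifree if, forgetting the differential, it is the free associative algebra without unit on some graded vector space. For a dg-algebra $A$, let $\operatorname{Act}(A,V)$ be the dg-scheme of actions of $A$ on $V$: it is the affine dg-scheme $\operatorname{Spec}$ of the commutative dg-algebra obtained from the graded symmetric algebra on $\operatorname{Hom}(V, A\otimes V)\cong A\otimes V\otimes V^*$ (the coordinate algebra of $|\operatorname{Hom}(A\otimes V,V)|$, with differential induced by that of $A$) by dividing by the ideal expressing associativity $\mu(ab\otimes v)=\mu(a\otimes\mu(b\otimes v))$ of the universal linear map $\mu\colon A\otimes V\to V$. A morphism $f\colon A\to B$ of dg-algebras induces $f^*\colon \operatorname{Act}(B,V)\to\operatorname{Act}(A,V)$. A morphism $X\to Y$ of dg-schemes is a quasi-isomorphism if it induces an isomorphism $\pi_0(X)\to\pi_0(Y)$, where $\pi_0(X)=\operatorname{Spec} H^0(\mathcal O_X)$, and, through it, isomorphisms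 $H^i(\mathcal O_Y)\to H^i(\mathcal O_X)$ of sheaves for all $i$. Then: (1) If $f\colon B_1\to B_2$ is a quasi-isomorphism of quasifree dg-algebras, then $f^*\colon\operatorname{Act}(B_2,V)\to\operatorname{Act}(B_1,V)$ is a quasi-isomorphism of dg-schemes. (2) Consequently $R\operatorname{Act}(A,V)=\operatorname{Act}(B,V)$, where $B\to A$ is any quasifree resolution, is well defined up to quasi-isomorphism, for every dg-algebra $A$. That is: there are a quasifree dg-algebra $B$ and a quasi-isomorphism $p\colon B\to A$; and if $p\colon B\to A$ and $p'\colon B'\to A$ are quasi-isomorphisms with $B$ and $B'$ quasifree, then there is a morphism $g\colon B\to B'$ with $H^\bullet(p')\circ H^\bullet(g)=H^\bullet(p)$ such that $g^*\colon\operatorname{Act}(B',V)\to\operatorname{Act}(B,V)$ is a quasi-isomorphism. -/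

import Mathlib

open CategoryTheory AlgebraicGeometry TopologicalSpace TensorProduct
open scoped DirectSum

universe u

namespace DerivedAct

noncomputable section

section Graded

variable {K M N : Type*} [Field K] [AddCommGroup M] [Module K M] [AddCommGroup N] [Module K N]

/-- A linear map out of a graded vector space, given on each graded component. -/
def glue {N : Type*} [AddCommMonoid N] [Module K N] {gr : ℤ → Submodule K M} (h : DirectSum.IsInternal gr) (f : ∀ i, gr i →ₗ[K] N) :
    M →ₗ[K] N :=
  (DirectSum.toModule K ℤ N f) ∘ₗ
    (LinearEquiv.ofBijective (DirectSum.coeLinearMap gr) h).symm.toLinearMap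

lemma glue_of_mem {N : Type*} [AddCommMonoid N] [Module K N] {gr : ℤ → Submodule K M}
    (h : DirectSum.IsInternal gr) (f : ∀ i, gr i →ₗ[K] N) {i : ℤ} {a : M} (ha : a ∈ gr i) :
    glue h f a = f i ⟨a, ha⟩ := by
  have : (LinearEquiv.ofBijective (DirectSum.coeLinearMap gr) h).symm a
      = DirectSum.lof K ℤ (fun i => gr i) i ⟨a, ha⟩ := by
    rw [LinearEquiv.symm_apply_eq]
    exact (DirectSum.coeLinearMap_lof gr i ⟨a, ha⟩).symm
  simp [glue, this]

/-- The projection to the component of degree `i`. -/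
def proj {gr : ℤ → Submodule K M} (h : DirectSum.IsInternal gr) (i : ℤ) : M →ₗ[K] M :=
  glue h fun j => if j = i then (gr j).subtype else 0

lemma proj_of_mem {gr : ℤ → Submodule K M} (h : DirectSum.IsInternal gr) {i : ℤ} {a : M}
    (ha : a ∈ gr i) : proj h i a = a := by
  simp [proj, glue_of_mem h _ ha]

lemma proj_of_mem_ne {gr : ℤ → Submodule K M} (h : DirectSum.IsInternal gr) {i j : ℤ} {a : M}
    (ha : a ∈ gr j) (hj : j ≠ i) : proj h i a = 0 := by
  simp [proj, glue_of_mem h _ ha, hj]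

lemma graded_induction {gr : ℤ → Submodule K M} (h : DirectSum.IsInternal gr) {p : M → Prop}
    (hom : ∀ i, ∀ a ∈ gr i, p a) (add : ∀ a b, p a → p b → p (a + b)) (a : M) : p a := by
  have ha : a ∈ ⨆ i, gr i := by rw [h.submodule_iSup_eq_top]; trivial
  exact Submodule.iSup_induction gr (motive := p) ha hom (hom 0 0 (zero_mem _)) add

lemma isInternal_of_proj (gr : ℤ → Submodule K M) (p : ℤ → M →+ M)
    (h1 : ∀ i, ∀ x ∈ gr i, p i x = x) (h2 : ∀ i j, j ≠ i → ∀ x ∈ gr j, p i x = 0)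
    (top : ∀ x, x ∈ ⨆ i, gr i) : DirectSum.IsInternal gr := by
  refine DirectSum.isInternal_submodule_of_iSupIndep_of_iSup_eq_top ?_
    (eq_top_iff.2 fun x _ => top x)
  rw [iSupIndep_def]
  intro i
  rw [Submodule.disjoint_def]
  intro x hx hx'
  rw [← h1 i x hx]
  refine Submodule.iSup_induction (p := fun j => ⨆ (_ : j ≠ i), gr j)
    (motive := fun x => p i x = 0) hx' (fun j y hy => ?_) (map_zero _) (fun a b ha hb => ?_)
  · by_cases hj : j = i
    · simp only [hj, ne_eq, not_true_eq_false, iSup_false, Submodule.mem_bot] at hy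
      rw [hy, map_zero]
    · simp only [hj, ne_eq, not_false_eq_true, iSup_true] at hy
      exact h2 i j hj y hy
  · rw [map_add, ha, hb, add_zero]

/-- Cocycles of degree `i`. -/
def cocycles (gr : ℤ → Submodule K M) (d : M →ₗ[K] M) (i : ℤ) : Submodule K M :=
  gr i ⊓ LinearMap.ker d

/-- Coboundaries of degree `i`. -/
def coboundaries (gr : ℤ → Submodule K M) (d : M →ₗ[K] M) (i : ℤ) : Submodule K M :=
  (gr (i - 1)).map d

/-- Cohomology in degree `i`: cocycles modulo coboundaries. -/
abbrev Cohomology (gr : ℤ → Submodule K M) (d : M →ₗ[K] M) (i : ℤ) : Type _ :=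
  cocycles gr d i ⧸ (coboundaries gr d i).submoduleOf (cocycles gr d i)

/-- The map induced on cohomology by a degree `0` linear map that commutes with the
differentials. -/
def cohomologyMap {gr : ℤ → Submodule K M} {d : M →ₗ[K] M}
    {gr' : ℤ → Submodule K N} {d' : N →ₗ[K] N} (f : M →ₗ[K] N)
    (hgr : ∀ i, ∀ a ∈ gr i, f a ∈ gr' i) (hd : ∀ a, f (d a) = d' (f a)) (i : ℤ) :
    Cohomology gr d i →ₗ[K] Cohomology gr' d' i :=
  Submodule.mapQ _ _
    (f.restrict (p := cocycles gr d i) (q := cocycles gr' d' i) fun a ha =>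
      ⟨hgr i a ha.1, by
        have h0 : d a = 0 := ha.2
        change d' (f a) = 0
        rw [← hd, h0, map_zero]⟩)
    (by
      rintro ⟨a, ha⟩ ⟨b, hb, hab⟩
      exact ⟨f b, hgr _ b hb, by
        have h0 : d b = a := hab
        rw [← hd, h0]; rfl⟩)

end Graded

/-- A `ℤ₋`-graded associative dg-algebra (not necessarily unital) over the field `K`, with
cohomological grading. -/
structure DGAlg (K : Type u) [Field K] where
  carrier : Type u
  [ring : NonUnitalRing carrier]
  [module : Module K carrier]
  [isScalarTower : IsScalarTower K carrier carrier]
  [smulCommClass : SMulCommClass K carrier carrier]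
  /-- The graded components. -/
  gr : ℤ → Submodule K carrier
  isInternal : DirectSum.IsInternal gr
  gr_pos : ∀ i, 0 < i → gr i = ⊥
  mul_mem : ∀ {i j a b}, a ∈ gr i → b ∈ gr j → a * b ∈ gr (i + j)
  /-- The differential. -/
  d : carrier →ₗ[K] carrier
  d_mem : ∀ {i a}, a ∈ gr i → d a ∈ gr (i + 1)
  d_d : ∀ a, d (d a) = 0
  d_mul : ∀ {i a}, a ∈ gr i → ∀ b, d (a * b) = d a * b + i.negOnePow • (a * d b)

namespace DGAlg

variable {K : Type u} [Field K]

instance : CoeSort (DGAlg K) (Type u) := ⟨carrier⟩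
attribute [instance] ring module isScalarTower smulCommClass

/-- Morphisms of dg-algebras. -/
structure Hom (A B : DGAlg K) where
  toFun : A →ₙₐ[K] B
  map_mem : ∀ {i a}, a ∈ A.gr i → toFun a ∈ B.gr i
  map_d : ∀ a, toFun (A.d a) = B.d (toFun a)

/-- The identity morphism. -/
def Hom.id (A : DGAlg K) : Hom A A := ⟨NonUnitalAlgHom.id K A, fun h => h, fun _ => rfl⟩

/-- Composition: `g.comp f` is `g ∘ f`. -/
def Hom.comp {A B C : DGAlg K} (g : Hom B C) (f : Hom A B) : Hom A C :=
  ⟨g.toFun.comp f.toFun, fun h => g.map_mem (f.map_mem h), fun a => by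
    simp [f.map_d, g.map_d]⟩

/-- The cohomology of a dg-algebra. -/
abbrev H (A : DGAlg K) (i : ℤ) : Type u := Cohomology A.gr A.d i

/-- The map induced on cohomology. -/
def Hom.H {A B : DGAlg K} (f : Hom A B) (i : ℤ) : A.H i →ₗ[K] B.H i :=
  cohomologyMap (f.toFun : A →ₗ[K] B) (fun _ _ h => f.map_mem h) f.map_d i

/-- Quasi-isomorphisms of dg-algebras. -/
def Hom.IsQuasiIso {A B : DGAlg K} (f : Hom A B) : Prop :=
  ∀ i, Function.Bijective (f.H i)

/-- `B` is quasifree if, forgetting the differential, it is the free associative algebra without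
unit on a graded vector space. With a homogeneous basis `x : X → B` of the space of generators,
this says that the canonical map from the semigroup algebra of the free semigroup on `X` (the
free non-unital associative algebra on `X`: its basis consists of the nonempty words in `X`)
to `B` is bijective. -/
def IsQuasifree (B : DGAlg K) : Prop :=
  ∃ (X : Type u) (deg : X → ℤ) (x : X → B), (∀ e, x e ∈ B.gr (deg e)) ∧
    Function.Bijective (MonoidAlgebra.liftMagma K (FreeSemigroup.lift x))

end DGAlg

/-- A `ℤ₋`-graded (graded-)commutative unital dg-algebra over the field `K`. -/
structure CDGAlg (K : Type u) [Field K] where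
  carrier : Type u
  [ring : Ring carrier]
  [algebra : Algebra K carrier]
  /-- The graded components. -/
  gr : ℤ → Submodule K carrier
  isInternal : DirectSum.IsInternal gr
  gr_pos : ∀ i, 0 < i → gr i = ⊥
  one_mem : 1 ∈ gr 0
  mul_mem : ∀ {i j a b}, a ∈ gr i → b ∈ gr j → a * b ∈ gr (i + j)
  mul_comm : ∀ {i j a b}, a ∈ gr i → b ∈ gr j → a * b = (i * j).negOnePow • (b * a)
  /-- The differential. -/
  d : carrier →ₗ[K] carrier
  d_mem : ∀ {i a}, a ∈ gr i → d a ∈ gr (i + 1)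
  d_d : ∀ a, d (d a) = 0
  d_mul : ∀ {i a}, a ∈ gr i → ∀ b, d (a * b) = d a * b + i.negOnePow • (a * d b)

namespace CDGAlg

variable {K : Type u} [Field K]

instance : CoeSort (CDGAlg K) (Type u) := ⟨carrier⟩
attribute [instance] ring algebra

/-- Morphisms of commutative dg-algebras. -/
structure Hom (A B : CDGAlg K) where
  toFun : A →ₐ[K] B
  map_mem : ∀ {i a}, a ∈ A.gr i → toFun a ∈ B.gr i
  map_d : ∀ a, toFun (A.d a) = B.d (toFun a)

/-- The identity morphism. -/
def Hom.id (A : CDGAlg K) : Hom A A := ⟨AlgHom.id K A, fun h => h, fun _ => rfl⟩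

/-- Composition: `g.comp f` is `g ∘ f`. -/
def Hom.comp {A B C : CDGAlg K} (g : Hom B C) (f : Hom A B) : Hom A C :=
  ⟨g.toFun.comp f.toFun, fun h => g.map_mem (f.map_mem h), fun a => by
    simp [f.map_d, g.map_d]⟩

@[ext] lemma Hom.ext {A B : CDGAlg K} {f g : Hom A B} (h : ∀ a, f.toFun a = g.toFun a) :
    f = g := by
  cases f; cases g
  congr
  exact AlgHom.ext h

/-- The cohomology of a commutative dg-algebra. -/
abbrev H (A : CDGAlg K) (i : ℤ) : Type u := Cohomology A.gr A.d i

/-- The map induced on cohomology. -/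
def Hom.H {A B : CDGAlg K} (f : Hom A B) (i : ℤ) : A.H i →ₗ[K] B.H i :=
  cohomologyMap f.toFun.toLinearMap (fun _ _ h => f.map_mem h) f.map_d i

/-- The degree `0` part, an ordinary commutative algebra. -/
def deg0 (A : CDGAlg K) : Subalgebra K A where
  carrier := A.gr 0
  mul_mem' ha hb := by simpa using A.mul_mem ha hb
  add_mem' := (A.gr 0).add_mem
  algebraMap_mem' r := by
    rw [Algebra.algebraMap_eq_smul_one]
    exact (A.gr 0).smul_mem r A.one_mem

instance (A : CDGAlg K) : CommRing A.deg0 where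
  mul_comm a b := Subtype.ext <| by
    have := A.mul_comm a.2 b.2
    simpa using this

lemma deg0_commutes (A : CDGAlg K) (a : A.deg0) (b : A) : (a : A) * b = b * a := by
  induction b using graded_induction A.isInternal with
  | hom i b hb => simpa using A.mul_comm a.2 hb
  | add b c hb hc => rw [mul_add, hb, hc, add_mul]

instance (A : CDGAlg K) : Algebra A.deg0 A where
  algebraMap := A.deg0.val.toRingHom
  commutes' a b := A.deg0_commutes a b
  smul_def' _ _ := rfl

lemma d_deg0 (A : CDGAlg K) (a : A.deg0) : A.d (a : A) = 0 := by
  have h := A.d_mem a.2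
  rw [A.gr_pos _ (by norm_num)] at h
  exact h

/-- The differential is linear over the degree `0` part. -/
def dLin (A : CDGAlg K) : A →ₗ[A.deg0] A where
  toFun := A.d
  map_add' := map_add _
  map_smul' a b := by
    change A.d ((a : A) * b) = (a : A) * A.d b
    rw [A.d_mul a.2, d_deg0]
    simp

/-- The projection to a graded component is linear over the degree `0` part. -/
def projLin (A : CDGAlg K) (i : ℤ) : A →ₗ[A.deg0] A where
  toFun := proj A.isInternal i
  map_add' := map_add _
  map_smul' a b := by
    change proj A.isInternal i ((a : A) * b) = (a : A) * proj A.isInternal i b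
    induction b using graded_induction A.isInternal with
    | hom j b hb =>
      have hab : (a : A) * b ∈ A.gr j := by simpa using A.mul_mem a.2 hb
      by_cases hj : j = i
      · subst hj
        rw [proj_of_mem _ hb, proj_of_mem _ hab]
      · rw [proj_of_mem_ne _ hb hj, proj_of_mem_ne _ hab hj, mul_zero]
    | add b c hb hc => rw [mul_add, map_add, hb, hc, map_add, mul_add]

section BaseChange

variable (A : CDGAlg K) (R : Type u) [CommRing R] [Algebra A.deg0 R]

/-- The underlying space `R ⊗ A` of the base change of `A` to an algebra `R` over its degree
`0` part. -/
def BC : Type u :=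
  R ⊗[A.deg0] A

instance : Ring (A.BC R) :=
  inferInstanceAs (Ring (R ⊗[A.deg0] A))

instance : Algebra A.deg0 (A.BC R) :=
  inferInstanceAs (Algebra A.deg0 (R ⊗[A.deg0] A))

instance : Algebra K (A.BC R) := Algebra.compHom _ (algebraMap K A.deg0)

variable {A R} in
/-- The element `r ⊗ a`. -/
def bc (r : R) (a : A) : A.BC R :=
  (r ⊗ₜ[A.deg0] a : R ⊗[A.deg0] A)

variable {A R}

lemma bc_add_left (r s : R) (a : A) : bc (r + s) a = bc r a + bc s a :=
  TensorProduct.add_tmul _ _ _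

lemma bc_add_right (r : R) (a b : A) : bc r (a + b) = bc r a + bc r b :=
  TensorProduct.tmul_add _ _ _

lemma bc_zero_right (r : R) : bc r (0 : A) = 0 :=
  TensorProduct.tmul_zero _ _

lemma bc_zero_left (a : A) : bc (0 : R) a = 0 :=
  TensorProduct.zero_tmul _ _

lemma bc_mul (r s : R) (a b : A) : bc r a * bc s b = bc (r * s) (a * b) :=
  Algebra.TensorProduct.tmul_mul_tmul _ _ _ _

lemma bc_one : bc (1 : R) (1 : A) = 1 := rfl

lemma bc_smul (a : A.deg0) (r : R) (b : A) : a • bc r b = bc r ((a : A) * b) :=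
  (TensorProduct.tmul_smul a r b).symm

lemma bc_deg0 (r : R) (a : A.deg0) (b : A) : bc r ((a : A) * b) = bc (algebraMap A.deg0 R a * r) b :=
  by
  rw [← Algebra.smul_def]
  exact (TensorProduct.smul_tmul a r b).symm

lemma bc_units_smul (r : R) (e : ℤˣ) (a : A) : bc r (e • a) = e • bc r a := by
  rw [Units.smul_def, Units.smul_def]
  exact (map_zsmul ((TensorProduct.mk A.deg0 R A r)) (e : ℤ) a)

@[elab_as_elim]
lemma bc_induction {p : A.BC R → Prop} (h : ∀ r a, p (bc r a))
    (add : ∀ x y, p x → p y → p (x + y)) (x : A.BC R) : p x := by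
  refine TensorProduct.induction_on (R := A.deg0) (M := R) (N := A) x ?_ h add
  have := h 0 0
  rwa [bc_zero_left] at this

/-- A `deg0`-linear endomorphism of `A`, extended to the base change. -/
def bcMapLin (f : A →ₗ[A.deg0] A) : A.BC R →ₗ[A.deg0] A.BC R :=
  LinearMap.lTensor R f

lemma bcMapLin_bc (f : A →ₗ[A.deg0] A) (r : R) (a : A) :
    bcMapLin f (bc r a) = bc r (f a) := rfl

variable (A R)

/-- The graded components of the base change. -/
def bcGr (i : ℤ) : Submodule K (A.BC R) :=
  Submodule.span K {x | ∃ r, ∃ a ∈ A.gr i, x = bc r a}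

variable {A R}

lemma bc_mem {i : ℤ} (r : R) {a : A} (ha : a ∈ A.gr i) : bc r a ∈ A.bcGr R i :=
  Submodule.subset_span ⟨r, a, ha, rfl⟩

lemma K_smul_bc (c : K) (r : R) (b : A) : c • bc r b = bc r (c • b) := by
  rw [Algebra.smul_def c b]
  exact bc_smul (algebraMap K A.deg0 c) r b

@[elab_as_elim]
lemma bcGr_induction {i : ℤ} {p : A.BC R → Prop} (h : ∀ r, ∀ a ∈ A.gr i, p (bc r a))
    (add : ∀ x y, p x → p y → p (x + y)) {x : A.BC R} (hx : x ∈ A.bcGr R i) : p x := by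
  refine Submodule.closure_induction (R := K) (p := fun x _ => p x) ?_ ?_ ?_ hx
  · have := h 0 0 (zero_mem _)
    rwa [bc_zero_left] at this
  · exact fun x y _ _ => add x y
  · rintro c x ⟨r, a, ha, rfl⟩
    rw [K_smul_bc]
    exact h _ _ ((A.gr i).smul_mem c ha)

lemma bc_mem_iSup (x : A.BC R) : x ∈ ⨆ i, A.bcGr R i := by
  induction x using bc_induction with
  | h r a =>
    induction a using graded_induction A.isInternal with
    | hom i a ha => exact Submodule.mem_iSup_of_mem i (bc_mem r ha)
    | add a b ha hb => rw [bc_add_right]; exact add_mem ha hb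
  | add x y hx hy => exact add_mem hx hy

variable (A R)

lemma bcGr_isInternal : DirectSum.IsInternal (A.bcGr R) := by
  refine isInternal_of_proj _ (fun i => (bcMapLin (R := R) (A.projLin i)).toAddMonoidHom)
    (fun i x hx => ?_) (fun i j hj x hx => ?_) bc_mem_iSup
  · refine bcGr_induction (fun r a ha => ?_) (fun x y hx hy => ?_) hx
    · change bc r (proj A.isInternal i a) = bc r a
      rw [proj_of_mem _ ha]
    · rw [map_add, hx, hy]
  · refine bcGr_induction (fun r a ha => ?_) (fun x y hx hy => ?_) hx
    · change bc r (proj A.isInternal i a) = 0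
      rw [proj_of_mem_ne _ ha hj, bc_zero_right]
    · rw [map_add, hx, hy, add_zero]

/-- The base change of a commutative dg-algebra `A` to an algebra `R` over its degree `0` part:
the algebra `R ⊗ A` over `A⁰`, with the grading and the differential of `A`. -/
def baseChange : CDGAlg K where
  carrier := A.BC R
  gr := A.bcGr R
  isInternal := A.bcGr_isInternal R
  gr_pos i hi := by
    rw [eq_bot_iff]
    intro x hx
    refine bcGr_induction (fun r a ha => ?_) (fun x y hx hy => ?_) hx
    · rw [A.gr_pos i hi] at ha
      rw [(Submodule.mem_bot K).1 ha, bc_zero_right]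
      exact zero_mem _
    · exact add_mem hx hy
  one_mem := bc_mem 1 A.one_mem
  mul_mem {i j x y} hx hy := by
    refine bcGr_induction (fun r a ha => ?_) (fun x₁ x₂ h₁ h₂ => ?_) hx
    · refine bcGr_induction (fun s b hb => ?_) (fun y₁ y₂ h₁ h₂ => ?_) hy
      · rw [bc_mul]
        exact bc_mem _ (A.mul_mem ha hb)
      · rw [mul_add]
        exact add_mem h₁ h₂
    · rw [add_mul]
      exact add_mem h₁ h₂
  mul_comm {i j x y} hx hy := by
    refine bcGr_induction (fun r a ha => ?_) (fun x₁ x₂ h₁ h₂ => ?_) hx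
    · refine bcGr_induction (fun s b hb => ?_) (fun y₁ y₂ h₁ h₂ => ?_) hy
      · rw [bc_mul, bc_mul, A.mul_comm ha hb, bc_units_smul, _root_.mul_comm r s]
      · rw [mul_add, add_mul, smul_add, h₁, h₂]
    · rw [mul_add, add_mul, smul_add, h₁, h₂]
  d :=
    { toFun := bcMapLin A.dLin
      map_add' := map_add _
      map_smul' := fun c x => (bcMapLin A.dLin).map_smul (algebraMap K A.deg0 c) x }
  d_mem {i x} hx := by
    change bcMapLin A.dLin x ∈ _
    refine bcGr_induction (fun r a ha => ?_) (fun x y hx hy => ?_) hx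
    · exact bc_mem r (A.d_mem ha)
    · rw [map_add]
      exact add_mem hx hy
  d_d x := by
    change bcMapLin A.dLin (bcMapLin A.dLin x) = 0
    induction x using bc_induction with
    | h r a =>
      change bc r (A.d (A.d a)) = 0
      rw [A.d_d, bc_zero_right]
    | add x y hx hy => rw [map_add, map_add, hx, hy, add_zero]
  d_mul {i x} hx y := by
    change bcMapLin A.dLin (x * y) = bcMapLin A.dLin x * y + i.negOnePow • (x * bcMapLin A.dLin y)
    refine bcGr_induction (fun r a ha => ?_) (fun x₁ x₂ h₁ h₂ => ?_) hx
    · induction y using bc_induction with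
      | h s b =>
        rw [bc_mul, bcMapLin_bc, bcMapLin_bc, bcMapLin_bc, bc_mul, bc_mul, ← bc_units_smul,
          ← bc_add_right]
        exact congrArg _ (A.d_mul ha b)
      | add y z hy hz =>
        rw [mul_add, map_add, hy, hz, mul_add, map_add, mul_add, smul_add]
        abel
    · rw [add_mul, map_add, h₁, h₂, map_add, add_mul, add_mul, smul_add]
      abel

/-- The structure map `R → R ⊗ A`, an isomorphism onto the degree `0` part. -/
def bcStr : R →+* A.baseChange R where
  toFun r := bc r 1
  map_one' := bc_one
  map_mul' r s := by
    have h : bc r (1 : A) * bc s (1 : A) = bc (r * s) (1 : A) := by rw [bc_mul, mul_one]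
    exact h.symm
  map_zero' := bc_zero_left 1
  map_add' r s := bc_add_left r s 1

lemma bcStr_injective : Function.Injective (A.bcStr R) := by
  let ret : A →ₗ[A.deg0] A.deg0 :=
    { toFun := fun a => ⟨A.projLin 0 a, by
        induction a using graded_induction A.isInternal with
        | hom i a ha =>
          change proj A.isInternal 0 a ∈ A.deg0
          by_cases hi : i = 0
          · subst hi
            rw [proj_of_mem _ ha]; exact ha
          · rw [proj_of_mem_ne _ ha hi]; exact zero_mem _
        | add a b ha hb => rw [map_add]; exact add_mem ha hb⟩
      map_add' := fun a b => Subtype.ext (map_add _ a b)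
      map_smul' := fun a b => Subtype.ext (map_smul _ a b) }
  let g : A.BC R →ₗ[A.deg0] R := (TensorProduct.rid A.deg0 R).toLinearMap ∘ₗ ret.lTensor R
  refine Function.LeftInverse.injective (g := g) fun r => ?_
  have h1 : ret 1 = 1 := Subtype.ext (proj_of_mem A.isInternal A.one_mem)
  change (TensorProduct.rid A.deg0 R) (r ⊗ₜ ret 1) = r
  rw [h1, TensorProduct.rid_tmul, one_smul]

lemma mem_bcGr_zero (x : A.baseChange R) :
    x ∈ (A.baseChange R).gr 0 ↔ ∃ r, A.bcStr R r = x := by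
  constructor
  · intro hx
    refine bcGr_induction (fun r a ha => ?_) (fun x y hx hy => ?_) hx
    · refine ⟨algebraMap A.deg0 R ⟨a, ha⟩ * r, ?_⟩
      change bc _ _ = _
      rw [← bc_deg0, mul_one]
    · obtain ⟨r, rfl⟩ := hx
      obtain ⟨s, rfl⟩ := hy
      exact ⟨r + s, map_add _ _ _⟩
  · rintro ⟨r, rfl⟩
    exact bc_mem r A.one_mem

end BaseChange

/-- The map induced on degree `0` parts. -/
def Hom.deg0 {A B : CDGAlg K} (f : Hom A B) : A.deg0 →+* B.deg0 where
  toFun a := ⟨f.toFun a, f.map_mem a.2⟩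
  map_one' := Subtype.ext (map_one _)
  map_mul' _ _ := Subtype.ext (map_mul _ _ _)
  map_zero' := Subtype.ext (map_zero _)
  map_add' _ _ := Subtype.ext (map_add _ _ _)

section BaseChangeMap

variable {A B : CDGAlg K} (f : Hom A B) {R S : Type u} [CommRing R] [CommRing S]
  [Algebra A.deg0 R] [Algebra B.deg0 S] (g : R →+* S)
  (hg : ∀ a, g (algebraMap A.deg0 R a) = algebraMap B.deg0 S (f.deg0 a))

/-- The map `r ⊗ a ↦ g r ⊗ f a` between base changes, as a map of rings. -/
def bcMapRing : A.BC R →+* B.BC S :=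
  letI : Algebra A.deg0 (S ⊗[B.deg0] B) :=
    ((algebraMap B.deg0 (S ⊗[B.deg0] B)).comp f.deg0).toAlgebra' fun a x => by
      exact Algebra.commutes (f.deg0 a) x
  (Algebra.TensorProduct.lift (R := A.deg0) (S := A.deg0) (A := R) (B := A) (C := S ⊗[B.deg0] B)
    { toRingHom := (Algebra.TensorProduct.includeLeftRingHom :
        S →+* S ⊗[B.deg0] B).comp g
      commutes' := fun a => by
        change g (algebraMap A.deg0 R a) ⊗ₜ[B.deg0] (1 : B) =
          (algebraMap B.deg0 S (f.deg0 a)) ⊗ₜ[B.deg0] (1 : B)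
        rw [hg] }
    { toRingHom := (Algebra.TensorProduct.includeRight :
        B →ₐ[B.deg0] S ⊗[B.deg0] B).toRingHom.comp f.toFun.toRingHom
      commutes' := fun a => by
        change (1 : S) ⊗ₜ[B.deg0] (f.toFun a) =
          (algebraMap B.deg0 S (f.deg0 a)) ⊗ₜ[B.deg0] (1 : B)
        rw [Algebra.algebraMap_eq_smul_one, TensorProduct.smul_tmul]
        congr 1
        exact (mul_one _).symm }
    (fun r a => by
      change (g r ⊗ₜ[B.deg0] (1 : B)) * ((1 : S) ⊗ₜ[B.deg0] f.toFun a) =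
        ((1 : S) ⊗ₜ[B.deg0] f.toFun a) * (g r ⊗ₜ[B.deg0] (1 : B))
      simp)).toRingHom

lemma bcMapRing_bc (r : R) (a : A) : bcMapRing f g hg (bc r a) = bc (g r) (f.toFun a) := by
  change (g r ⊗ₜ[B.deg0] (1 : B)) * ((1 : S) ⊗ₜ[B.deg0] f.toFun a) = g r ⊗ₜ[B.deg0] f.toFun a
  simp

/-- The morphism `r ⊗ a ↦ g r ⊗ f a` between base changes. -/
def baseChangeMap : Hom (A.baseChange R) (B.baseChange S) where
  toFun :=
    { toRingHom := bcMapRing f g hg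
      commutes' := fun c => by
        have h1 : algebraMap K (A.BC R) c = bc 1 (algebraMap K A c) := by
          rw [Algebra.algebraMap_eq_smul_one, Algebra.algebraMap_eq_smul_one, ← bc_one, K_smul_bc]
        have h2 : algebraMap K (B.BC S) c = bc 1 (algebraMap K B c) := by
          rw [Algebra.algebraMap_eq_smul_one, Algebra.algebraMap_eq_smul_one, ← bc_one, K_smul_bc]
        change bcMapRing f g hg (algebraMap K (A.BC R) c) = algebraMap K (B.BC S) c
        rw [h1, h2, bcMapRing_bc, map_one, AlgHom.commutes] }
  map_mem {i x} hx := by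
    change bcMapRing f g hg x ∈ B.bcGr S i
    refine bcGr_induction (fun r a ha => ?_) (fun x y hx hy => ?_) hx
    · rw [bcMapRing_bc]
      exact bc_mem _ (f.map_mem ha)
    · rw [map_add]
      exact add_mem hx hy
  map_d x := by
    change bcMapRing f g hg (bcMapLin A.dLin x) = bcMapLin B.dLin (bcMapRing f g hg x)
    induction x using bc_induction with
    | h r a =>
      rw [bcMapRing_bc, bcMapLin_bc, bcMapLin_bc, bcMapRing_bc]
      exact congrArg _ (f.map_d a)
    | add x y hx hy => rw [map_add, map_add, map_add, map_add, hx, hy]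

lemma baseChangeMap_bc (r : R) (a : A) :
    (baseChangeMap f g hg).toFun (bc r a) = (bc (g r) (f.toFun a) : B.BC S) :=
  bcMapRing_bc f g hg r a

lemma baseChangeMap_str (r : R) :
    (baseChangeMap f g hg).toFun (A.bcStr R r) = B.bcStr S (g r) := by
  refine (baseChangeMap_bc f g hg r 1).trans ?_
  rw [map_one]
  rfl

end BaseChangeMap

lemma baseChangeMap_id {A : CDGAlg K} {R : Type u} [CommRing R] [Algebra A.deg0 R] (g : R →+* R)
    (hg) (h : ∀ r, g r = r) : baseChangeMap (Hom.id A) g hg = Hom.id (A.baseChange R) := by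
  ext x
  refine bc_induction (p := fun x => (baseChangeMap (Hom.id A) g hg).toFun x = x)
    (fun r a => ?_) (fun x y hx hy => ?_) x
  · rw [baseChangeMap_bc, h]
    rfl
  · refine (map_add (baseChangeMap (Hom.id A) g hg).toFun x y).trans ?_
    exact congrArg₂ (fun x y : A.BC R => x + y) hx hy

lemma baseChangeMap_comp {A B C : CDGAlg K} {R S T : Type u} [CommRing R] [CommRing S] [CommRing T]
    [Algebra A.deg0 R] [Algebra B.deg0 S] [Algebra C.deg0 T] {f : Hom A B} {f' : Hom B C}
    {f'' : Hom A C} {g : R →+* S} {g' : S →+* T} {g'' : R →+* T} (hg) (hg') (hg'')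
    (hf : ∀ a, f'.toFun (f.toFun a) = f''.toFun a) (h : ∀ r, g' (g r) = g'' r) :
    (baseChangeMap f' g' hg').comp (baseChangeMap f g hg) = baseChangeMap f'' g'' hg'' := by
  ext x
  refine bc_induction (p := fun x => (baseChangeMap f' g' hg').toFun
    ((baseChangeMap f g hg).toFun x) = (baseChangeMap f'' g'' hg'').toFun x)
    (fun r a => ?_) (fun x y hx hy => ?_) x
  · rw [baseChangeMap_bc, baseChangeMap_bc, baseChangeMap_bc, hf, h]
  · refine (congrArg _ (map_add (baseChangeMap f g hg).toFun x y)).trans ?_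
    refine (map_add (baseChangeMap f' g' hg').toFun _ _).trans ?_
    refine Eq.trans ?_ (map_add (baseChangeMap f'' g'' hg'').toFun x y).symm
    exact congrArg₂ (fun x y : C.BC T => x + y) hx hy

section Localization

variable {A : CDGAlg K} {R S : Type u} [CommRing R] [CommRing S] [Algebra A.deg0 R]
  [Algebra A.deg0 S]

lemma baseChange_gr_induction {i : ℤ} {p : A.baseChange R → Prop}
    (h : ∀ r, ∀ a ∈ A.gr i, p (bc r a)) (add : ∀ x y : A.baseChange R, p x → p y → p (x + y))
    {x : A.baseChange R} (hx : x ∈ (A.baseChange R).gr i) : p x :=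
  bcGr_induction (p := p) h add hx

lemma bc_loc_surj (g : R →+* S) (hg) (f : R) (hs : ∀ s : S, ∃ n : ℕ, ∃ r, g r = g (f ^ n) * s)
    {i : ℤ} {b : A.baseChange S} (hb : b ∈ (A.baseChange S).gr i) :
    ∃ n : ℕ, ∃ a ∈ (A.baseChange R).gr i, (baseChangeMap (Hom.id A) g hg).toFun a =
      (baseChangeMap (Hom.id A) g hg).toFun (A.bcStr R (f ^ n)) * b := by
  set φ := (baseChangeMap (Hom.id A) g hg).toFun with hφ
  refine baseChange_gr_induction (p := fun b => ∃ n : ℕ, ∃ a ∈ (A.baseChange R).gr i,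
    φ a = φ (A.bcStr R (f ^ n)) * b) (fun s a ha => ?_) (fun x y hx hy => ?_) hb
  · obtain ⟨n, r, hr⟩ := hs s
    refine ⟨n, bc r a, bc_mem r ha, ?_⟩
    rw [hφ, baseChangeMap_bc, baseChangeMap_str, hr]
    refine Eq.trans ?_ (bc_mul (g (f ^ n)) s 1 a).symm
    rw [one_mul]
    rfl
  · obtain ⟨n, a, ha, h⟩ := hx
    obtain ⟨m, b, hb, h'⟩ := hy
    have hm (k : ℕ) {c : A.baseChange R} (hc : c ∈ (A.baseChange R).gr i) :
        A.bcStr R (f ^ k) * c ∈ (A.baseChange R).gr i := by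
      simpa using (A.baseChange R).mul_mem ((A.mem_bcGr_zero R _).2 ⟨f ^ k, rfl⟩) hc
    refine ⟨m + n, A.bcStr R (f ^ m) * a + A.bcStr R (f ^ n) * b, add_mem (hm m ha) (hm n hb), ?_⟩
    rw [map_add, map_mul, map_mul, h, h', ← mul_assoc, ← mul_assoc, ← map_mul φ, ← map_mul φ,
      ← map_mul, ← map_mul, ← pow_add, ← pow_add, add_comm n m]
    exact (mul_add _ _ _).symm

lemma bc_loc_inj (g : R →+* S) (hg : ∀ a, g (algebraMap A.deg0 R a) =
      algebraMap A.deg0 S ((Hom.id A).deg0 a)) (f : R)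
    (hloc : letI := g.toAlgebra; IsLocalization.Away f S)
    {a : A.baseChange R} (ha : (baseChangeMap (Hom.id A) g hg).toFun a = 0) :
    ∃ n : ℕ, A.bcStr R (f ^ n) * a = 0 := by
  let := g.toAlgebra
  have : IsScalarTower A.deg0 R S := IsScalarTower.of_algebraMap_eq fun a => (hg a).symm
  have : IsLocalizedModule (Submonoid.powers f) (Algebra.linearMap R S) :=
    (isLocalizedModule_iff_isLocalization' _ _).2 hloc
  let φ := TensorProduct.AlgebraTensorModule.rTensor A.deg0 A (Algebra.linearMap R S)
  have h0 : φ a = 0 := by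
    refine Eq.trans ?_ ha
    refine bc_induction (p := fun a => φ a = (baseChangeMap (Hom.id A) g hg).toFun a)
      (fun r a => ?_) (fun x y hx hy => ?_) a
    · rw [baseChangeMap_bc]
      rfl
    · refine (map_add φ x y).trans ?_
      refine Eq.trans ?_ (map_add (baseChangeMap (Hom.id A) g hg).toFun x y).symm
      exact congrArg₂ (fun x y : A.BC S => x + y) hx hy
  obtain ⟨⟨_, n, rfl⟩, h⟩ := (IsLocalizedModule.eq_zero_iff (Submonoid.powers f) φ).1 h0
  refine ⟨n, Eq.trans ?_ h⟩
  let ψ : R ⊗[A.deg0] A →ₗ[R] R ⊗[A.deg0] A := LinearMap.lsmul R _ (f ^ n)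
  refine bc_induction (p := fun a => (bc (f ^ n) 1 * a : A.BC R) = ψ a)
    (fun r a => ?_) (fun x y hx hy => ?_) a
  · refine (bc_mul (f ^ n) r 1 a).trans ?_
    rw [one_mul]
    rfl
  · refine (mul_add _ _ _).trans ?_
    refine Eq.trans ?_ (map_add ψ x y).symm
    exact congrArg₂ (fun x y : A.BC R => x + y) hx hy

end Localization

end CDGAlg

/-! ### The coordinate algebra of the space of actions -/

namespace DGAlg

variable {K : Type u} [Field K] (A : DGAlg K) (V : Type u) [AddCommGroup V] [Module K V]

/-- The space `V ⊗ V*`. For finite-dimensional `V`, the space `A ⊗ (V ⊗ V*)` is canonically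
`Hom(V, A ⊗ V)`, the space of generators of the coordinate algebra of `|Hom(A ⊗ V, V)|`. Its
element `a ⊗ (v ⊗ ξ)`, which is the map `w ↦ ξ(w) a ⊗ v`, is the matrix element
`μ ↦ ξ(μ(a ⊗ v))` of an indeterminate linear map `μ : A ⊗ V → V`. -/
abbrev VV (K V : Type u) [Field K] [AddCommGroup V] [Module K V] : Type u :=
  V ⊗[K] Module.Dual K V

/-- The relations that define the coordinate algebra of the space of actions of `A` on `V`, as a
quotient of the tensor algebra of `A ⊗ (V ⊗ V*)`: graded commutativity (which turns the tensor
algebra into the symmetric algebra of a graded vector space), and associativity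
`μ(ab ⊗ v) = μ(a ⊗ μ(b ⊗ v))`, written in matrix elements by means of any basis of `V`. -/
inductive ActRel :
    TensorAlgebra K (A ⊗[K] VV K V) → TensorAlgebra K (A ⊗[K] VV K V) → Prop
  | comm {i j : ℤ} {a b : A} (ha : a ∈ A.gr i) (hb : b ∈ A.gr j) (m n : VV K V) :
      ActRel
        (TensorAlgebra.ι K (a ⊗ₜ[K] m) * TensorAlgebra.ι K (b ⊗ₜ[K] n))
        ((i * j).negOnePow • (TensorAlgebra.ι K (b ⊗ₜ[K] n) * TensorAlgebra.ι K (a ⊗ₜ[K] m)))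
  | assoc (a b : A) (v : V) (ξ : Module.Dual K V) {n : ℕ} (e : Module.Basis (Fin n) K V) :
      ActRel
        (TensorAlgebra.ι K ((a * b) ⊗ₜ[K] (v ⊗ₜ[K] ξ)))
        (∑ k, TensorAlgebra.ι K (a ⊗ₜ[K] (e k ⊗ₜ[K] ξ)) *
          TensorAlgebra.ι K (b ⊗ₜ[K] (v ⊗ₜ[K] e.coord k)))

/-- The underlying algebra of the coordinate algebra of the space of actions of `A` on `V`. -/
def ActAlg : Type u := RingQuot (A.ActRel V)

instance : Ring (A.ActAlg V) := inferInstanceAs (Ring (RingQuot (A.ActRel V)))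

instance : Algebra K (A.ActAlg V) := inferInstanceAs (Algebra K (RingQuot (A.ActRel V)))

/-- The quotient map. -/
def actMk : TensorAlgebra K (A ⊗[K] VV K V) →ₐ[K] A.ActAlg V := RingQuot.mkAlgHom K (A.ActRel V)

lemma actMk_surjective : Function.Surjective (A.actMk V) := RingQuot.mkAlgHom_surjective K _

variable {A V} in
lemma actMk_rel {x y : TensorAlgebra K (A ⊗[K] VV K V)} (h : A.ActRel V x y) :
    A.actMk V x = A.actMk V y := RingQuot.mkAlgHom_rel K h

variable {V}

/-- The class of the generator `a ⊗ m`, as a bilinear map. -/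
def t : A →ₗ[K] VV K V →ₗ[K] A.ActAlg V :=
  (TensorProduct.mk K A (VV K V)).compr₂
    ((A.actMk V).toLinearMap ∘ₗ TensorAlgebra.ι K)

variable {A}

lemma t_apply (a : A) (m : VV K V) :
    A.t a m = A.actMk V (TensorAlgebra.ι K (a ⊗ₜ[K] m)) := rfl

lemma t_comm {i j : ℤ} {a b : A} (ha : a ∈ A.gr i) (hb : b ∈ A.gr j) (m n : VV K V) :
    A.t a m * A.t b n = (i * j).negOnePow • (A.t b n * A.t a m) := by
  have := actMk_rel (ActRel.comm ha hb m n)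
  rw [Units.smul_def, map_zsmul, map_mul, map_mul] at this
  exact this

lemma t_assoc (a b : A) (v : V) (ξ : Module.Dual K V) {n : ℕ} (e : Module.Basis (Fin n) K V) :
    A.t (a * b) (v ⊗ₜ[K] ξ) = ∑ k, A.t a (e k ⊗ₜ[K] ξ) * A.t b (v ⊗ₜ[K] e.coord k) := by
  have := actMk_rel (ActRel.assoc a b v ξ e)
  rw [map_sum] at this
  simp only [map_mul] at this
  exact this

/-- The universal property of the coordinate algebra, forgetting grading and differential. -/
def actLift {S : Type u} [Ring S] [Algebra K S] (f : A →ₗ[K] VV K V →ₗ[K] S)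
    (hc : ∀ {i j : ℤ} {a b : A}, a ∈ A.gr i → b ∈ A.gr j → ∀ m n : VV K V,
      f a m * f b n = (i * j).negOnePow • (f b n * f a m))
    (ha : ∀ (a b : A) (v : V) (ξ : Module.Dual K V) {n : ℕ} (e : Module.Basis (Fin n) K V),
      f (a * b) (v ⊗ₜ[K] ξ) = ∑ k, f a (e k ⊗ₜ[K] ξ) * f b (v ⊗ₜ[K] e.coord k)) :
    A.ActAlg V →ₐ[K] S :=
  RingQuot.liftAlgHom K ⟨TensorAlgebra.lift K (TensorProduct.lift f), by
    rintro x y (⟨h1, h2, m, n⟩ | ⟨a, b, v, ξ, e⟩)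
    · rw [Units.smul_def, map_zsmul, map_mul, map_mul]
      simpa [Units.smul_def] using hc h1 h2 m n
    · rw [map_sum]
      simpa using ha a b v ξ e⟩

lemma actLift_t {S : Type u} [Ring S] [Algebra K S] (f : A →ₗ[K] VV K V →ₗ[K] S) (hc) (ha)
    (a : A) (m : VV K V) : actLift f hc ha (A.t a m) = f a m := by
  refine (RingQuot.liftAlgHom_mkAlgHom_apply K _ _ _).trans ?_
  simp

/-- Monomials of degree `i` in the generators. -/
inductive Mono : ℤ → A.ActAlg V → Prop
  | one : Mono 0 1
  | mul {i j : ℤ} {a : A} (m : VV K V) {x : A.ActAlg V} (ha : a ∈ A.gr i) (hx : Mono j x) :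
      Mono (i + j) (A.t a m * x)

variable (A V) in
/-- The graded components of the coordinate algebra: a generator `a ⊗ m` with `a` of degree `i`
has degree `i`. -/
def actGr (i : ℤ) : Submodule K (A.ActAlg V) := Submodule.span K {x | Mono i x}

lemma Mono.mem {i : ℤ} {x : A.ActAlg V} (h : Mono i x) : x ∈ A.actGr V i :=
  Submodule.subset_span h

lemma Mono.mul' {i j : ℤ} {x y : A.ActAlg V} (hx : Mono i x) (hy : Mono j y) :
    Mono (i + j) (x * y) := by
  induction hx with
  | one => simpa using hy
  | mul m ha _ ih =>
    rw [add_assoc, mul_assoc]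
    exact .mul m ha ih

lemma Mono.t {i : ℤ} {a : A} (ha : a ∈ A.gr i) (m : VV K V) : Mono i (A.t a m) := by
  simpa using Mono.mul m ha .one

@[elab_as_elim]
lemma actGr_induction {i : ℤ} {p : A.ActAlg V → Prop} (h : ∀ x, Mono i x → p x) (zero : p 0)
    (add : ∀ x y, p x → p y → p (x + y)) (smul : ∀ (c : K) x, p x → p (c • x))
    {x : A.ActAlg V} (hx : x ∈ A.actGr V i) : p x :=
  Submodule.span_induction (p := fun x _ => p x) h zero (fun x y _ _ => add x y)
    (fun c x _ => smul c x) hx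

lemma actGr_mul {i j : ℤ} {x y : A.ActAlg V} (hx : x ∈ A.actGr V i) (hy : y ∈ A.actGr V j) :
    x * y ∈ A.actGr V (i + j) := by
  refine actGr_induction (fun x hx => ?_) ?_ (fun x x' h h' => ?_) (fun c x h => ?_) hx
  · refine actGr_induction (fun y hy => (hx.mul' hy).mem) ?_ (fun y y' h h' => ?_)
      (fun c y h => ?_) hy
    · rw [mul_zero]; exact zero_mem _
    · rw [mul_add]; exact add_mem h h'
    · rw [mul_smul_comm]; exact Submodule.smul_mem _ c h
  · rw [zero_mul]; exact zero_mem _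
  · rw [add_mul]; exact add_mem h h'
  · rw [smul_mul_assoc]; exact Submodule.smul_mem _ c h

lemma mem_iSup_actGr (x : A.ActAlg V) : x ∈ ⨆ i, A.actGr V i := by
  obtain ⟨x, rfl⟩ := A.actMk_surjective V x
  induction x using TensorAlgebra.induction with
  | algebraMap r =>
    rw [AlgHom.commutes, Algebra.algebraMap_eq_smul_one]
    exact Submodule.smul_mem _ _ (Submodule.mem_iSup_of_mem 0 Mono.one.mem)
  | ι y =>
    induction y using TensorProduct.induction_on with
    | zero => rw [map_zero, map_zero]; exact zero_mem _
    | tmul a m =>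
      rw [← t_apply]
      induction a using graded_induction A.isInternal with
      | hom i a ha => exact Submodule.mem_iSup_of_mem i (Mono.t ha m).mem
      | add a b ha hb => rw [map_add]; exact add_mem ha hb
    | add y z hy hz => rw [map_add, map_add]; exact add_mem hy hz
  | mul x y hx hy =>
    rw [map_mul]
    refine Submodule.iSup_induction (A.actGr V) (motive := fun z =>
      z * _ ∈ ⨆ i, A.actGr V i) hx (fun i x hx => ?_) ?_ (fun x x' h h' => ?_)
    · refine Submodule.iSup_induction (A.actGr V) (motive := fun z =>
        x * z ∈ ⨆ i, A.actGr V i) hy (fun j y hy => ?_) ?_ (fun y y' h h' => ?_)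
      · exact Submodule.mem_iSup_of_mem _ (actGr_mul hx hy)
      · rw [mul_zero]; exact zero_mem _
      · rw [mul_add]; exact add_mem h h'
    · rw [zero_mul]; exact zero_mem _
    · rw [add_mul]; exact add_mem h h'
  | add x y hx hy => rw [map_add]; exact add_mem hx hy

@[elab_as_elim]
lemma act_induction {p : A.ActAlg V → Prop} (h : ∀ i x, Mono i x → p x) (zero : p 0)
    (add : ∀ x y, p x → p y → p (x + y)) (smul : ∀ (c : K) x, p x → p (c • x))
    (x : A.ActAlg V) : p x :=
  Submodule.iSup_induction (A.actGr V) (motive := p) (mem_iSup_actGr x)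
    (fun i _ hx => actGr_induction (h i) zero add smul hx) zero add

/-- The coaction that records the degree, on generators. -/
def coactGen : A →ₗ[K] VV K V →ₗ[K] AddMonoidAlgebra (A.ActAlg V) ℤ :=
  glue (N := VV K V →ₗ[K] AddMonoidAlgebra (A.ActAlg V) ℤ) A.isInternal fun i =>
    LinearMap.mk₂ K (fun (a : A.gr i) (m : VV K V) => AddMonoidAlgebra.single i (A.t a.1 m))
      (fun a b m => by
        rw [Submodule.coe_add, map_add, LinearMap.add_apply, AddMonoidAlgebra.single_add])
      (fun c a m => by
        rw [Submodule.coe_smul, map_smul, LinearMap.smul_apply, AddMonoidAlgebra.smul_single])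
      (fun a m n => by rw [map_add, AddMonoidAlgebra.single_add])
      (fun c a m => by rw [map_smul, AddMonoidAlgebra.smul_single])

lemma coactGen_of_mem {i : ℤ} {a : A} (ha : a ∈ A.gr i) (m : VV K V) :
    coactGen a m = AddMonoidAlgebra.single i (A.t a m) := by
  rw [coactGen, glue_of_mem _ _ ha]
  rfl

/-- The coaction that records the degree. -/
def coact : A.ActAlg V →ₐ[K] AddMonoidAlgebra (A.ActAlg V) ℤ :=
  actLift (V := V) (S := AddMonoidAlgebra (A.ActAlg V) ℤ) coactGen
    (fun {i j a b} ha hb m n => by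
      rw [coactGen_of_mem ha, coactGen_of_mem hb, AddMonoidAlgebra.single_mul_single,
        AddMonoidAlgebra.single_mul_single, t_comm ha hb, add_comm i j, Units.smul_def,
        Units.smul_def, AddMonoidAlgebra.smul_single])
    (fun a b v ξ n e => by
      induction a using graded_induction A.isInternal with
      | hom i a ha =>
        induction b using graded_induction A.isInternal with
        | hom j b hb =>
          rw [coactGen_of_mem (A.mul_mem ha hb), t_assoc a b v ξ e]
          simp only [coactGen_of_mem ha, coactGen_of_mem hb, AddMonoidAlgebra.single_mul_single]
          exact map_sum (AddMonoidAlgebra.singleAddHom (i + j)) _ _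
        | add b b' h h' =>
          simp only [mul_add, map_add, LinearMap.add_apply, h, h', Finset.sum_add_distrib]
      | add a a' h h' =>
        simp only [add_mul, map_add, LinearMap.add_apply, h, h', Finset.sum_add_distrib])

lemma coact_mono {i : ℤ} {x : A.ActAlg V} (hx : Mono i x) :
    coact x = AddMonoidAlgebra.single i x := by
  induction hx with
  | one => rw [map_one]; rfl
  | mul m ha _ ih =>
    rw [map_mul, ih, coact, actLift_t, coactGen_of_mem ha, AddMonoidAlgebra.single_mul_single]

lemma coact_of_mem {i : ℤ} {x : A.ActAlg V} (hx : x ∈ A.actGr V i) :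
    coact x = AddMonoidAlgebra.single i x := by
  refine actGr_induction (fun x hx => coact_mono hx) ?_ (fun x y h h' => ?_) (fun c x h => ?_) hx
  · simp
  · rw [map_add, h, h', AddMonoidAlgebra.single_add]
  · rw [map_smul, h, AddMonoidAlgebra.smul_single]

lemma actGr_isInternal : DirectSum.IsInternal (A.actGr V) := by
  refine isInternal_of_proj _
    (fun i => (Finsupp.applyAddHom i).comp
      ((AddMonoidAlgebra.coeffAddEquiv.toAddMonoidHom).comp (coact (A := A) (V := V)).toAddMonoidHom))
    (fun i x hx => ?_) (fun i j hj x hx => ?_) mem_iSup_actGr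
  · change (coact x).coeff i = x
    rw [coact_of_mem hx, AddMonoidAlgebra.coeff_single, Finsupp.single_eq_same]
  · change (coact x).coeff i = 0
    rw [coact_of_mem hx, AddMonoidAlgebra.coeff_single, Finsupp.single_eq_of_ne hj.symm]

variable (A) in
/-- The parity operator, `a ↦ (-1)^i a` in degree `i`. -/
def sgn : A →ₗ[K] A := glue A.isInternal fun i => (i.negOnePow : ℤ) • (A.gr i).subtype

lemma sgn_of_mem {i : ℤ} {a : A} (ha : a ∈ A.gr i) : A.sgn a = (i.negOnePow : ℤ) • a := by
  rw [sgn, glue_of_mem _ _ ha]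
  rfl

lemma sgn_mul (a b : A) : A.sgn (a * b) = A.sgn a * A.sgn b := by
  induction a using graded_induction A.isInternal with
  | hom i a ha =>
    induction b using graded_induction A.isInternal with
    | hom j b hb =>
      rw [sgn_of_mem ha, sgn_of_mem hb, sgn_of_mem (A.mul_mem ha hb), Int.negOnePow_add,
        smul_mul_smul_comm, Units.val_mul]
    | add b b' h h' => rw [mul_add, map_add, map_add, mul_add, h, h']
  | add a a' h h' => rw [add_mul, map_add, map_add, add_mul, h, h']

lemma d_mul_sgn (a b : A) : A.d (a * b) = A.d a * b + A.sgn a * A.d b := by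
  induction a using graded_induction A.isInternal with
  | hom i a ha => rw [A.d_mul ha, sgn_of_mem ha, Units.smul_def, smul_mul_assoc]
  | add a a' h h' =>
    rw [add_mul, map_add, map_add, map_add, add_mul, add_mul, h, h']
    abel

/-- The matrix with the parity operator and the differential, on generators. -/
def actMatGen : A →ₗ[K] VV K V →ₗ[K] Matrix (Fin 2) (Fin 2) (A.ActAlg V) :=
  LinearMap.mk₂ K (fun a m => !![A.t (A.sgn a) m, A.t (A.d a) m; 0, A.t a m])
    (fun a b m => by ext i j; fin_cases i <;> fin_cases j <;> simp)
    (fun c a m => by ext i j; fin_cases i <;> fin_cases j <;> simp)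
    (fun a m n => by ext i j; fin_cases i <;> fin_cases j <;> simp)
    (fun c a m => by ext i j; fin_cases i <;> fin_cases j <;> simp)

lemma actMatGen_apply (a : A) (m : VV K V) :
    actMatGen a m = !![A.t (A.sgn a) m, A.t (A.d a) m; 0, A.t a m] := rfl

section Matrices

variable {S : Type u} [Ring S]

lemma mat_mul (a b c a' b' c' : S) :
    !![a, b; 0, c] * !![a', b'; 0, c'] = !![a * a', a * b' + b * c'; 0, c * c'] := by
  simp

lemma mat_sum {n : ℕ} (f g h : Fin n → S) :
    ∑ k, !![f k, g k; 0, h k] = !![∑ k, f k, ∑ k, g k; 0, ∑ k, h k] := by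
  ext i j
  rw [Matrix.sum_apply]
  fin_cases i <;> fin_cases j <;> simp

lemma mat_comm (p q r : ℤˣ) (x y x' y' : S) (h1 : x * y = r • (y * x))
    (h2 : x * y' = (r * p) • (y' * x)) (h3 : x' * y = (r * q) • (y * x')) :
    !![(p : ℤ) • x, x'; 0, x] * !![(q : ℤ) • y, y'; 0, y] =
      r • (!![(q : ℤ) • y, y'; 0, y] * !![(p : ℤ) • x, x'; 0, x]) := by
  rw [mat_mul, mat_mul]
  have e : ∀ a b c : S, r • !![a, b; 0, c] = !![r • a, r • b; 0, r • c] := by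
    intro a b c
    ext i j
    fin_cases i <;> fin_cases j <;> simp
  rw [e, h1, h3]
  rcases Int.units_eq_one_or p with rfl | rfl <;> rcases Int.units_eq_one_or q with rfl | rfl <;>
    rcases Int.units_eq_one_or r with rfl | rfl <;>
    simp_all [add_comm]

end Matrices

/-- The algebra map `x ↦ !![± x, d x; 0, x]` that encodes the differential: it is multiplicative
precisely because `d` is a derivation with signs. -/
def actMat : A.ActAlg V →ₐ[K] Matrix (Fin 2) (Fin 2) (A.ActAlg V) :=
  actLift (V := V) (S := Matrix (Fin 2) (Fin 2) (A.ActAlg V)) actMatGen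
    (fun {i j a b} ha hb m n => by
      have e2 := t_comm ha (A.d_mem hb) m n
      have e3 := t_comm (A.d_mem ha) hb m n
      rw [mul_add, mul_one, Int.negOnePow_add] at e2
      rw [add_mul, one_mul, Int.negOnePow_add] at e3
      rw [actMatGen_apply, actMatGen_apply, sgn_of_mem ha, sgn_of_mem hb, map_zsmul, map_zsmul]
      exact mat_comm _ _ _ _ _ _ _ (t_comm ha hb m n) e2 e3)
    (fun a b v ξ n e => by
      simp only [actMatGen_apply, mat_mul, mat_sum]
      rw [sgn_mul, d_mul_sgn, map_add, LinearMap.add_apply, t_assoc _ _ v ξ e, t_assoc _ _ v ξ e,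
        t_assoc _ _ v ξ e, t_assoc _ _ v ξ e, Finset.sum_add_distrib, add_comm])

lemma actMat_t (a : A) (m : VV K V) :
    actMat (A.t a m) = !![A.t (A.sgn a) m, A.t (A.d a) m; 0, A.t a m] := actLift_t _ _ _ a m

variable (A V) in
/-- The differential of the coordinate algebra: the derivation (with signs) that extends the
differential `a ⊗ m ↦ da ⊗ m` of the space of generators. -/
def actD : A.ActAlg V →ₗ[K] A.ActAlg V :=
  (Matrix.entryLinearMap K (A.ActAlg V) (0 : Fin 2) (1 : Fin 2)) ∘ₗ (actMat (A := A)).toLinearMap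

lemma actMat_mono {i : ℤ} {x : A.ActAlg V} (hx : Mono i x) :
    actMat x = !![(i.negOnePow : ℤ) • x, A.actD V x; 0, x] := by
  have key : actMat x 0 0 = (i.negOnePow : ℤ) • x ∧ actMat x 1 0 = 0 ∧ actMat x 1 1 = x := by
    induction hx with
    | one => simp [map_one]
    | mul m ha _ ih =>
      obtain ⟨h1, h2, h3⟩ := ih
      rw [map_mul, actMat_t]
      simp only [Matrix.mul_apply, Fin.sum_univ_two, h1, h2, h3]
      simp only [Matrix.of_apply, Matrix.cons_val', Matrix.cons_val_zero, Matrix.cons_val_one,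
        Matrix.cons_val_fin_one, mul_zero, add_zero, zero_mul, zero_add, and_true]
      rw [sgn_of_mem ha, map_zsmul, LinearMap.smul_apply, smul_mul_smul_comm, Int.negOnePow_add,
        Units.val_mul]
  obtain ⟨h1, h2, h3⟩ := key
  ext k l
  fin_cases k <;> fin_cases l
  · exact h1
  · rfl
  · exact h2
  · exact h3

lemma actD_t (a : A) (m : VV K V) : A.actD V (A.t a m) = A.t (A.d a) m := by
  change actMat (A.t a m) 0 1 = _
  rw [actMat_t]
  rfl

lemma actD_mono_mul {i : ℤ} {x : A.ActAlg V} (hx : Mono i x) (y : A.ActAlg V) :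
    A.actD V (x * y) = A.actD V x * y + (i.negOnePow : ℤ) • (x * A.actD V y) := by
  refine act_induction (fun j y hy => ?_) ?_ (fun y y' h h' => ?_) (fun c y h => ?_) y
  · change actMat (x * y) 0 1 = _
    rw [map_mul, actMat_mono hx, actMat_mono hy]
    rw [mat_mul, add_comm, ← smul_mul_assoc]
    rfl
  · simp
  · rw [mul_add, map_add, map_add, h, h', mul_add, mul_add, smul_add]
    abel
  · rw [mul_smul_comm, map_smul, map_smul, h, mul_smul_comm, mul_smul_comm, smul_add,
      smul_comm c]

lemma actD_one : A.actD V 1 = 0 := by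
  change actMat (1 : A.ActAlg V) 0 1 = 0
  rw [map_one]
  simp

lemma actD_mono_mem {i : ℤ} {x : A.ActAlg V} (hx : Mono i x) : A.actD V x ∈ A.actGr V (i + 1) := by
  induction hx with
  | one => rw [actD_one]; exact zero_mem _
  | @mul i j a m x ha hx ih =>
    rw [actD_mono_mul (Mono.t ha m), actD_t]
    refine add_mem ?_ (Submodule.smul_of_tower_mem _ _ ?_)
    · rw [add_right_comm]
      exact actGr_mul (Mono.t (A.d_mem ha) m).mem hx.mem
    · rw [add_assoc]
      exact actGr_mul (Mono.t ha m).mem ih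

lemma actD_actD_mono {i : ℤ} {x : A.ActAlg V} (hx : Mono i x) : A.actD V (A.actD V x) = 0 := by
  induction hx with
  | one => rw [actD_one, map_zero]
  | @mul i j a m x ha hx ih =>
    rw [actD_mono_mul (Mono.t ha m), actD_t, map_add, map_zsmul, actD_mono_mul (Mono.t ha m),
      actD_mono_mul (Mono.t (A.d_mem ha) m), actD_t, actD_t, A.d_d, ih, Int.negOnePow_succ]
    simp

lemma t_mono_comm {i j : ℤ} {a : A} (ha : a ∈ A.gr i) (m : VV K V) {y : A.ActAlg V}
    (hy : Mono j y) : A.t a m * y = ((i * j).negOnePow : ℤ) • (y * A.t a m) := by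
  induction hy with
  | one => simp
  | @mul j k b n y hb hy ih =>
    rw [← mul_assoc, t_comm ha hb, Units.smul_def, smul_mul_assoc, mul_assoc, ih, mul_smul_comm,
      smul_smul, mul_add, Int.negOnePow_add, Units.val_mul, mul_assoc]

lemma mono_comm {i j : ℤ} {x y : A.ActAlg V} (hx : Mono i x) (hy : Mono j y) :
    x * y = ((i * j).negOnePow : ℤ) • (y * x) := by
  induction hx with
  | one => simp
  | @mul i k a m x ha hx ih =>
    rw [mul_assoc, ih, mul_smul_comm, ← mul_assoc, t_mono_comm ha m hy, smul_mul_assoc, smul_smul,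
      add_mul, Int.negOnePow_add, Units.val_mul, mul_assoc, mul_comm]

lemma mono_pos {i : ℤ} {x : A.ActAlg V} (hx : Mono i x) (hi : 0 < i) : x = 0 := by
  induction hx with
  | one => exact absurd hi (lt_irrefl 0)
  | @mul i j a m x ha hx ih =>
    by_cases hj : 0 < j
    · rw [ih hj, mul_zero]
    · rw [A.gr_pos i (by omega), Submodule.mem_bot] at ha
      rw [ha]
      simp

variable (A V) in
/-- The coordinate dg-algebra of the space of actions of `A` on `V`. -/
def actCoord : CDGAlg K where
  carrier := A.ActAlg V
  gr := A.actGr V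
  isInternal := actGr_isInternal
  gr_pos i hi := by
    rw [eq_bot_iff]
    intro x hx
    refine actGr_induction (fun x hx => ?_) (zero_mem _) (fun x y h h' => add_mem h h')
      (fun c x h => Submodule.smul_mem _ c h) hx
    rw [mono_pos hx hi]
    exact zero_mem _
  one_mem := Mono.one.mem
  mul_mem := actGr_mul
  mul_comm {i j x y} hx hy := by
    rw [Units.smul_def]
    refine actGr_induction (fun x hx => ?_) ?_ (fun x x' h h' => ?_) (fun c x h => ?_) hx
    · refine actGr_induction (fun y hy => mono_comm hx hy) ?_ (fun y y' h h' => ?_)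
        (fun c y h => ?_) hy
      · simp
      · rw [mul_add, add_mul, smul_add, h, h']
      · rw [mul_smul_comm, smul_mul_assoc, h, smul_comm c]
    · simp
    · rw [mul_add, add_mul, smul_add, h, h']
    · rw [mul_smul_comm, smul_mul_assoc, h, smul_comm c]
  d := A.actD V
  d_mem {i x} hx := by
    refine actGr_induction (fun x hx => actD_mono_mem hx) ?_ (fun x y h h' => ?_)
      (fun c x h => ?_) hx
    · rw [map_zero]; exact zero_mem _
    · rw [map_add]; exact add_mem h h'
    · rw [map_smul]; exact Submodule.smul_mem _ c h
  d_d x := by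
    refine act_induction (fun j y hy => actD_actD_mono hy) ?_ (fun y y' h h' => ?_)
      (fun c y h => ?_) x
    · simp
    · rw [map_add, map_add, h, h', add_zero]
    · rw [map_smul, map_smul, h, smul_zero]
  d_mul {i x} hx y := by
    rw [Units.smul_def]
    refine actGr_induction (fun x hx => actD_mono_mul hx y) ?_ (fun x x' h h' => ?_)
      (fun c x h => ?_) hx
    · simp
    · rw [add_mul, map_add, map_add, h, h', add_mul, add_mul, smul_add]
      abel
    · rw [smul_mul_assoc, map_smul, map_smul, h, smul_mul_assoc, smul_mul_assoc, smul_add,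
        smul_comm c]

variable {B : DGAlg K}

/-- The algebra map between coordinate algebras induced by a morphism of dg-algebras. -/
def actMapAlg (f : Hom A B) : A.ActAlg V →ₐ[K] B.ActAlg V :=
  actLift (B.t ∘ₗ (f.toFun : A →ₗ[K] B))
    (fun ha hb m n => t_comm (f.map_mem ha) (f.map_mem hb) m n)
    (fun a b v ξ n e => by
      change B.t (f.toFun (a * b)) _ = _
      rw [map_mul]
      exact t_assoc _ _ v ξ e)

lemma actMapAlg_t (f : Hom A B) (a : A) (m : VV K V) :
    actMapAlg f (A.t a m) = B.t (f.toFun a) m := actLift_t _ _ _ a m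

lemma actMapAlg_mono (f : Hom A B) {i : ℤ} {x : A.ActAlg V} (hx : Mono i x) :
    Mono i (actMapAlg f x) := by
  induction hx with
  | one => rw [map_one]; exact .one
  | mul m ha _ ih =>
    rw [map_mul, actMapAlg_t]
    exact .mul m (f.map_mem ha) ih

variable (V) in
/-- The morphism of coordinate dg-algebras induced by a morphism of dg-algebras `f`; it sends the
generator `a ⊗ m` to `f a ⊗ m`. -/
def actCoordMap (f : Hom A B) : CDGAlg.Hom (A.actCoord V) (B.actCoord V) where
  toFun := actMapAlg f
  map_mem {i x} hx := by
    change actMapAlg f x ∈ B.actGr V i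
    refine actGr_induction (fun x hx => (actMapAlg_mono f hx).mem) ?_ (fun x y h h' => ?_)
      (fun c x h => ?_) hx
    · rw [map_zero]; exact zero_mem _
    · rw [map_add]; exact add_mem h h'
    · rw [map_smul]; exact Submodule.smul_mem _ c h
  map_d x := by
    change actMapAlg f (A.actD V x) = B.actD V (actMapAlg f x)
    refine act_induction (fun j y hy => ?_) ?_ (fun y y' h h' => ?_) (fun c y h => ?_) x
    · induction hy with
      | one => rw [actD_one, map_one, actD_one, map_zero]
      | @mul i j a m y ha hy ih =>
        rw [actD_mono_mul (Mono.t ha m), actD_t, map_add, map_zsmul, map_mul, map_mul, map_mul, ih,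
          actMapAlg_t, actMapAlg_t, actD_mono_mul (Mono.t (f.map_mem ha) m), actD_t, f.map_d]
    · simp
    · rw [map_add, map_add, map_add, map_add, h, h']
    · rw [map_smul, map_smul, map_smul, map_smul, h]

end DGAlg

/-! ### Dg-schemes -/

/-- A dg-scheme over `K`: an ordinary scheme `X` with a sheaf `𝒪` of `ℤ₋`-graded commutative
dg-algebras whose degree `0` part is the structure sheaf of `X` and whose graded components are
quasi-coherent. As a quasi-coherent sheaf is the same as the system of its sections over the
affine open subschemes, `𝒪` is given by its sections over these; quasi-coherence says that the
restriction to a basic open subset `D(f)` is the localization away from `f`. -/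
structure DGScheme (K : Type u) [Field K] where
  /-- The underlying ordinary scheme. -/
  X : Scheme.{u}
  /-- The sections of the structure sheaf of dg-algebras. -/
  O : X.affineOpens → CDGAlg K
  /-- Restriction maps. -/
  res : ∀ {U V : X.affineOpens}, U ≤ V → CDGAlg.Hom (O V) (O U)
  res_id : ∀ U : X.affineOpens, res (le_refl U) = CDGAlg.Hom.id (O U)
  res_comp : ∀ {U V W : X.affineOpens} (h : U ≤ V) (h' : V ≤ W),
    (res h).comp (res h') = res (h.trans h')
  /-- The identification of the structure sheaf of `X` with the degree `0` part of `𝒪`. -/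
  str : ∀ U : X.affineOpens, Γ(X, U.1) →+* O U
  str_injective : ∀ U, Function.Injective (str U)
  mem_gr_zero : ∀ (U : X.affineOpens) (x : O U), x ∈ (O U).gr 0 ↔ ∃ r, str U r = x
  res_str : ∀ {U V : X.affineOpens} (h : U ≤ V) (r : Γ(X, V.1)),
    (res h).toFun (str V r) = str U (X.presheaf.map (homOfLE h).op r)
  qc_surj : ∀ (V : X.affineOpens) (f : Γ(X, V.1)) (i : ℤ) (b : O (X.affineBasicOpen f)),
    b ∈ (O (X.affineBasicOpen f)).gr i → ∃ n : ℕ, ∃ a ∈ (O V).gr i,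
      (res (X.affineBasicOpen_le f)).toFun a =
        (res (X.affineBasicOpen_le f)).toFun (str V (f ^ n)) * b
  qc_inj : ∀ (V : X.affineOpens) (f : Γ(X, V.1)) (i : ℤ), ∀ a ∈ (O V).gr i,
    (res (X.affineBasicOpen_le f)).toFun a = 0 → ∃ n : ℕ, str V (f ^ n) * a = 0

namespace DGScheme

lemma mem_of_unit {R : Type u} [CommRing R] {I : Ideal R} {u x b : R} (hu : IsUnit u)
    (h : x = u * b) (hx : x ∈ I) : b ∈ I := by
  obtain ⟨v, hv⟩ := hu.exists_left_inv
  have hb : b = v * x := by rw [h, ← mul_assoc, hv, one_mul]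
  rw [hb]
  exact I.mul_mem_left _ hx

lemma appTop_map {X Y : Scheme.{u}} (f : X ⟶ Y) (U : X.Opens) :
    f.appTop ≫ X.presheaf.map (homOfLE le_top).op = f.appLE ⊤ U le_top := rfl

lemma exists_pow_mul (X : Scheme.{u}) (V : X.affineOpens) (f : Γ(X, V.1))
    (s : Γ(X, (X.affineBasicOpen f).1)) :
    letI φ : Γ(X, V.1) →+* Γ(X, (X.affineBasicOpen f).1) :=
      (X.presheaf.map (homOfLE (X.affineBasicOpen_le f)).op).hom
    ∃ n : ℕ, ∃ r, φ r = φ (f ^ n) * s := by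
  have hloc := V.2.isLocalization_basicOpen f
  let _ : Algebra Γ(X, V.1) Γ(X, (X.affineBasicOpen f).1) :=
    (X.presheaf.map (homOfLE (X.affineBasicOpen_le f)).op).hom.toAlgebra
  have : IsLocalization.Away f Γ(X, (X.affineBasicOpen f).1) := hloc
  obtain ⟨n, r, h⟩ := IsLocalization.Away.surj f s
  refine ⟨n, r, ?_⟩
  rw [mul_comm, map_pow]
  exact h.symm

variable {K : Type u} [Field K]

/-- A morphism of dg-schemes: a morphism of the underlying schemes together with a morphism of
sheaves of dg-algebras from the pullback of the structure sheaf, extending the one in degree `0`;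
it is given by compatible maps of sections `𝒪_Y(V) → 𝒪_X(U)` for affine open `U` and `V` such
that `U` is mapped to `V`. -/
structure Hom (X Y : DGScheme K) where
  /-- The underlying morphism of schemes. -/
  base : X.X ⟶ Y.X
  /-- The maps of sections. -/
  map : ∀ (V : Y.X.affineOpens) (U : X.X.affineOpens), U.1 ≤ base ⁻¹ᵁ V.1 →
    CDGAlg.Hom (Y.O V) (X.O U)
  map_str : ∀ V U h (r : Γ(Y.X, V.1)),
    (map V U h).toFun (Y.str V r) = X.str U (base.appLE V.1 U.1 h r)
  map_res : ∀ {V V' : Y.X.affineOpens} {U U' : X.X.affineOpens} (hV : V ≤ V') (hU : U' ≤ U)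
    (h : U.1 ≤ base ⁻¹ᵁ V.1) (h' : U'.1 ≤ base ⁻¹ᵁ V'.1),
    (X.res hU).comp ((map V U h).comp (Y.res hV)) = map V' U' h'

lemma str_mem (X : DGScheme K) (U : X.X.affineOpens) (r : Γ(X.X, U.1)) :
    X.str U r ∈ (X.O U).gr 0 := (X.mem_gr_zero U _).2 ⟨r, rfl⟩

lemma d_str_mul (X : DGScheme K) (U : X.X.affineOpens) (r : Γ(X.X, U.1)) (y : X.O U) :
    (X.O U).d (X.str U r * y) = X.str U r * (X.O U).d y := by
  have h1 : (X.O U).d (X.str U r) = 0 := (X.O U).d_deg0 ⟨_, X.str_mem U r⟩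
  rw [(X.O U).d_mul (X.str_mem U r), h1]
  simp

lemma res_eq_mul (X : DGScheme K) {W U : X.X.affineOpens} (hle : W ≤ U) {a g : Γ(X.X, U.1)}
    {b : Γ(X.X, W.1)} {y : X.O U} {y' : X.O W} (hb : (X.O W).d y' = X.str W b)
    (ha : X.str U a = (X.O U).d y)
    (h : (X.res hle).toFun y = (X.res hle).toFun (X.str U g) * y') :
    X.X.presheaf.map (homOfLE hle).op a = X.X.presheaf.map (homOfLE hle).op g * b := by
  apply X.str_injective W
  rw [map_mul, ← X.res_str hle, ← X.res_str hle, ha, (X.res hle).map_d, h, X.res_str hle,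
    d_str_mul, hb]

/-- The ideal sheaf of `π₀(X)` in `X`, the image of `d : 𝒪⁻¹ → 𝒪⁰`. -/
def pi0Ideal (X : DGScheme K) : X.X.IdealSheafData where
  ideal U :=
    { carrier := {a | ∃ y ∈ (X.O U).gr (-1), (X.O U).d y = X.str U a}
      add_mem' := by
        rintro a b ⟨y, hy, h⟩ ⟨z, hz, h'⟩
        exact ⟨y + z, add_mem hy hz, by rw [map_add, map_add, h, h']⟩
      zero_mem' := ⟨0, zero_mem _, by rw [map_zero, map_zero]⟩
      smul_mem' := by
        rintro r a ⟨y, hy, h⟩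
        refine ⟨X.str U r * y, by simpa using (X.O U).mul_mem (X.str_mem U r) hy, ?_⟩
        rw [d_str_mul, h, smul_eq_mul, map_mul] }
  map_ideal_basicOpen U f := by
    have hle : X.X.affineBasicOpen f ≤ U := X.X.affineBasicOpen_le f
    apply le_antisymm
    · refine Ideal.map_le_iff_le_comap.2 ?_
      rintro a ⟨y, hy, h⟩
      refine ⟨(X.res hle).toFun y, (X.res hle).map_mem hy, ?_⟩
      rw [← (X.res hle).map_d, h, X.res_str hle]
      rfl
    · rintro b ⟨y', hy', h'⟩
      obtain ⟨n, y, hy, h⟩ := X.qc_surj U f (-1) y' hy'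
      have hd : (X.O U).d y ∈ (X.O U).gr 0 := by simpa using (X.O U).d_mem hy
      obtain ⟨a, ha⟩ := (X.mem_gr_zero U _).1 hd
      have key := X.res_eq_mul hle h' ha h
      have hu : IsUnit (X.X.presheaf.map (homOfLE hle).op (f ^ n)) := by
        rw [map_pow]
        exact (RingedSpace.isUnit_res_basicOpen X.X.toRingedSpace f).pow n
      exact mem_of_unit hu key (Ideal.mem_map_of_mem _ ⟨y, hy, ha.symm⟩)

/-- The degree `0` truncation `π₀(X) = Spec H⁰(𝒪)`, a closed subscheme of `X`. -/
def pi0 (X : DGScheme K) : Scheme.{u} := X.pi0Ideal.subscheme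

/-- The closed immersion of `π₀(X)` in `X`. -/
def pi0ι (X : DGScheme K) : X.pi0 ⟶ X.X := X.pi0Ideal.subschemeι

lemma Hom.pi0Ideal_le {X Y : DGScheme K} (f : Hom X Y) :
    Y.pi0Ideal ≤ X.pi0Ideal.map f.base := by
  refine Scheme.IdealSheafData.le_ofIdeals_iff.2 fun V a ha => ?_
  obtain ⟨y, hy, hya⟩ := ha
  change (X.pi0Ideal.subschemeι ≫ f.base).app V.1 a = 0
  refine TopCat.Presheaf.section_ext X.pi0Ideal.subscheme.sheaf _ _ _ fun x hx => ?_
  obtain ⟨U, hU, hxU, hUV⟩ := Opens.isBasis_iff_nbhd.1 X.X.isBasis_affineOpens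
    (U := f.base ⁻¹ᵁ V.1) (x := X.pi0Ideal.subschemeι x) hx
  let U' : X.X.affineOpens := ⟨U, hU⟩
  have hmem : f.base.appLE V.1 U hUV a ∈ X.pi0Ideal.ideal U' := by
    refine ⟨(f.map V U' hUV).toFun y, (f.map V U' hUV).map_mem hy, ?_⟩
    rw [← (f.map V U' hUV).map_d, hya, f.map_str V U' hUV]
  have h0 : X.pi0Ideal.subschemeι.app U (f.base.appLE V.1 U hUV a) = 0 := by
    rw [← X.pi0Ideal.ker_subschemeι_app U'] at hmem
    exact hmem
  have hle : X.pi0Ideal.subschemeι ⁻¹ᵁ U ≤ (X.pi0Ideal.subschemeι ≫ f.base) ⁻¹ᵁ V.1 :=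
    fun z hz => hUV hz
  have h1 : X.pi0Ideal.subscheme.presheaf.map (homOfLE hle).op
      ((X.pi0Ideal.subschemeι ≫ f.base).app V.1 a) = 0 := by
    rw [← h0, ← CommRingCat.comp_apply, ← CommRingCat.comp_apply, Scheme.Hom.app_eq_appLE,
      Scheme.Hom.app_eq_appLE, Scheme.Hom.appLE_map, Scheme.Hom.appLE_comp_appLE]
  have h2 := TopCat.Presheaf.germ_res_apply X.pi0Ideal.subscheme.presheaf (homOfLE hle) x hxU
    ((X.pi0Ideal.subschemeι ≫ f.base).app V.1 a)
  rw [h1, map_zero] at h2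
  exact h2.symm.trans (map_zero _).symm

/-- The induced morphism `π₀(X) → π₀(Y)`. -/
def Hom.pi0 {X Y : DGScheme K} (f : Hom X Y) : X.pi0 ⟶ Y.pi0 :=
  Scheme.IdealSheafData.subschemeMap _ _ f.base f.pi0Ideal_le

/-- A morphism `f : X → Y` of dg-schemes is a quasi-isomorphism if it induces an isomorphism of
the graded schemes `(π₀, H(𝒪))`: the morphism `π₀(X) → π₀(Y)` is an isomorphism, and through it
`H(𝒪_Y)` is isomorphic to `H(𝒪_X)`. The cohomology sheaves `Hⁱ(𝒪)` are quasi-coherent sheaves on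
`π₀`, whose sections over `π₀(X) ∩ U` are `Hⁱ(𝒪_X(U))` for affine open `U`; hence the second
condition says that `π₀(X)` is covered by open subsets of the form `π₀(X) ∩ U = π₀(X) ∩ f⁻¹(V)`
with `U` and `V` affine open such that `Hⁱ(𝒪_Y(V)) → Hⁱ(𝒪_X(U))` is bijective for all `i`. -/
structure Hom.IsQuasiIso {X Y : DGScheme K} (f : Hom X Y) : Prop where
  isIso_pi0 : IsIso f.pi0
  bijective_H : ∀ x : X.pi0, ∃ (V : Y.X.affineOpens) (U : X.X.affineOpens)
    (h : U.1 ≤ f.base ⁻¹ᵁ V.1), x ∈ X.pi0ι ⁻¹ᵁ U.1 ∧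
      X.pi0ι ⁻¹ᵁ U.1 = X.pi0ι ⁻¹ᵁ (f.base ⁻¹ᵁ V.1) ∧
      ∀ i, Function.Bijective ((f.map V U h).H i)

/-- The ring map from `A⁰` to the sections of the structure sheaf of `Spec A⁰`. -/
def specRing (A : CDGAlg K) (U : (Spec (CommRingCat.of A.deg0)).Opens) :
    A.deg0 →+* Γ(Spec (CommRingCat.of A.deg0), U) :=
  ((Scheme.ΓSpecIso (CommRingCat.of A.deg0)).inv ≫
    (Spec (CommRingCat.of A.deg0)).presheaf.map (homOfLE le_top).op).hom

instance specAlgebra (A : CDGAlg K) (U : (Spec (CommRingCat.of A.deg0)).Opens) :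
    Algebra A.deg0 Γ(Spec (CommRingCat.of A.deg0), U) := (specRing A U).toAlgebra

lemma specRing_res (A : CDGAlg K) {U V : (Spec (CommRingCat.of A.deg0)).Opens} (h : U ≤ V)
    (a : A.deg0) :
    (Spec (CommRingCat.of A.deg0)).presheaf.map (homOfLE h).op
      (algebraMap A.deg0 Γ(Spec (CommRingCat.of A.deg0), V) a) =
    algebraMap A.deg0 Γ(Spec (CommRingCat.of A.deg0), U) a := by
  change (Spec (CommRingCat.of A.deg0)).presheaf.map (homOfLE h).op
    (((Scheme.ΓSpecIso (CommRingCat.of A.deg0)).inv ≫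
    (Spec (CommRingCat.of A.deg0)).presheaf.map (homOfLE le_top).op) a) =
    ((Scheme.ΓSpecIso (CommRingCat.of A.deg0)).inv ≫
    (Spec (CommRingCat.of A.deg0)).presheaf.map (homOfLE le_top).op) a
  rw [← CommRingCat.comp_apply, Category.assoc, ← Functor.map_comp]
  rfl

lemma specRing_map {A B : CDGAlg K} (f : CDGAlg.Hom A B)
    (V : (Spec (CommRingCat.of A.deg0)).Opens) (U : (Spec (CommRingCat.of B.deg0)).Opens)
    (h : U ≤ Spec.map (CommRingCat.ofHom f.deg0) ⁻¹ᵁ V) (a : A.deg0) :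
    (Spec.map (CommRingCat.ofHom f.deg0)).appLE V U h
      (algebraMap A.deg0 Γ(Spec (CommRingCat.of A.deg0), V) a) =
    algebraMap B.deg0 Γ(Spec (CommRingCat.of B.deg0), U) (f.deg0 a) := by
  have := Scheme.ΓSpecIso_inv_naturality (CommRingCat.ofHom f.deg0)
  change (Spec.map (CommRingCat.ofHom f.deg0)).appLE V U h
    (((Scheme.ΓSpecIso (CommRingCat.of A.deg0)).inv ≫
    (Spec (CommRingCat.of A.deg0)).presheaf.map (homOfLE le_top).op) a) =
    ((Scheme.ΓSpecIso (CommRingCat.of B.deg0)).inv ≫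
    (Spec (CommRingCat.of B.deg0)).presheaf.map (homOfLE le_top).op)
      ((CommRingCat.ofHom f.deg0) a)
  rw [← CommRingCat.comp_apply, ← CommRingCat.comp_apply, Category.assoc,
    Scheme.Hom.map_appLE, reassoc_of% this, appTop_map]

/-- The affine dg-scheme `Spec A`: its underlying scheme is `Spec A⁰`, and its structure sheaf is
associated with the `A⁰`-algebra `A`, so that its sections over an affine open `U` are
`Γ(Spec A⁰, U) ⊗ A` (over `A⁰`). -/
def spec (A : CDGAlg K) : DGScheme K where
  X := Spec (CommRingCat.of A.deg0)
  O U := A.baseChange Γ(Spec (CommRingCat.of A.deg0), U.1)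
  res {U V} h := CDGAlg.baseChangeMap (CDGAlg.Hom.id A)
    ((Spec (CommRingCat.of A.deg0)).presheaf.map (homOfLE h).op).hom (specRing_res A h)
  res_id U := CDGAlg.baseChangeMap_id _ _ fun r => by
    change (Spec (CommRingCat.of A.deg0)).presheaf.map (𝟙 _) r = r
    rw [CategoryTheory.Functor.map_id]
    rfl
  res_comp {U V W} h h' := CDGAlg.baseChangeMap_comp _ _ _ (fun _ => rfl) fun r => by
    change (Spec (CommRingCat.of A.deg0)).presheaf.map (homOfLE h).op
      ((Spec (CommRingCat.of A.deg0)).presheaf.map (homOfLE h').op r) = _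
    rw [← CommRingCat.comp_apply, ← Functor.map_comp]
    rfl
  str U := A.bcStr _
  str_injective U := A.bcStr_injective _
  mem_gr_zero U := A.mem_bcGr_zero _
  res_str h r := CDGAlg.baseChangeMap_str _ _ _ r
  qc_surj V f i b hb := CDGAlg.bc_loc_surj _ _ f (exists_pow_mul _ V f) hb
  qc_inj V f i a ha h :=
    CDGAlg.bc_loc_inj _ (specRing_res A (Scheme.affineBasicOpen_le _ f)) f
      (V.2.isLocalization_basicOpen f) h

/-- The maps of sections of the morphism `Spec B → Spec A` induced by a morphism `f : A → B`:
they are given by `r ⊗ a ↦ f^*(r) ⊗ f a`. -/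
def specMapSections {A B : CDGAlg K} (f : CDGAlg.Hom A B)
    (V : (Spec (CommRingCat.of A.deg0)).Opens) (U : (Spec (CommRingCat.of B.deg0)).Opens)
    (h : U ≤ Spec.map (CommRingCat.ofHom f.deg0) ⁻¹ᵁ V) :
    CDGAlg.Hom (A.baseChange Γ(Spec (CommRingCat.of A.deg0), V))
      (B.baseChange Γ(Spec (CommRingCat.of B.deg0), U)) :=
  CDGAlg.baseChangeMap f ((Spec.map (CommRingCat.ofHom f.deg0)).appLE V U h).hom
    (specRing_map f V U h)

lemma specMapSections_str {A B : CDGAlg K} (f : CDGAlg.Hom A B)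
    (V : (Spec (CommRingCat.of A.deg0)).Opens) (U : (Spec (CommRingCat.of B.deg0)).Opens)
    (h : U ≤ Spec.map (CommRingCat.ofHom f.deg0) ⁻¹ᵁ V) (r : Γ(Spec (CommRingCat.of A.deg0), V)) :
    (specMapSections f V U h).toFun (A.bcStr _ r) =
      B.bcStr _ ((Spec.map (CommRingCat.ofHom f.deg0)).appLE V U h r) :=
  CDGAlg.baseChangeMap_str _ _ _ r

lemma specMapSections_res {A B : CDGAlg K} (f : CDGAlg.Hom A B)
    {V V' : (Spec (CommRingCat.of A.deg0)).Opens} {U U' : (Spec (CommRingCat.of B.deg0)).Opens}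
    (hV : V ≤ V') (hU : U' ≤ U) (h : U ≤ Spec.map (CommRingCat.ofHom f.deg0) ⁻¹ᵁ V)
    (h' : U' ≤ Spec.map (CommRingCat.ofHom f.deg0) ⁻¹ᵁ V') :
    (CDGAlg.baseChangeMap (CDGAlg.Hom.id B)
      ((Spec (CommRingCat.of B.deg0)).presheaf.map (homOfLE hU).op).hom (specRing_res B hU)).comp
      ((specMapSections f V U h).comp (CDGAlg.baseChangeMap (CDGAlg.Hom.id A)
        ((Spec (CommRingCat.of A.deg0)).presheaf.map (homOfLE hV).op).hom (specRing_res A hV))) =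
      specMapSections f V' U' h' := by
  have h1 : U ≤ Spec.map (CommRingCat.ofHom f.deg0) ⁻¹ᵁ V' := fun x hx => hV (h hx)
  have e1 : (specMapSections f V U h).comp (CDGAlg.baseChangeMap (CDGAlg.Hom.id A)
        ((Spec (CommRingCat.of A.deg0)).presheaf.map (homOfLE hV).op).hom (specRing_res A hV)) =
      specMapSections f V' U h1 :=
    CDGAlg.baseChangeMap_comp _ _ _ (fun _ => rfl) fun r => by
      rw [← CommRingCat.comp_apply, Scheme.Hom.map_appLE]
  rw [e1]
  exact CDGAlg.baseChangeMap_comp _ _ _ (fun _ => rfl) fun r => by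
    rw [← CommRingCat.comp_apply, Scheme.Hom.appLE_map]

/-- The morphism `Spec B → Spec A` induced by a morphism `A → B`. -/
def specMap {A B : CDGAlg K} (f : CDGAlg.Hom A B) : Hom (spec B) (spec A) where
  base := Spec.map (CommRingCat.ofHom f.deg0)
  map V U h := specMapSections f V.1 U.1 h
  map_str V U h r := specMapSections_str f V.1 U.1 h r
  map_res hV hU h h' := specMapSections_res f hV hU h h'

end DGScheme

namespace DGAlg

variable {K : Type u} [Field K]

/-- The dg-scheme `Act(A, V)` of actions of `A` on `V`. -/
def Act (A : DGAlg K) (V : Type u) [AddCommGroup V] [Module K V] : DGScheme K :=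
  DGScheme.spec (A.actCoord V)

/-- The morphism `f^* : Act(B, V) → Act(A, V)` induced by a morphism `f : A → B`. -/
def actMap (V : Type u) [AddCommGroup V] [Module K V] {A B : DGAlg K} (f : Hom A B) :
    DGScheme.Hom (B.Act V) (A.Act V) :=
  DGScheme.specMap (actCoordMap V f)

end DGAlg

end

end DerivedAct

/-! Everything rests on homotopy invariance. Two morphisms `B → C` are homotopic if they are the
values at `t = 0` and `t = 1` of one morphism from `B` to the polynomial differential forms on the
line with coefficients in `C`. A form `φ + dt η` of degree `i` is stored as the upper triangular
matrix with rows `((-1)^i φ, η)` and `(0, φ)`; products of forms become products of matrices, so a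
homotopy is an algebra map into matrices that respects degree and differential (`Homotopy`).

Two facts carry the proof. First, a homotopy passes to coordinate algebras: the associativity
relation is bilinear, hence survives with polynomial coefficients (`polyMap_t_mul`), and forms over
a graded commutative algebra are graded commutative. Integrating from `0` to `1`, which needs
characteristic `0`, then shows that homotopic morphisms agree on the cohomology of the coordinate
algebras (`sub_mem_coboundaries`, `Homotopy.actCoordMap_H_eq`). Second, a morphism `q : B → C` from
a quasifree `B` lifts along a quasi-isomorphism `f : A → C` up to homotopy (`exists_homotopy_lift`).
For this, consider triples of an element `b`, an element `a` and a path from `f a` to `q b`. Their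
projection to `B` has the lifting property of an acyclic surjection (`cylGr_lift`), so a section can
be built on generators, from degree `0` downwards (`FreeGens.exists_lift`).

Lifting identities, `f : B₁ → B₂` gets a right homotopy inverse `g`, and `g` gets one in turn; so
`f` is invertible on the cohomology of coordinate algebras (`actCoordMap_H_bijective`). As the
spaces of actions are affine, global sections decide about quasi-isomorphisms
(`specMap_isQuasiIso`).

For resolutions, cells are attached all at once: for each cycle `x` of degree `-n + 1` and each `a`
of degree `-n` with `d a` the image of `x`, there is a generator of degree `-n` with differential
`x` and image `a`. The circularity (`x` is itself made of generators) is broken by the inductive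
type `Term` of formal expressions. Two resolutions are compared by lifting one augmentation along
the other. -/

namespace DerivedAct

noncomputable section

/-! ### Calculus of polynomials with coefficients in a vector space -/

open scoped Polynomial

/-- The antiderivative of a polynomial that vanishes at `0`. -/
def integral (K : Type u) [Field K] : K[X] →ₗ[K] K[X] :=
  (Polynomial.basisMonomials K).constr K fun n => Polynomial.monomial (n + 1) ((n : K) + 1)⁻¹

section Integral

variable {K : Type u} [Field K]

lemma integral_monomial (n : ℕ) (c : K) :
    integral K (Polynomial.monomial n c) = Polynomial.monomial (n + 1) (c * ((n : K) + 1)⁻¹) := by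
  have h := (Polynomial.basisMonomials K).constr_basis K
    (fun n => Polynomial.monomial (n + 1) ((n : K) + 1)⁻¹) n
  rw [Polynomial.coe_basisMonomials] at h
  have e : Polynomial.monomial n c = c • Polynomial.monomial n (1 : K) := by
    rw [Polynomial.smul_monomial, smul_eq_mul, mul_one]
  rw [e, map_smul, integral, h, Polynomial.smul_monomial, smul_eq_mul]

lemma eval_zero_integral : Polynomial.leval (0 : K) ∘ₗ integral K = 0 := by
  refine Polynomial.lhom_ext' fun n => LinearMap.ext_ring ?_
  simp [integral_monomial]

variable [CharZero K]

/-- The factor `n + 1` produced by the derivative cancels the denominator. This lemma and the next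
are where characteristic `0` enters; every later use goes through them. -/
lemma derivative_integral : Polynomial.derivative ∘ₗ integral K = LinearMap.id := by
  refine Polynomial.lhom_ext' fun n => LinearMap.ext_ring ?_
  have : (n : K) + 1 ≠ 0 := by exact_mod_cast n.succ_ne_zero
  simp [integral_monomial, this]

/-- Constants are killed by the derivative and the antiderivative restores no constant term, which
accounts for the correction by the value at `0`. -/
lemma integral_derivative :
    integral K ∘ₗ Polynomial.derivative =
      LinearMap.id - (LinearMap.toSpanSingleton K K[X] 1) ∘ₗ Polynomial.leval (0 : K) := by
  refine Polynomial.lhom_ext' fun n => LinearMap.ext_ring ?_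
  cases n with
  | zero => simp
  | succ n =>
    have : (n : K) + 1 ≠ 0 := by exact_mod_cast n.succ_ne_zero
    rw [LinearMap.comp_apply, LinearMap.comp_apply, Polynomial.derivative_monomial,
      integral_monomial]
    simp [this]

end Integral

section Poly

variable {K : Type u} [Field K] {R : Type u} [AddCommGroup R] [Module K R]
  {S : Type u} [AddCommGroup S] [Module K S]

/-- Evaluation of polynomials with coefficients in `R`. -/
def polyEval (c : K) : R ⊗[K] K[X] →ₗ[K] R :=
  (TensorProduct.rid K R).toLinearMap ∘ₗ (Polynomial.leval c).lTensor R

lemma polyEval_tmul (c : K) (r : R) (p : K[X]) : polyEval c (r ⊗ₜ[K] p) = p.eval c • r := by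
  simp [polyEval]

/-- The derivative of polynomials with coefficients in `R`. -/
def polyDeriv : R ⊗[K] K[X] →ₗ[K] R ⊗[K] K[X] := Polynomial.derivative.lTensor R

lemma polyDeriv_tmul (r : R) (p : K[X]) :
    polyDeriv (r ⊗ₜ[K] p) = r ⊗ₜ[K] Polynomial.derivative p := rfl

/-- The antiderivative of polynomials with coefficients in `R`. -/
def polyInt : R ⊗[K] K[X] →ₗ[K] R ⊗[K] K[X] := (integral K).lTensor R

lemma polyInt_tmul (r : R) (p : K[X]) :
    polyInt (r ⊗ₜ[K] p) = r ⊗ₜ[K] integral K p := rfl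

/-- A linear map, applied to the coefficients. -/
def polyMap (f : R →ₗ[K] S) : R ⊗[K] K[X] →ₗ[K] S ⊗[K] K[X] := f.rTensor K[X]

lemma polyMap_tmul (f : R →ₗ[K] S) (r : R) (p : K[X]) :
    polyMap f (r ⊗ₜ[K] p) = f r ⊗ₜ[K] p := rfl

lemma polyDeriv_polyMap (f : R →ₗ[K] S) (x : R ⊗[K] K[X]) :
    polyDeriv (polyMap f x) = polyMap f (polyDeriv x) := by
  induction x using TensorProduct.induction_on with
  | zero => simp
  | tmul r p => rfl
  | add x y hx hy => simp only [map_add, hx, hy]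

lemma polyInt_polyMap (f : R →ₗ[K] S) (x : R ⊗[K] K[X]) :
    polyInt (polyMap f x) = polyMap f (polyInt x) := by
  induction x using TensorProduct.induction_on with
  | zero => simp
  | tmul r p => rfl
  | add x y hx hy => simp only [map_add, hx, hy]

lemma polyEval_polyMap (c : K) (f : R →ₗ[K] S) (x : R ⊗[K] K[X]) :
    polyEval c (polyMap f x) = f (polyEval c x) := by
  induction x using TensorProduct.induction_on with
  | zero => simp
  | tmul r p => simp [polyMap_tmul, polyEval_tmul]
  | add x y hx hy => simp only [map_add, hx, hy]

lemma polyEval_zero_polyInt (x : R ⊗[K] K[X]) : polyEval 0 (polyInt x) = 0 := by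
  induction x using TensorProduct.induction_on with
  | zero => simp
  | tmul r p =>
    have : (integral K p).eval 0 = 0 := LinearMap.congr_fun eval_zero_integral p
    rw [polyInt_tmul, polyEval_tmul, this, zero_smul]
  | add x y hx hy => simp only [map_add, hx, hy, add_zero]

lemma polyDeriv_polyInt [CharZero K] (x : R ⊗[K] K[X]) : polyDeriv (polyInt x) = x := by
  induction x using TensorProduct.induction_on with
  | zero => simp
  | tmul r p =>
    have : Polynomial.derivative (integral K p) = p := LinearMap.congr_fun derivative_integral p
    rw [polyInt_tmul, polyDeriv_tmul, this]
  | add x y hx hy => simp only [map_add, hx, hy]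

lemma polyInt_polyDeriv [CharZero K] (x : R ⊗[K] K[X]) :
    polyInt (polyDeriv x) = x - polyEval 0 x ⊗ₜ[K] 1 := by
  induction x using TensorProduct.induction_on with
  | zero => simp
  | tmul r p =>
    have : integral K (Polynomial.derivative p) = p - p.eval 0 • 1 :=
      LinearMap.congr_fun integral_derivative p
    rw [polyDeriv_tmul, polyInt_tmul, this, polyEval_tmul, TensorProduct.tmul_sub,
      TensorProduct.tmul_smul, TensorProduct.smul_tmul']
  | add x y hx hy =>
    simp only [map_add, hx, hy, TensorProduct.add_tmul]
    abel

/-- The polynomials whose coefficients have degree `i`. -/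
def polyGr (gr : ℤ → Submodule K R) (i : ℤ) : Submodule K (R ⊗[K] K[X]) :=
  Submodule.span K {x | ∃ r ∈ gr i, ∃ p, x = r ⊗ₜ[K] p}

variable {gr : ℤ → Submodule K R} {gr' : ℤ → Submodule K S}

lemma tmul_mem_polyGr {i : ℤ} {r : R} (hr : r ∈ gr i) (p : K[X]) :
    r ⊗ₜ[K] p ∈ polyGr gr i := Submodule.subset_span ⟨r, hr, p, rfl⟩

@[elab_as_elim]
-- Closure under sums is enough, since a scalar can be absorbed in the coefficient of a pure tensor.
lemma polyGr_induction {i : ℤ} {P : R ⊗[K] K[X] → Prop} (h : ∀ r ∈ gr i, ∀ p, P (r ⊗ₜ[K] p))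
    (add : ∀ x y, P x → P y → P (x + y)) {x : R ⊗[K] K[X]} (hx : x ∈ polyGr gr i) : P x := by
  refine Submodule.closure_induction (R := K) (p := fun x _ => P x) ?_
    (fun x y _ _ => add x y) ?_ hx
  · simpa using h 0 (zero_mem _) 0
  · rintro c x ⟨r, hr, p, rfl⟩
    rw [TensorProduct.smul_tmul']
    exact h _ ((gr i).smul_mem c hr) p

lemma polyMap_mem {f : R →ₗ[K] S} {i j : ℤ} (hf : ∀ a ∈ gr i, f a ∈ gr' j) {x : R ⊗[K] K[X]}
    (hx : x ∈ polyGr gr i) : polyMap f x ∈ polyGr gr' j := by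
  refine polyGr_induction (fun r hr p => tmul_mem_polyGr (hf r hr) p) (fun x y hx hy => ?_) hx
  rw [map_add]
  exact add_mem hx hy

lemma polyDeriv_mem {i : ℤ} {x : R ⊗[K] K[X]} (hx : x ∈ polyGr gr i) :
    polyDeriv x ∈ polyGr gr i := by
  refine polyGr_induction (fun r hr p => tmul_mem_polyGr hr _) (fun x y hx hy => ?_) hx
  rw [map_add]
  exact add_mem hx hy

lemma polyInt_mem {i : ℤ} {x : R ⊗[K] K[X]} (hx : x ∈ polyGr gr i) :
    polyInt x ∈ polyGr gr i := by
  refine polyGr_induction (fun r hr p => tmul_mem_polyGr hr _) (fun x y hx hy => ?_) hx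
  rw [map_add]
  exact add_mem hx hy

lemma polyEval_mem (c : K) {i : ℤ} {x : R ⊗[K] K[X]} (hx : x ∈ polyGr gr i) :
    polyEval c x ∈ gr i := by
  refine polyGr_induction (fun r hr p => ?_) (fun x y hx hy => ?_) hx
  · rw [polyEval_tmul]
    exact (gr i).smul_mem _ hr
  · rw [map_add]
    exact add_mem hx hy

end Poly

/-! ### Differential forms on the line with graded coefficients -/

/-- The data of a graded algebra with a differential of degree `1` that is a derivation with
signs. -/
structure IsDG {K : Type u} [Field K] {R : Type u} [NonUnitalRing R] [Module K R]
    (gr : ℤ → Submodule K R) (d : R →ₗ[K] R) : Prop where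
  mul_mem : ∀ {i j a b}, a ∈ gr i → b ∈ gr j → a * b ∈ gr (i + j)
  d_mul : ∀ {i a}, a ∈ gr i → ∀ b, d (a * b) = d a * b + (i.negOnePow : ℤ) • (a * d b)

/-- Forms are taken with coefficients both in a dg-algebra and in its coordinate algebra; `IsDG`
isolates what the two computations share. -/
lemma DGAlg.isDG {K : Type u} [Field K] (A : DGAlg K) : IsDG A.gr A.d where
  mul_mem := A.mul_mem
  d_mul := A.d_mul

lemma CDGAlg.isDG {K : Type u} [Field K] (A : CDGAlg K) : IsDG A.gr A.d where
  mul_mem := A.mul_mem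
  d_mul := A.d_mul

section Path

variable {K : Type u} [Field K] {R : Type u} [AddCommGroup R] [Module K R]
  {gr : ℤ → Submodule K R} {d : R →ₗ[K] R}

/-- The matrix that stands for the form `φ + dt η` of degree `i`. -/
def pathMat (i : ℤ) (φ η : R ⊗[K] K[X]) : Matrix (Fin 2) (Fin 2) (R ⊗[K] K[X]) :=
  !![(i.negOnePow : ℤ) • φ, η; 0, φ]

lemma pathMat_inj {i : ℤ} {φ η φ' η' : R ⊗[K] K[X]} (h : pathMat i φ η = pathMat i φ' η') :
    φ = φ' ∧ η = η' :=
  ⟨congrFun (congrFun h 1) 1, congrFun (congrFun h 0) 1⟩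

lemma pathMat_add (i : ℤ) (φ η φ' η' : R ⊗[K] K[X]) :
    pathMat i φ η + pathMat i φ' η' = pathMat i (φ + φ') (η + η') := by
  ext k l
  fin_cases k <;> fin_cases l <;> simp [pathMat]

lemma pathMat_smul (i : ℤ) (c : K) (φ η : R ⊗[K] K[X]) :
    c • pathMat i φ η = pathMat i (c • φ) (c • η) := by
  ext k l
  fin_cases k <;> fin_cases l <;> simp [pathMat, smul_comm c]

lemma pathMat_zsmul (i : ℤ) (c : ℤ) (φ η : R ⊗[K] K[X]) :
    c • pathMat i φ η = pathMat i (c • φ) (c • η) := by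
  ext k l
  fin_cases k <;> fin_cases l <;> simp [pathMat, smul_comm c]

lemma pathMat_zero (i : ℤ) : pathMat i (0 : R ⊗[K] K[X]) 0 = 0 := by
  ext k l
  fin_cases k <;> fin_cases l <;> simp [pathMat]

variable (gr) in
/-- The forms of degree `i` on the line with coefficients in `R`. -/
def pathGr (i : ℤ) : Submodule K (Matrix (Fin 2) (Fin 2) (R ⊗[K] K[X])) where
  carrier := {ψ | ∃ φ ∈ polyGr gr i, ∃ η ∈ polyGr gr (i - 1), ψ = pathMat i φ η}
  add_mem' := by
    rintro _ _ ⟨φ, hφ, η, hη, rfl⟩ ⟨φ', hφ', η', hη', rfl⟩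
    exact ⟨_, add_mem hφ hφ', _, add_mem hη hη', pathMat_add _ _ _ _ _⟩
  zero_mem' := ⟨0, zero_mem _, 0, zero_mem _, (pathMat_zero i).symm⟩
  smul_mem' := by
    rintro c _ ⟨φ, hφ, η, hη, rfl⟩
    exact ⟨_, Submodule.smul_mem _ c hφ, _, Submodule.smul_mem _ c hη, pathMat_smul _ _ _ _⟩

/-- The differential of forms on the line with coefficients in `R`. -/
def pathD (d : R →ₗ[K] R) :
    Matrix (Fin 2) (Fin 2) (R ⊗[K] K[X]) →ₗ[K] Matrix (Fin 2) (Fin 2) (R ⊗[K] K[X]) where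
  toFun x := !![-polyMap d (x 0 0), -polyMap d (x 0 1) + polyDeriv (x 1 1); 0, polyMap d (x 1 1)]
  map_add' x y := by
    ext k l
    fin_cases k <;> fin_cases l <;> simp <;> abel
  map_smul' c x := by
    ext k l
    fin_cases k <;> fin_cases l <;> simp

/-- This is `d (φ + dt η) = dφ + dt (φ' - dη)`: the minus sign comes from moving `d` past `dt`. The
sign in the upper left corner must flip because the degree rises by one. -/
lemma pathD_pathMat (i : ℤ) (φ η : R ⊗[K] K[X]) :
    pathD d (pathMat i φ η) =
      pathMat (i + 1) (polyMap d φ) (-polyMap d η + polyDeriv φ) := by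
  ext k l
  fin_cases k <;> fin_cases l <;> simp [pathMat, pathD, Int.negOnePow_succ]

end Path

section PathRing

variable {K : Type u} [Field K] {R : Type u} [NonUnitalRing R] [Module K R]
  {gr : ℤ → Submodule K R} {d : R →ₗ[K] R}

variable [IsScalarTower K R R] [SMulCommClass K R R]

lemma polyGr_mul (h : IsDG gr d) {i j : ℤ} {x y : R ⊗[K] K[X]} (hx : x ∈ polyGr gr i)
    (hy : y ∈ polyGr gr j) : x * y ∈ polyGr gr (i + j) := by
  refine polyGr_induction (fun r hr p => ?_) (fun x x' hx hx' => ?_) hx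
  · refine polyGr_induction (fun s hs q => ?_) (fun y y' hy hy' => ?_) hy
    · rw [Algebra.TensorProduct.tmul_mul_tmul]
      exact tmul_mem_polyGr (h.mul_mem hr hs) _
    · rw [mul_add]
      exact add_mem hy hy'
  · rw [add_mul]
    exact add_mem hx hx'

lemma polyDeriv_mul (x y : R ⊗[K] K[X]) :
    polyDeriv (x * y) = polyDeriv x * y + x * polyDeriv y := by
  induction x using TensorProduct.induction_on with
  | zero => simp
  | tmul r p =>
    induction y using TensorProduct.induction_on with
    | zero => simp
    | tmul s q =>
      simp only [polyDeriv_tmul, Algebra.TensorProduct.tmul_mul_tmul, Polynomial.derivative_mul,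
        TensorProduct.tmul_add]
    | add y z hy hz =>
      rw [mul_add, map_add, map_add, hy, hz, mul_add, mul_add]
      abel
  | add x z hx hz =>
    rw [add_mul, map_add, map_add, hx, hz, add_mul, add_mul]
    abel

lemma polyMap_d_mul (h : IsDG gr d) {i : ℤ} {x : R ⊗[K] K[X]} (hx : x ∈ polyGr gr i)
    (y : R ⊗[K] K[X]) :
    polyMap d (x * y) = polyMap d x * y + (i.negOnePow : ℤ) • (x * polyMap d y) := by
  refine polyGr_induction (fun r hr p => ?_) (fun x x' hx hx' => ?_) hx
  · induction y using TensorProduct.induction_on with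
    | zero => simp
    | tmul s q =>
      simp only [polyMap_tmul, Algebra.TensorProduct.tmul_mul_tmul, h.d_mul hr,
        TensorProduct.add_tmul, TensorProduct.smul_tmul']
    | add y z hy hz =>
      rw [mul_add, map_add, map_add, hy, hz, mul_add, mul_add, smul_add]
      abel
  · rw [add_mul, map_add, map_add, hx, hx', add_mul, add_mul, smul_add]
    abel

lemma polyEval_mul (c : K) (x y : R ⊗[K] K[X]) :
    polyEval c (x * y) = polyEval c x * polyEval c y := by
  induction x using TensorProduct.induction_on with
  | zero => simp
  | tmul r p =>
    induction y using TensorProduct.induction_on with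
    | zero => simp
    | tmul s q =>
      rw [Algebra.TensorProduct.tmul_mul_tmul]
      simp only [polyEval_tmul, Polynomial.eval_mul, smul_mul_smul_comm]
    | add y z hy hz => rw [mul_add, map_add, map_add, hy, hz, mul_add]
  | add x z hx hz => rw [add_mul, map_add, map_add, hx, hz, add_mul]

/-- In `(φ + dt η)(φ' + dt η')` the term `φ dt η'` picks up `(-1)^i` when `dt` moves to the front,
and `dt² = 0`. The signed corner entry of the matrix supplies exactly this sign. -/
lemma pathMat_mul (i j : ℤ) (φ η φ' η' : R ⊗[K] K[X]) :
    pathMat i φ η * pathMat j φ' η' =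
      pathMat (i + j) (φ * φ') ((i.negOnePow : ℤ) • (φ * η') + η * φ') := by
  ext k l
  have e (n : ℤ) (x y : R ⊗[K] K[X]) : x * n • y = n • (x * y) :=
    map_zsmul (AddMonoidHom.mulLeft x) n y
  fin_cases k <;> fin_cases l <;>
    simp [pathMat, Matrix.mul_apply, Int.negOnePow_add, smul_mul_assoc, mul_smul, e,
      smul_comm (j.negOnePow : ℤ)]

lemma pathGr_mul (h : IsDG gr d) {i j : ℤ} {x y : Matrix (Fin 2) (Fin 2) (R ⊗[K] K[X])}
    (hx : x ∈ pathGr gr i) (hy : y ∈ pathGr gr j) : x * y ∈ pathGr gr (i + j) := by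
  obtain ⟨φ, hφ, η, hη, rfl⟩ := hx
  obtain ⟨φ', hφ', η', hη', rfl⟩ := hy
  refine ⟨_, polyGr_mul h hφ hφ', _, add_mem (Submodule.smul_of_tower_mem _ _ ?_) ?_,
    pathMat_mul _ _ _ _ _ _⟩
  · rw [add_sub_assoc]
    exact polyGr_mul h hφ hη'
  · rw [add_sub_right_comm]
    exact polyGr_mul h hη hφ'

/-- The Leibniz rule for forms combines those of `d` on the coefficients and of `d/dt`. After both
sides are put in the form `pathMat`, only the `dt` components have to be compared. -/
lemma pathD_mul (h : IsDG gr d) {i j : ℤ} {x y : Matrix (Fin 2) (Fin 2) (R ⊗[K] K[X])}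
    (hx : x ∈ pathGr gr i) (hy : y ∈ pathGr gr j) :
    pathD d (x * y) = pathD d x * y + (i.negOnePow : ℤ) • (x * pathD d y) := by
  obtain ⟨φ, hφ, η, hη, rfl⟩ := hx
  obtain ⟨φ', hφ', η', hη', rfl⟩ := hy
  have e : i + 1 + j = i + (j + 1) := by ring
  rw [pathMat_mul, pathD_pathMat, pathD_pathMat, pathD_pathMat, pathMat_mul, pathMat_mul, e,
    pathMat_zsmul, pathMat_add, polyMap_d_mul h hφ, map_add, map_zsmul, polyMap_d_mul h hφ,
    polyMap_d_mul h hη, polyDeriv_mul, ← add_assoc]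
  -- In the term `φ · dη'` the sign `(-1)^i` occurs twice, once from the product of forms and once
  -- from the Leibniz rule.
  have h1 : (i.negOnePow : ℤ) * (i.negOnePow : ℤ) = 1 := by
    rw [← Units.val_mul, Int.units_mul_self, Units.val_one]
  rw [add_assoc i j 1]
  refine congrArg₂ _ rfl ?_
  rw [Int.negOnePow_succ, Int.negOnePow_sub, Int.negOnePow_one]
  have nm (x y : R ⊗[K] K[X]) : -x * y = -(x * y) := neg_mul x y
  have mn (x y : R ⊗[K] K[X]) : x * -y = -(x * y) := mul_neg x y
  simp only [smul_add, smul_smul, h1, Units.val_neg, mul_add, add_mul, neg_smul, one_smul,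
    mul_neg, smul_neg, mul_one, nm, mn]
  abel

end PathRing

/-! ### Integration from `0` to `1` and equality on cohomology -/

section Homotopy

variable {K : Type u} [Field K] {M N : Type u} [AddCommGroup M] [Module K M]
  [AddCommGroup N] [Module K N] {gr : ℤ → Submodule K M} {d : M →ₗ[K] M}
  {gr' : ℤ → Submodule K N} {d' : N →ₗ[K] N}

lemma cohomologyMap_eq {f g : M →ₗ[K] N} (hf : ∀ i, ∀ a ∈ gr i, f a ∈ gr' i)
    (hfd : ∀ a, f (d a) = d' (f a)) (hg : ∀ i, ∀ a ∈ gr i, g a ∈ gr' i)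
    (hgd : ∀ a, g (d a) = d' (g a)) (i : ℤ)
    (h : ∀ a ∈ cocycles gr d i, g a - f a ∈ coboundaries gr' d' i) :
    cohomologyMap f hf hfd i = cohomologyMap g hg hgd i := by
  refine Submodule.linearMap_qext _ (LinearMap.ext fun a => ?_)
  refine Eq.symm ((Submodule.Quotient.eq _).2 ?_)
  exact h a.1 a.2

variable [CharZero K]

lemma polyEval_polyInt_polyDeriv (x : N ⊗[K] K[X]) :
    polyEval 1 (polyInt (polyDeriv x)) = polyEval 1 x - polyEval 0 x := by
  rw [polyInt_polyDeriv, map_sub, polyEval_tmul, Polynomial.eval_one, one_smul]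

/-- Stokes' theorem on the interval. If `a` is a cocycle, the form `Ψ a = φ + dt η` is closed, so
`φ' = dη`, and integration gives `φ(1) - φ(0) = d ∫ η`. Multiplicativity of `Ψ` plays no role. -/
lemma sub_mem_coboundaries (Ψ : M →ₗ[K] Matrix (Fin 2) (Fin 2) (N ⊗[K] K[X]))
    (mem : ∀ {i a}, a ∈ gr i → Ψ a ∈ pathGr gr' i) (comm : ∀ a, Ψ (d a) = pathD d' (Ψ a))
    {i : ℤ} {a : M} (ha : a ∈ cocycles gr d i) :
    polyEval 1 (Ψ a 1 1) - polyEval 0 (Ψ a 1 1) ∈ coboundaries gr' d' i := by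
  obtain ⟨φ, -, η, hη, h⟩ := mem ha.1
  have h0 : d a = 0 := ha.2
  have h1 := comm a
  rw [h0, map_zero, h, pathD_pathMat, ← pathMat_zero (i + 1)] at h1
  -- The `dt` component of the equation that says that `φ + dt η` is closed.
  have h2 : polyDeriv φ = polyMap d' η := by
    rw [eq_comm, ← neg_add_eq_zero]
    exact (pathMat_inj h1).2.symm
  have h3 : Ψ a 1 1 = φ := by rw [h]; rfl
  rw [h3, ← polyEval_polyInt_polyDeriv, h2, polyInt_polyMap, polyEval_polyMap]
  exact ⟨_, polyEval_mem 1 (polyInt_mem hη), rfl⟩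

end Homotopy

namespace DGAlg

variable {K : Type u} [Field K]

/-- A polynomial homotopy between two morphisms of dg-algebras. -/
structure Homotopy {B C : DGAlg K} (f g : Hom B C) where
  toFun : B →ₙₐ[K] Matrix (Fin 2) (Fin 2) (C ⊗[K] K[X])
  mem : ∀ {i b}, b ∈ B.gr i → toFun b ∈ pathGr C.gr i
  comm : ∀ b, toFun (B.d b) = pathD C.d (toFun b)
  eval_zero : ∀ b, polyEval 0 (toFun b 1 1) = f.toFun b
  eval_one : ∀ b, polyEval 1 (toFun b 1 1) = g.toFun b

lemma Homotopy.H_eq [CharZero K] {B C : DGAlg K} {f g : Hom B C} (h : Homotopy f g) (i : ℤ) :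
    f.H i = g.H i := by
  refine cohomologyMap_eq _ _ _ _ i fun a ha => ?_
  have := sub_mem_coboundaries (h.toFun : B →ₗ[K] Matrix (Fin 2) (Fin 2) (C ⊗[K] K[X])) h.mem
    h.comm ha
  change polyEval 1 (h.toFun a 1 1) - polyEval 0 (h.toFun a 1 1) ∈ _ at this
  rwa [h.eval_zero, h.eval_one] at this

/-! ### Homotopies pass to the coordinate algebras of spaces of actions -/

section Act

variable {B C : DGAlg K} {V : Type u} [AddCommGroup V] [Module K V]

lemma polyGr_comm (E : CDGAlg K) {i j : ℤ} {x y : E ⊗[K] K[X]} (hx : x ∈ polyGr E.gr i)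
    (hy : y ∈ polyGr E.gr j) : x * y = (i * j).negOnePow • (y * x) := by
  refine polyGr_induction (fun r hr p => ?_) (fun x x' hx hx' => ?_) hx
  · refine polyGr_induction (fun s hs q => ?_) (fun y y' hy hy' => ?_) hy
    · rw [Algebra.TensorProduct.tmul_mul_tmul, Algebra.TensorProduct.tmul_mul_tmul,
        E.mul_comm hr hs, _root_.mul_comm p q, Units.smul_def, Units.smul_def,
        TensorProduct.smul_tmul']
    · rw [mul_add, add_mul, smul_add, hy, hy']
  · rw [mul_add, add_mul, smul_add, hx, hx']

/-- Both sides are bilinear over polynomials in `t`, so the associativity relation for coefficients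
gives it for polynomials. This is why a homotopy of algebras respects the relations of the
coordinate algebra. -/
lemma polyMap_t_mul (x y : C ⊗[K] K[X]) (v : V) (ξ : Module.Dual K V) {n : ℕ}
    (e : Module.Basis (Fin n) K V) :
    polyMap (C.t.flip (v ⊗ₜ[K] ξ)) (x * y) =
      ∑ k, polyMap (C.t.flip (e k ⊗ₜ[K] ξ)) x * polyMap (C.t.flip (v ⊗ₜ[K] e.coord k)) y := by
  induction x using TensorProduct.induction_on with
  | zero => simp
  | tmul r p =>
    induction y using TensorProduct.induction_on with
    | zero => simp
    | tmul s q =>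
      simp only [Algebra.TensorProduct.tmul_mul_tmul, polyMap_tmul, LinearMap.flip_apply]
      rw [t_assoc r s v ξ e, TensorProduct.sum_tmul]
    | add y z hy hz => simp only [mul_add, map_add, hy, hz, Finset.sum_add_distrib]
  | add x z hx hz => simp only [add_mul, map_add, hx, hz, Finset.sum_add_distrib]

namespace Homotopy

variable {f g : Hom B C} (h : Homotopy f g)

/-- The homotopy of coordinate algebras, on generators. -/
def actGen : B →ₗ[K] VV K V →ₗ[K] Matrix (Fin 2) (Fin 2) (C.ActAlg V ⊗[K] K[X]) :=
  LinearMap.mk₂ K (fun b m => (h.toFun b).map (polyMap (C.t.flip m)))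
    (fun a b m => by ext i j; simp)
    (fun c a m => by ext i j; simp)
    (fun a m n => by ext i j; simp [polyMap])
    (fun c a m => by ext i j; simp [polyMap])

lemma actGen_apply (b : B) (m : VV K V) :
    h.actGen b m = (h.toFun b).map (polyMap (C.t.flip m)) := rfl

lemma pathMat_map {R S : Type u} [AddCommGroup R] [Module K R] [AddCommGroup S] [Module K S]
    (F : R →ₗ[K] S) (i : ℤ) (φ η : R ⊗[K] K[X]) :
    (pathMat i φ η).map (polyMap F) = pathMat i (polyMap F φ) (polyMap F η) := by
  ext k l
  fin_cases k <;> fin_cases l <;> simp [pathMat]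

lemma t_mem {i : ℤ} {a : C} (ha : a ∈ C.gr i) (m : VV K V) : C.t.flip m a ∈ C.actGr V i :=
  (Mono.t ha m).mem

lemma actGen_mem {i : ℤ} {b : B} (hb : b ∈ B.gr i) (m : VV K V) :
    h.actGen b m ∈ pathGr (C.actGr V) i := by
  obtain ⟨φ, hφ, η, hη, e⟩ := h.mem hb
  rw [actGen_apply, e, pathMat_map]
  exact ⟨_, polyMap_mem (fun a ha => t_mem ha m) hφ, _, polyMap_mem (fun a ha => t_mem ha m) hη,
    rfl⟩

/-- Matrices do not commute, but these stand for forms with coefficients in a graded commutative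
algebra. As `η` has degree `i - 1`, exchanging it with `φ'` costs an extra `(-1)^j`, and
symmetrically; this is the sign pattern that `mat_comm` asks for. -/
lemma pathGr_comm {i j : ℤ} {x y : Matrix (Fin 2) (Fin 2) (C.ActAlg V ⊗[K] K[X])}
    (hx : x ∈ pathGr (C.actGr V) i) (hy : y ∈ pathGr (C.actGr V) j) :
    x * y = (i * j).negOnePow • (y * x) := by
  obtain ⟨φ, hφ, η, hη, rfl⟩ := hx
  obtain ⟨φ', hφ', η', hη', rfl⟩ := hy
  refine mat_comm i.negOnePow j.negOnePow _ φ φ' η η' (polyGr_comm (C.actCoord V) hφ hφ') ?_ ?_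
  · refine (polyGr_comm (C.actCoord V) hφ hη').trans ?_
    rw [mul_sub, mul_one, Int.negOnePow_sub]
    rfl
  · refine (polyGr_comm (C.actCoord V) hη hφ').trans ?_
    rw [sub_mul, one_mul, Int.negOnePow_sub]
    rfl

/-- The homotopy of coordinate algebras. -/
def act : B.ActAlg V →ₐ[K] Matrix (Fin 2) (Fin 2) (C.ActAlg V ⊗[K] K[X]) :=
  actLift (V := V) h.actGen
    (fun ha hb m n => pathGr_comm (h.actGen_mem ha m) (h.actGen_mem hb n))
    (fun a b v ξ n e => by
      -- Each entry of a matrix product is a sum of products of polynomials, and the associativity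
      -- relation applies to each summand.
      ext k l
      rw [Matrix.sum_apply]
      simp only [actGen_apply, map_mul, Matrix.map_apply, Matrix.mul_apply, Fin.sum_univ_two,
        map_add, polyMap_t_mul _ _ v ξ e, Finset.sum_add_distrib])

lemma act_t (b : B) (m : VV K V) : h.act (B.t b m) = h.actGen b m := actLift_t _ _ _ b m

lemma pathMat_one : (1 : Matrix (Fin 2) (Fin 2) (C.ActAlg V ⊗[K] K[X])) = pathMat 0 1 0 := by
  ext k l
  fin_cases k <;> fin_cases l <;> simp [pathMat]

lemma act_mono_mem {i : ℤ} {x : B.ActAlg V} (hx : Mono i x) : h.act x ∈ pathGr (C.actGr V) i := by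
  induction hx with
  | one =>
    rw [map_one, pathMat_one]
    exact ⟨_, tmul_mem_polyGr (Mono.one.mem) 1, _, zero_mem _, rfl⟩
  | mul m ha _ ih =>
    rw [map_mul, act_t]
    exact pathGr_mul (C.actCoord V).isDG (h.actGen_mem ha m) ih

/-- Both sides are derivations with signs along `h.act`, so agreement on generators propagates to
monomials. -/
lemma act_mono_comm {i : ℤ} {x : B.ActAlg V} (hx : Mono i x) :
    h.act (B.actD V x) = pathD (C.actD V) (h.act x) := by
  induction hx with
  | one =>
    rw [actD_one, map_one, map_zero, pathMat_one, pathD_pathMat]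
    have h1 : polyMap (C.actD V) 1 = 0 := by
      change C.actD V 1 ⊗ₜ[K] (1 : K[X]) = 0
      rw [actD_one, TensorProduct.zero_tmul]
    have h2 : polyDeriv (1 : C.ActAlg V ⊗[K] K[X]) = 0 := by
      change (1 : C.ActAlg V) ⊗ₜ[K] Polynomial.derivative (1 : K[X]) = 0
      simp
    rw [h1, h2, map_zero, neg_zero, add_zero, pathMat_zero]
  | @mul i j a m x ha hx ih =>
    -- On generators, the claim is the compatibility of `h` itself with differentials, transported
    -- along `c ↦ c ⊗ m`, which commutes with `d`.
    have h1 : h.act (B.t (B.d a) m) = pathD (C.actD V) (h.act (B.t a m)) := by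
      rw [act_t, act_t, actGen_apply, h.comm, actGen_apply]
      obtain ⟨φ, hφ, η, hη, e⟩ := h.mem ha
      have hd : ∀ y : C ⊗[K] K[X], polyMap (C.t.flip m) (polyMap C.d y) =
          polyMap (C.actD V) (polyMap (C.t.flip m) y) := fun y => by
        induction y using TensorProduct.induction_on with
        | zero => simp
        | tmul r p => rw [polyMap_tmul, polyMap_tmul, polyMap_tmul, polyMap_tmul,
            LinearMap.flip_apply, LinearMap.flip_apply, actD_t]
        | add y z hy hz => simp only [map_add, hy, hz]
      rw [e, pathD_pathMat, pathMat_map, pathMat_map, pathD_pathMat, map_add, map_neg, hd, hd,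
        polyDeriv_polyMap]
    rw [actD_mono_mul (Mono.t ha m), actD_t, map_add, map_zsmul, map_mul, map_mul, map_mul, ih, h1]
    exact (pathD_mul (C.actCoord V).isDG (h.act_mono_mem (Mono.t ha m)) (h.act_mono_mem hx)).symm

/-- The matrices are upper triangular, so the lower right entry is multiplicative in `x`, as is
evaluation at `c`; both sides are thus determined by generators. -/
lemma act_mono_eval {p : Hom B C} {c : K} (hc : ∀ b, polyEval c (h.toFun b 1 1) = p.toFun b)
    {i : ℤ} {x : B.ActAlg V} (hx : Mono i x) :
    polyEval c (h.act x 1 1) = actMapAlg p x := by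
  induction hx with
  | one =>
    rw [map_one, map_one]
    change polyEval c ((1 : C.ActAlg V) ⊗ₜ[K] (1 : K[X])) = 1
    simp [polyEval_tmul]
  | @mul i j a m x ha hx ih =>
    obtain ⟨φ, hφ, η, hη, e⟩ := h.act_mono_mem (Mono.t ha m)
    have h0 : h.act (B.t a m) 1 0 = 0 := by rw [e]; rfl
    rw [map_mul, Matrix.mul_apply, Fin.sum_univ_two, h0, zero_mul, zero_add, polyEval_mul, ih,
      map_mul, actMapAlg_t, act_t, actGen_apply, Matrix.map_apply, polyEval_polyMap, hc]
    rfl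

/-- Homotopic morphisms induce the same map on the cohomology of the coordinate algebras of the
spaces of actions. -/
lemma actCoordMap_H_eq [CharZero K] {f g : Hom B C} (h : Homotopy f g) (i : ℤ) :
    (actCoordMap V f).H i = (actCoordMap V g).H i := by
  have ev {p : Hom B C} {c : K} (hc : ∀ b, polyEval c (h.toFun b 1 1) = p.toFun b)
      (x : B.ActAlg V) : polyEval c (h.act x 1 1) = actMapAlg p x := by
    refine act_induction (fun i x hx => h.act_mono_eval hc hx) ?_ (fun x y hx hy => ?_)
      (fun r x hx => ?_) x
    · simp
    · simp only [map_add, Matrix.add_apply, hx, hy]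
    · simp only [map_smul, Matrix.smul_apply, hx]
  refine cohomologyMap_eq _ _ _ _ i fun a ha => ?_
  have := sub_mem_coboundaries (gr := B.actGr V) (d := B.actD V) (gr' := C.actGr V)
    (d' := C.actD V) (h.act (V := V)).toLinearMap
    (fun {i a} ha => ?_) (fun a => ?_) ha
  · change polyEval 1 (h.act a 1 1) - polyEval 0 (h.act a 1 1) ∈ _ at this
    exact (congrArg₂ (fun x y : C.ActAlg V => x - y) (ev h.eval_one a) (ev h.eval_zero a)) ▸ this
  · refine actGr_induction (fun x hx => h.act_mono_mem hx) ?_ (fun x y hx hy => ?_)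
      (fun r x hx => ?_) ha
    · rw [map_zero]; exact zero_mem _
    · rw [map_add]; exact add_mem hx hy
    · rw [map_smul]; exact Submodule.smul_mem _ r hx
  · refine act_induction (fun i x hx => h.act_mono_comm hx) ?_ (fun x y hx hy => ?_)
      (fun r x hx => ?_) a
    · simp only [map_zero]
    · simp only [map_add, hx, hy]
    · simp only [map_smul, hx]

end Homotopy

end Act

end DGAlg

/-! ### Free generators and lifting from quasifree algebras -/

section Words

variable {X : Type u}

/-- The degree of a word. -/
def wordDeg (deg : X → ℤ) (w : FreeSemigroup X) : ℤ :=
  (FreeSemigroup.lift (fun e => Multiplicative.ofAdd (deg e)) w).toAdd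

lemma wordDeg_of (deg : X → ℤ) (e : X) : wordDeg deg (FreeSemigroup.of e) = deg e := by
  simp [wordDeg]

lemma wordDeg_mul (deg : X → ℤ) (w w' : FreeSemigroup X) :
    wordDeg deg (w * w') = wordDeg deg w + wordDeg deg w' := by
  simp [wordDeg]

/-- All letters of the word satisfy `p`. -/
def AllLetters (p : X → Prop) (w : FreeSemigroup X) : Prop := ∀ e ∈ w.head :: w.tail, p e

lemma allLetters_of {p : X → Prop} {e : X} : AllLetters p (FreeSemigroup.of e) ↔ p e := by
  simp [AllLetters, FreeSemigroup.of]

lemma allLetters_mul {p : X → Prop} {w w' : FreeSemigroup X} :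
    AllLetters p (w * w') ↔ AllLetters p w ∧ AllLetters p w' := by
  simp only [AllLetters, FreeSemigroup.head_mul, FreeSemigroup.tail_mul, List.mem_cons,
    List.mem_append]
  grind

lemma AllLetters.mono {p q : X → Prop} {w : FreeSemigroup X} (hw : AllLetters p w)
    (h : ∀ e, p e → q e) : AllLetters q w := fun e he => h e (hw e he)

lemma wordDeg_nonpos {deg : X → ℤ} (h : ∀ e, deg e ≤ 0) (w : FreeSemigroup X) :
    wordDeg deg w ≤ 0 := by
  induction w using FreeSemigroup.recOnMul with
  | ih1 e => rw [wordDeg_of]; exact h e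
  | ih2 e w h1 h2 => rw [wordDeg_mul]; exact add_nonpos h1 h2

/-- The remaining letters contribute nonpositive degrees. Hence the differential of a generator of
degree `n`, being of degree `n + 1`, involves only generators of degree greater than `n`; this makes
recursion on generators terminate. -/
lemma allLetters_le_deg {deg : X → ℤ} (h : ∀ e, deg e ≤ 0) (w : FreeSemigroup X) :
    AllLetters (fun e => wordDeg deg w ≤ deg e) w := by
  induction w using FreeSemigroup.recOnMul with
  | ih1 e => rw [allLetters_of, wordDeg_of]
  | ih2 e w h1 h2 =>
    have e1 := wordDeg_nonpos h (FreeSemigroup.of e)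
    have e2 := wordDeg_nonpos h w
    rw [allLetters_mul, wordDeg_mul]
    exact ⟨h1.mono fun _ he => by omega, h2.mono fun _ he => by omega⟩

lemma lift_congr {S : Type*} [Semigroup S] {v v' : X → S} {w : FreeSemigroup X}
    (h : AllLetters (fun e => v e = v' e) w) :
    FreeSemigroup.lift v w = FreeSemigroup.lift v' w := by
  induction w using FreeSemigroup.recOnMul with
  | ih1 e => simpa [allLetters_of] using h
  | ih2 e w h1 h2 =>
    rw [allLetters_mul] at h
    rw [map_mul, map_mul, h1 h.1, h2 h.2]

end Words

/-- A graded vector space of free generators of a dg-algebra, given by a homogeneous basis. -/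
structure FreeGens {K : Type u} [Field K] (B : DGAlg K) (X : Type u) where
  deg : X → ℤ
  gen : X → B
  gen_mem : ∀ e, gen e ∈ B.gr (deg e)
  bijective : Function.Bijective (MonoidAlgebra.liftMagma K (FreeSemigroup.lift gen))

namespace FreeGens

variable {K : Type u} [Field K] {B : DGAlg K} {X : Type u} (F : FreeGens B X)

/-- The product of the letters of a word. -/
def word (w : FreeSemigroup X) : B := FreeSemigroup.lift F.gen w

lemma word_of (e : X) : F.word (FreeSemigroup.of e) = F.gen e := by simp [word]

lemma word_mul (w w' : FreeSemigroup X) : F.word (w * w') = F.word w * F.word w' := by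
  simp [word]

lemma word_mem (w : FreeSemigroup X) : F.word w ∈ B.gr (wordDeg F.deg w) := by
  induction w using FreeSemigroup.recOnMul with
  | ih1 e => rw [wordDeg_of, word_of]; exact F.gen_mem e
  | ih2 e w h1 h2 => rw [wordDeg_mul, word_mul]; exact B.mul_mem h1 h2

lemma liftMagma_single {S : Type*} [NonUnitalRing S] [Module K S] [IsScalarTower K S S]
    [SMulCommClass K S S] (f : FreeSemigroup X →ₙ* S) (w : FreeSemigroup X) (c : K) :
    MonoidAlgebra.liftMagma K f (MonoidAlgebra.single w c) = c • f w := by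
  simp [MonoidAlgebra.liftMagma]

@[elab_as_elim]
lemma induction {p : B → Prop} (word : ∀ w, p (F.word w)) (zero : p 0)
    (add : ∀ x y, p x → p y → p (x + y)) (smul : ∀ (c : K) x, p x → p (c • x)) (b : B) : p b := by
  obtain ⟨y, rfl⟩ := F.bijective.2 b
  induction y using MonoidAlgebra.induction_linear with
  | zero => rwa [map_zero]
  | add f g hf hg => rw [map_add]; exact add _ _ hf hg
  | single w c =>
    rw [liftMagma_single]
    exact smul c _ (word w)

/-- Words span and are homogeneous, so the projection to degree `i` keeps the words of degree `i`
and kills the others. -/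
lemma mem_span {i : ℤ} {b : B} (hb : b ∈ B.gr i) :
    b ∈ Submodule.span K {y | ∃ w, wordDeg F.deg w = i ∧ y = F.word w} := by
  suffices h : ∀ b : B, proj B.isInternal i b ∈
      Submodule.span K {y | ∃ w, wordDeg F.deg w = i ∧ y = F.word w} by
    simpa only [proj_of_mem B.isInternal hb] using h b
  refine F.induction (fun w => ?_) ?_ (fun x y hx hy => ?_) (fun c x hx => ?_)
  · by_cases hw : wordDeg F.deg w = i
    · subst hw
      rw [proj_of_mem _ (F.word_mem w)]
      exact Submodule.subset_span ⟨w, rfl, rfl⟩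
    · rw [proj_of_mem_ne _ (F.word_mem w) hw]
      exact zero_mem _
  · rw [map_zero]; exact zero_mem _
  · rw [map_add]; exact add_mem hx hy
  · rw [map_smul]; exact Submodule.smul_mem _ c hx

@[elab_as_elim]
lemma gr_induction {i : ℤ} {p : B → Prop} (word : ∀ w, wordDeg F.deg w = i → p (F.word w))
    (zero : p 0) (add : ∀ x y, p x → p y → p (x + y)) (smul : ∀ (c : K) x, p x → p (c • x))
    {b : B} (hb : b ∈ B.gr i) : p b := by
  refine Submodule.span_induction (p := fun x _ => p x) ?_ zero (fun x y _ _ => add x y)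
    (fun c x _ => smul c x) (F.mem_span hb)
  rintro _ ⟨w, hw, rfl⟩
  exact word w hw

/-- A generator of positive degree would vanish in `B`, against the injectivity of the map from the
free algebra. -/
lemma deg_nonpos (e : X) : F.deg e ≤ 0 := by
  by_contra! h
  have h1 := F.gen_mem e
  rw [B.gr_pos _ h, Submodule.mem_bot] at h1
  have h2 : MonoidAlgebra.single (FreeSemigroup.of e) (1 : K) = 0 := by
    apply F.bijective.1
    rw [liftMagma_single, map_zero, FreeSemigroup.lift_of, h1, smul_zero]
  exact one_ne_zero (MonoidAlgebra.single_eq_zero.1 h2)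

variable {S : Type u} [NonUnitalRing S] [Module K S] [IsScalarTower K S S] [SMulCommClass K S S]

/-- The algebra map with prescribed values on the generators. -/
def lift (v : X → S) : B →ₙₐ[K] S :=
  (MonoidAlgebra.liftMagma K (FreeSemigroup.lift v)).comp
    (NonUnitalAlgHom.inverse _ _ (Function.leftInverse_surjInv F.bijective)
      (Function.rightInverse_surjInv F.bijective.2))

lemma lift_word (v : X → S) (w : FreeSemigroup X) :
    F.lift v (F.word w) = FreeSemigroup.lift v w := by
  have h : F.word w =
      MonoidAlgebra.liftMagma K (FreeSemigroup.lift F.gen) (MonoidAlgebra.single w 1) := by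
    rw [liftMagma_single, one_smul]; rfl
  change MonoidAlgebra.liftMagma K _ (Function.surjInv F.bijective.2 (F.word w)) = _
  rw [h, Function.leftInverse_surjInv F.bijective, liftMagma_single, one_smul]

lemma lift_gen (v : X → S) (e : X) : F.lift v (F.gen e) = v e := by
  rw [← word_of, lift_word, FreeSemigroup.lift_of]

/-- Well-founded recursion along `n` in which `G` always receives a total function: values that are
not yet available are replaced by `0`. -/
lemma exists_rec (n : X → ℕ) (G : X → (X → S) → S) :
    ∃ v : X → S, ∀ e, v e = G e (fun e' => open Classical in if n e' < n e then v e' else 0) := by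
  classical
  let v : X → S := WellFounded.fix (measure n).wf
    fun e v => G e (fun e' => if h : n e' < n e then v e' h else 0)
  refine ⟨v, fun e => ?_⟩
  have h := WellFounded.fix_eq (measure n).wf
    (fun e (v : ∀ y, (measure n).rel y e → S) =>
      G e (fun e' => if h : n e' < n e then v e' h else 0)) e
  refine h.trans ?_
  congr 1

/-- Quasifree dg-algebras lift against acyclic surjections. -/
theorem exists_lift (F : FreeGens B X) (G : ℤ → Submodule K S) (D : S →ₗ[K] S) (π : S →ₙₐ[K] B)
    (hmul : ∀ {i j s t}, s ∈ G i → t ∈ G j → s * t ∈ G (i + j))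
    (hD : ∀ {i j s t}, s ∈ G i → t ∈ G j → D (s * t) = D s * t + (i.negOnePow : ℤ) • (s * D t))
    (hL : ∀ {i b s}, b ∈ B.gr i → s ∈ G (i + 1) → D s = 0 → π s = B.d b →
      ∃ s' ∈ G i, π s' = b ∧ D s' = s) :
    ∃ Ψ : B →ₙₐ[K] S, (∀ b, π (Ψ b) = b) ∧ (∀ {i b}, b ∈ B.gr i → Ψ b ∈ G i) ∧
      ∀ b, D (Ψ b) = Ψ (B.d b) := by
  classical
  -- Generators are treated in order of decreasing degree. The value at `e` is a lift of the
  -- generator whose differential is the value already forced on `d e`; the default `0` turns out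
  -- never to be needed.
  obtain ⟨v, hv⟩ := exists_rec (S := S) (fun e => (-F.deg e).toNat) fun e u =>
    if h : ∃ s' ∈ G (F.deg e), π s' = F.gen e ∧ D s' = F.lift u (B.d (F.gen e)) then h.choose
    else 0
  let Good (e : X) : Prop :=
    v e ∈ G (F.deg e) ∧ π (v e) = F.gen e ∧ D (v e) = F.lift v (B.d (F.gen e))
  have hword (w) (hw : AllLetters Good w) : F.lift v (F.word w) ∈ G (wordDeg F.deg w) ∧
      π (F.lift v (F.word w)) = F.word w ∧ D (F.lift v (F.word w)) = F.lift v (B.d (F.word w)) := by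
    induction w using FreeSemigroup.recOnMul with
    | ih1 e =>
      rw [word_of, lift_gen, wordDeg_of]
      exact (allLetters_of (p := Good)).1 hw
    | ih2 e w h1 h2 =>
      rw [allLetters_mul] at hw
      obtain ⟨a1, a2, a3⟩ := h1 hw.1
      obtain ⟨b1, b2, b3⟩ := h2 hw.2
      rw [word_mul, map_mul, wordDeg_mul]
      refine ⟨hmul a1 b1, by rw [map_mul, a2, b2], ?_⟩
      rw [hD a1 b1, B.d_mul (F.word_mem _), map_add, Units.smul_def, map_zsmul, map_mul, map_mul,
        a3, b3]
  have hgood (N : ℕ) : ∀ e, (-F.deg e).toNat = N → Good e := by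
    induction N using Nat.strong_induction_on with
    | _ N ih =>
      intro e he
      have hdeg := F.deg_nonpos
      -- Every letter of a word in `d e` comes strictly before `e` in the recursion.
      have hlet (w) (hw : wordDeg F.deg w = F.deg e + 1) :
          AllLetters (fun e' => (-F.deg e').toNat < (-F.deg e).toNat) w := by
        refine (allLetters_le_deg F.deg_nonpos w).mono fun e' he' => ?_
        have := hdeg e'
        have := hdeg e
        omega
      have hdx := B.d_mem (F.gen_mem e)
      have hlow {b : B} (hb : b ∈ B.gr (F.deg e + 1)) : F.lift v b ∈ G (F.deg e + 1) ∧
          π (F.lift v b) = b ∧ D (F.lift v b) = F.lift v (B.d b) := by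
        refine F.gr_induction (fun w hw => ?_) ?_ (fun x y hx hy => ?_) (fun c x hx => ?_) hb
        · rw [← hw]
          exact hword w ((hlet w hw).mono fun e' he' => ih _ (he ▸ he') e' rfl)
        · simp only [map_zero, and_true, zero_mem]
        · simp only [map_add, hx.2.1, hx.2.2, hy.2.1, hy.2.2, and_true]
          exact add_mem hx.1 hy.1
        · simp only [map_smul, hx.2.1, hx.2.2, and_true]
          exact Submodule.smul_mem _ c hx.1
      -- Cutting off the values from `e` onwards does not change the image of `d e`, so the
      -- recursive choice at `e` may be read with the full family `v`.
      have hu : F.lift (fun e' => if (-F.deg e').toNat < (-F.deg e).toNat then v e' else 0)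
          (B.d (F.gen e)) = F.lift v (B.d (F.gen e)) := by
        refine F.gr_induction (fun w hw => ?_) ?_ (fun x y hx hy => ?_) (fun c x hx => ?_) hdx
        · rw [lift_word, lift_word]
          exact lift_congr ((hlet w hw).mono fun e' he' => if_pos he')
        · simp only [map_zero]
        · simp only [map_add, hx, hy]
        · simp only [map_smul, hx]
      obtain ⟨c1, c2, c3⟩ := hlow hdx
      -- The element prescribed as differential is closed because `d (d e) = 0` and `F.lift v`
      -- already commutes with differentials in this degree.
      have hex := hL (F.gen_mem e) c1 (by rw [c3, B.d_d, map_zero]) c2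
      have hve := hv e
      rw [hu, dif_pos hex] at hve
      have := hex.choose_spec
      rw [← hve] at this
      exact this
  have hw (w) := hword w fun e _ => hgood _ e rfl
  refine ⟨F.lift v, fun b => ?_, fun {i b} hb => ?_, fun b => ?_⟩
  · refine F.induction (fun w => (hw w).2.1) ?_ (fun x y hx hy => ?_) (fun c x hx => ?_) b
    · simp only [map_zero]
    · simp only [map_add, hx, hy]
    · simp only [map_smul, hx]
  · refine F.gr_induction (fun w h => h ▸ (hw w).1) ?_ (fun x y hx hy => ?_) (fun c x hx => ?_) hb
    · rw [map_zero]; exact zero_mem _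
    · rw [map_add]; exact add_mem hx hy
    · rw [map_smul]; exact Submodule.smul_mem _ c hx
  · refine F.induction (fun w => (hw w).2.2) ?_ (fun x y hx hy => ?_) (fun c x hx => ?_) b
    · simp only [map_zero]
    · simp only [map_add, hx, hy]
    · simp only [map_smul, hx]

end FreeGens

/-! ### Induced maps on cohomology: elementwise criteria and functoriality -/

section CohomologyMap

variable {K : Type u} [Field K] {M N : Type u} [AddCommGroup M] [Module K M]
  [AddCommGroup N] [Module K N] {gr : ℤ → Submodule K M} {d : M →ₗ[K] M}
  {gr' : ℤ → Submodule K N} {d' : N →ₗ[K] N} {f : M →ₗ[K] N}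
  {hf : ∀ i, ∀ a ∈ gr i, f a ∈ gr' i} {hfd : ∀ a, f (d a) = d' (f a)} {i : ℤ}

lemma cohomologyMap_injective_iff : Function.Injective (cohomologyMap f hf hfd i) ↔
    ∀ a ∈ gr i, d a = 0 → ∀ c ∈ gr' (i - 1), d' c = f a → ∃ b ∈ gr (i - 1), d b = a := by
  rw [injective_iff_map_eq_zero]
  constructor
  · intro h a ha hda c hc hca
    have h1 := h (Submodule.Quotient.mk ⟨a, ha, hda⟩)
      ((Submodule.Quotient.mk_eq_zero _).2 ⟨c, hc, hca⟩)
    exact (Submodule.Quotient.mk_eq_zero _).1 h1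
  · intro h x hx
    induction x using Submodule.Quotient.induction_on with
    | _ a =>
      obtain ⟨c, hc, hca⟩ := (Submodule.Quotient.mk_eq_zero _).1 hx
      exact (Submodule.Quotient.mk_eq_zero _).2 (h a.1 a.2.1 a.2.2 c hc hca)

lemma cohomologyMap_surjective_iff : Function.Surjective (cohomologyMap f hf hfd i) ↔
    ∀ c ∈ gr' i, d' c = 0 → ∃ a ∈ gr i, d a = 0 ∧ ∃ b ∈ gr' (i - 1), d' b = c - f a := by
  constructor
  · intro h c hc hdc
    obtain ⟨x, hx⟩ := h (Submodule.Quotient.mk ⟨c, hc, hdc⟩)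
    induction x using Submodule.Quotient.induction_on with
    | _ a => exact ⟨a.1, a.2.1, a.2.2, (Submodule.Quotient.eq _).1 hx.symm⟩
  · intro h y
    induction y using Submodule.Quotient.induction_on with
    | _ c =>
      obtain ⟨a, ha, hda, hb⟩ := h c.1 c.2.1 c.2.2
      exact ⟨Submodule.Quotient.mk ⟨a, ha, hda⟩, Eq.symm ((Submodule.Quotient.eq _).2 hb)⟩

end CohomologyMap

namespace DGAlg

variable {K : Type u} [Field K]

lemma Hom.H_comp {A B C : DGAlg K} (g : Hom B C) (f : Hom A B) (i : ℤ) :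
    (g.comp f).H i = g.H i ∘ₗ f.H i :=
  Submodule.linearMap_qext _ (LinearMap.ext fun _ => rfl)

lemma Hom.H_id (A : DGAlg K) (i : ℤ) : (Hom.id A).H i = LinearMap.id :=
  Submodule.linearMap_qext _ (LinearMap.ext fun _ => rfl)

end DGAlg

lemma CDGAlg.Hom.H_comp {K : Type u} [Field K] {A B C : CDGAlg K} (g : Hom B C) (f : Hom A B)
    (i : ℤ) : (g.comp f).H i = g.H i ∘ₗ f.H i :=
  Submodule.linearMap_qext _ (LinearMap.ext fun _ => rfl)

lemma CDGAlg.Hom.H_id {K : Type u} [Field K] (A : CDGAlg K) (i : ℤ) :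
    (Hom.id A).H i = LinearMap.id :=
  Submodule.linearMap_qext _ (LinearMap.ext fun _ => rfl)

namespace DGAlg

variable {K : Type u} [Field K]

lemma actCoordMap_comp (V : Type u) [AddCommGroup V] [Module K V] {A B C : DGAlg K}
    (g : Hom B C) (f : Hom A B) :
    actCoordMap V (g.comp f) = (actCoordMap V g).comp (actCoordMap V f) := by
  refine CDGAlg.Hom.ext fun x => ?_
  change actMapAlg (g.comp f) x = actMapAlg g (actMapAlg f x)
  refine act_induction (fun i x hx => ?_) ?_ (fun x y hx hy => ?_) (fun c x hx => ?_) x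
  · induction hx with
    | one => simp only [map_one]
    | mul m ha _ ih =>
      rw [map_mul, map_mul, map_mul, ih, actMapAlg_t, actMapAlg_t, actMapAlg_t]
      rfl
  · simp only [map_zero]
  · simp only [map_add, hx, hy]
  · simp only [map_smul, hx]

lemma actCoordMap_id (V : Type u) [AddCommGroup V] [Module K V] (A : DGAlg K) :
    actCoordMap V (Hom.id A) = CDGAlg.Hom.id (A.actCoord V) := by
  refine CDGAlg.Hom.ext fun x => ?_
  change actMapAlg (Hom.id A) x = x
  refine act_induction (fun i x hx => ?_) ?_ (fun x y hx hy => ?_) (fun c x hx => ?_) x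
  · induction hx with
    | one => simp only [map_one]
    | mul m ha _ ih => rw [map_mul, ih, actMapAlg_t]; rfl
  · simp only [map_zero]
  · simp only [map_add, hx, hy]
  · simp only [map_smul, hx]

/-! ### Lifting along quasi-isomorphisms up to homotopy -/

section Lifting

variable {A B C : DGAlg K} (f : Hom A C) (q : Hom B C)

/-- The forms of degree `i` on the line with coefficients in `C`, whose value at `0` is lifted
to `A` and whose value at `1` is lifted to `B`. -/
def cylGr (i : ℤ) :
    Submodule K (B × A × Matrix (Fin 2) (Fin 2) (C ⊗[K] K[X])) where
  carrier := {s | s.1 ∈ B.gr i ∧ s.2.1 ∈ A.gr i ∧ s.2.2 ∈ pathGr C.gr i ∧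
    polyEval 0 (s.2.2 1 1) = f.toFun s.2.1 ∧ polyEval 1 (s.2.2 1 1) = q.toFun s.1}
  add_mem' := by
    rintro x y ⟨a1, a2, a3, a4, a5⟩ ⟨b1, b2, b3, b4, b5⟩
    refine ⟨add_mem a1 b1, add_mem a2 b2, add_mem a3 b3, ?_, ?_⟩
    · simp [a4, b4]
    · simp [a5, b5]
  zero_mem' := ⟨zero_mem _, zero_mem _, zero_mem _, by simp, by simp⟩
  smul_mem' := by
    rintro c x ⟨a1, a2, a3, a4, a5⟩
    refine ⟨Submodule.smul_mem _ c a1, Submodule.smul_mem _ c a2, Submodule.smul_mem _ c a3, ?_, ?_⟩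
    · simp [a4]
    · simp [a5]

/-- The lower left entries vanish. -/
lemma pathGr_mul_apply {R : Type u} [NonUnitalRing R] [Module K R]
    [IsScalarTower K R R] [SMulCommClass K R R]
    {gr : ℤ → Submodule K R} {i j : ℤ} {x y : Matrix (Fin 2) (Fin 2) (R ⊗[K] K[X])}
    (hx : x ∈ pathGr gr i) (hy : y ∈ pathGr gr j) : (x * y) 1 1 = x 1 1 * y 1 1 := by
  obtain ⟨φ, -, η, -, rfl⟩ := hx
  obtain ⟨φ', -, η', -, rfl⟩ := hy
  rw [pathMat_mul]
  rfl

variable {f q} in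
lemma cylGr_mul {i j : ℤ} {s t : B × A × Matrix (Fin 2) (Fin 2) (C ⊗[K] K[X])}
    (hs : s ∈ cylGr f q i) (ht : t ∈ cylGr f q j) : s * t ∈ cylGr f q (i + j) := by
  obtain ⟨a1, a2, a3, a4, a5⟩ := hs
  obtain ⟨b1, b2, b3, b4, b5⟩ := ht
  refine ⟨B.mul_mem a1 b1, A.mul_mem a2 b2, pathGr_mul C.isDG a3 b3, ?_, ?_⟩
  · refine (congrArg _ (pathGr_mul_apply a3 b3)).trans ?_
    rw [polyEval_mul, a4, b4]
    exact (map_mul _ _ _).symm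
  · refine (congrArg _ (pathGr_mul_apply a3 b3)).trans ?_
    rw [polyEval_mul, a5, b5]
    exact (map_mul _ _ _).symm

variable (A B C) in
/-- The differential of the cylinder. -/
def cylD : B × A × Matrix (Fin 2) (Fin 2) (C ⊗[K] K[X]) →ₗ[K]
    B × A × Matrix (Fin 2) (Fin 2) (C ⊗[K] K[X]) :=
  B.d.prodMap (A.d.prodMap (pathD C.d))

variable {f q} in
lemma cylD_mul {i j : ℤ} {s t : B × A × Matrix (Fin 2) (Fin 2) (C ⊗[K] K[X])}
    (hs : s ∈ cylGr f q i) (ht : t ∈ cylGr f q j) :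
    cylD A B C (s * t) = cylD A B C s * t + (i.negOnePow : ℤ) • (s * cylD A B C t) := by
  obtain ⟨a1, a2, a3, a4, a5⟩ := hs
  obtain ⟨b1, b2, b3, b4, b5⟩ := ht
  refine Prod.ext ?_ (Prod.ext ?_ ?_)
  · exact B.isDG.d_mul a1 t.1
  · exact A.isDG.d_mul a2 t.2.1
  · exact pathD_mul C.isDG a3 b3

variable [CharZero K]

variable {f} in
-- The projection from triples to `B` behaves as an acyclic surjection because `f` is a
-- quasi-isomorphism. Let `(d b, α, φ₁ + dt η₁)` be the closed triple and `I = ∫ η₁`. By Stokes, `f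
-- α = d (q b - I)`, so injectivity on cohomology gives `α = d y₀`. The cocycle `f y₀ - (q b - I)`
-- equals `f z + d w` by surjectivity, with `z` a cocycle. Then `y₀ - z` has the same differential
-- `α`, and `f (y₀ - z) = q b - I + d w`; the error `d w` is absorbed by adding the constant form
-- `-dt w` to the path.
lemma cylGr_lift (hf : f.IsQuasiIso) {i : ℤ} {b : B}
    {s : B × A × Matrix (Fin 2) (Fin 2) (C ⊗[K] K[X])} (hb : b ∈ B.gr i)
    (hs : s ∈ cylGr f q (i + 1)) (hDs : cylD A B C s = 0) (hsb : s.1 = B.d b) :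
    ∃ s' ∈ cylGr f q i, s'.1 = b ∧ cylD A B C s' = s := by
  obtain ⟨b', α, ψ⟩ := s
  obtain ⟨-, hα, ⟨φ₁, hφ₁, η₁, hη₁, rfl⟩, h0, h1⟩ := hs
  replace hη₁ : η₁ ∈ polyGr C.gr i := by simpa using hη₁
  change b' = B.d b at hsb
  subst hsb
  change polyEval 0 φ₁ = f.toFun α at h0
  change polyEval 1 φ₁ = q.toFun (B.d b) at h1
  have hdα : A.d α = 0 := congrArg (fun s => s.2.1) hDs
  have hdψ : pathD C.d (pathMat (i + 1) φ₁ η₁) = 0 := congrArg (fun s => s.2.2) hDs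
  rw [pathD_pathMat, ← pathMat_zero (i + 1 + 1)] at hdψ
  have hder : polyDeriv φ₁ = polyMap C.d η₁ := by
    rw [eq_comm, ← neg_add_eq_zero]
    exact (pathMat_inj hdψ).2
  let I : C := polyEval 1 (polyInt η₁)
  have hI : I ∈ C.gr i := polyEval_mem 1 (polyInt_mem hη₁)
  -- Closedness of the path gives `φ₁' = d η₁`; integrate it from `0` to `1`.
  have hdI : C.d I = q.toFun (B.d b) - f.toFun α := by
    rw [← h0, ← h1, ← polyEval_polyInt_polyDeriv, hder, polyInt_polyMap, polyEval_polyMap]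
  have hc := q.map_mem hb
  -- The class of `α` dies in the cohomology of `C`, as `f α` bounds `q b - I`.
  obtain ⟨y₀, hy₀, hdy₀⟩ := cohomologyMap_injective_iff.1 (hf (i + 1)).1 α hα hdα
    (q.toFun b - I) (by simpa using sub_mem hc hI) (by
      rw [map_sub, hdI, q.map_d]
      exact sub_sub_cancel _ _)
  replace hy₀ : y₀ ∈ A.gr i := by simpa using hy₀
  obtain ⟨z, hz, hdz, w, hw, hdw⟩ := cohomologyMap_surjective_iff.1 (hf i).2
    (f.toFun y₀ - (q.toFun b - I)) (sub_mem (f.map_mem hy₀) (sub_mem hc hI)) (by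
      rw [map_sub, map_sub, hdI, ← q.map_d, ← f.map_d, hdy₀]
      abel)
  have hfz : C.d w = f.toFun y₀ - (q.toFun b - I) - f.toFun z := hdw
  have hy : y₀ - z ∈ A.gr i := sub_mem hy₀ hz
  -- The path must start at `f (y₀ - z)` and satisfy `φ' - dη = η₁`, which determines `φ` once `η`
  -- is given. The constant `η = -w` makes it end at `f (y₀ - z) + I - d w = q b`.
  let η : C ⊗[K] K[X] := -(w ⊗ₜ[K] 1)
  let φ : C ⊗[K] K[X] := f.toFun (y₀ - z) ⊗ₜ[K] 1 + polyInt (η₁ + polyMap C.d η)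
  have hη : η ∈ polyGr C.gr (i - 1) := neg_mem (tmul_mem_polyGr hw 1)
  have hdη : polyMap C.d η ∈ polyGr C.gr i :=
    polyMap_mem (fun a ha => by simpa using C.d_mem ha) hη
  have hφ : φ ∈ polyGr C.gr i :=
    add_mem (tmul_mem_polyGr (f.map_mem hy) 1) (polyInt_mem (add_mem hη₁ hdη))
  have hddη : polyMap C.d (polyMap C.d η) = 0 := by
    simp [η, polyMap_tmul, C.d_d]
  have e1 : polyEval 1 (polyInt (w ⊗ₜ[K] (1 : K[X]))) = w := by
    have : integral K (1 : K[X]) = Polynomial.X := by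
      rw [← Polynomial.monomial_zero_one, integral_monomial]
      simp [Polynomial.X]
    rw [polyInt_tmul, this, polyEval_tmul, Polynomial.eval_X, one_smul]
  refine ⟨(b, y₀ - z, pathMat i φ η), ⟨hb, hy, ⟨φ, hφ, η, hη, rfl⟩, ?_, ?_⟩, rfl, ?_⟩
  · change polyEval 0 φ = f.toFun (y₀ - z)
    simp [φ, polyEval_tmul, polyEval_zero_polyInt]
  · change polyEval 1 φ = q.toFun b
    have e2 : polyEval 1 (polyInt (polyMap C.d η)) = -C.d w := by
      rw [polyInt_polyMap, polyEval_polyMap]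
      simp only [η, map_neg, e1]
    rw [map_add, map_add, map_add, e2, hfz, polyEval_tmul, Polynomial.eval_one, one_smul, map_sub]
    change f.toFun y₀ - f.toFun z + (I + _) = _
    abel
  · refine Prod.ext rfl (Prod.ext ?_ ?_)
    · change A.d (y₀ - z) = α
      have hdz' : A.d z = 0 := hdz
      rw [map_sub, hdy₀, hdz', sub_zero]
    · change pathD C.d (pathMat i φ η) = pathMat (i + 1) φ₁ η₁
      -- Here `dφ = f α + ∫ dη₁`, with `dη₁ = φ₁'` and `f α = φ₁(0)`, so integration returns `φ₁`.
      have e3 : polyMap C.d φ = φ₁ := by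
        have hdz' : A.d z = 0 := hdz
        rw [map_add, ← polyInt_polyMap, map_add, hddη, add_zero, ← hder, polyInt_polyDeriv, h0,
          polyMap_tmul, ← f.map_d, map_sub, hdy₀, hdz', sub_zero]
        exact add_sub_cancel _ _
      have e4 : polyDeriv φ = η₁ + polyMap C.d η := by
        rw [map_add, polyDeriv_polyInt, polyDeriv_tmul, Polynomial.derivative_one,
          TensorProduct.tmul_zero, zero_add]
      rw [pathD_pathMat, e3, e4]
      congr 1
      abel

variable {f} in
/-- Morphisms from a quasifree dg-algebra lift along quasi-isomorphisms, up to homotopy. -/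
theorem exists_homotopy_lift (hB : B.IsQuasifree) (hf : f.IsQuasiIso) :
    ∃ g : Hom B A, Nonempty (Homotopy (f.comp g) q) := by
  obtain ⟨X, deg, x, hx, hbij⟩ := hB
  let F : FreeGens B X := ⟨deg, x, hx, hbij⟩
  -- A section of the projection to `B` has as its second component the lift `g` and as its third
  -- the homotopy from `f ∘ g` to `q`. The spaces `cylGr` need not span the product; only
  -- homogeneous triples with matching endpoints are ever used.
  obtain ⟨Ψ, h1, h2, h3⟩ := F.exists_lift (cylGr f q) (cylD A B C)
    (NonUnitalAlgHom.fst K B (A × Matrix (Fin 2) (Fin 2) (C ⊗[K] K[X]))) cylGr_mul cylD_mul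
    (cylGr_lift q hf)
  -- The endpoint conditions are part of `cylGr` and so known for homogeneous elements; additivity
  -- extends them to all.
  have hmem (b : B) : polyEval 0 ((Ψ b).2.2 1 1) = f.toFun (Ψ b).2.1 ∧
      polyEval 1 ((Ψ b).2.2 1 1) = q.toFun b := by
    induction b using graded_induction B.isInternal with
    | hom i b hb =>
      have := h2 hb
      refine ⟨this.2.2.2.1, this.2.2.2.2.trans ?_⟩
      exact congrArg _ (h1 b)
    | add a b ha hb =>
      simp only [map_add, Prod.snd_add, Prod.fst_add, Matrix.add_apply, ha.1, ha.2, hb.1, hb.2,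
        and_self]
  refine ⟨⟨(NonUnitalAlgHom.fst K _ _).comp ((NonUnitalAlgHom.snd K _ _).comp Ψ),
    fun hb => (h2 hb).2.1, fun b => (congrArg (fun s => s.2.1) (h3 b)).symm⟩, ⟨?_⟩⟩
  exact
    { toFun := (NonUnitalAlgHom.snd K _ _).comp ((NonUnitalAlgHom.snd K _ _).comp Ψ)
      mem := fun hb => (h2 hb).2.2.1
      comm := fun b => (congrArg (fun s => s.2.2) (h3 b)).symm
      eval_zero := fun b => (hmem b).1
      eval_one := fun b => (hmem b).2 }

/-- Lift the identity of `B₂` along `f`, so that `f ∘ g` is homotopic to the identity. On cohomology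
`g` is then inverse to `f`, and homotopy invariance gives the second claim. On coordinate algebras
this yields a one-sided inverse only, since nothing is assumed there about `f`. -/
lemma exists_right_inverse {B₁ B₂ : DGAlg K} {f : Hom B₁ B₂} (hB : B₂.IsQuasifree)
    (hf : f.IsQuasiIso) (V : Type u) [AddCommGroup V] [Module K V] :
    ∃ g : Hom B₂ B₁, g.IsQuasiIso ∧
      ∀ i, (actCoordMap V f).H i ∘ₗ (actCoordMap V g).H i = LinearMap.id := by
  obtain ⟨g, ⟨h⟩⟩ := exists_homotopy_lift (Hom.id B₂) hB hf
  refine ⟨g, fun i => ?_, fun i => ?_⟩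
  · have h1 : f.H i ∘ₗ g.H i = LinearMap.id := by
      rw [← Hom.H_comp, h.H_eq, Hom.H_id]
    have h2 : Function.Bijective (f.H i ∘ g.H i) := by
      rw [← LinearMap.coe_comp, h1]
      exact Function.bijective_id
    exact (Function.Bijective.of_comp_iff' (hf i) _).1 h2
  · rw [← CDGAlg.Hom.H_comp, ← actCoordMap_comp, h.actCoordMap_H_eq, actCoordMap_id,
      CDGAlg.Hom.H_id]

/-- A quasi-isomorphism of quasifree dg-algebras induces isomorphisms on the cohomology of the
coordinate algebras of the spaces of actions. -/
theorem actCoordMap_H_bijective {B₁ B₂ : DGAlg K} {f : Hom B₁ B₂} (h₁ : B₁.IsQuasifree)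
    (h₂ : B₂.IsQuasifree) (hf : f.IsQuasiIso) (V : Type u) [AddCommGroup V] [Module K V] (i : ℤ) :
    Function.Bijective ((actCoordMap V f).H i) := by
  obtain ⟨g, hg, hfg⟩ := exists_right_inverse h₂ hf V
  -- As `g` is itself a quasi-isomorphism to a quasifree algebra, it also has a right inverse up to
  -- homotopy.
  obtain ⟨k, -, hgk⟩ := exists_right_inverse h₁ hg V
  have e1 := LinearMap.congr_fun (hfg i)
  have e2 := LinearMap.congr_fun (hgk i)
  refine ⟨Function.LeftInverse.injective (g := (actCoordMap V g).H i) fun x => ?_,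
    fun y => ⟨_, e1 y⟩⟩
  -- On cohomology `f = f g k = k`, so that `g f = g k = 1`.
  have e3 : (actCoordMap V f).H i x = (actCoordMap V k).H i x := by
    conv_lhs => rw [← show _ = x from e2 x]
    exact e1 _
  rw [e3]
  exact e2 x

end Lifting

end DGAlg

/-! ### Free algebras with a differential prescribed on generators -/

section FreeDG

/-- The free associative algebra without unit. -/
abbrev FreeNU (K Y : Type u) [Field K] : Type u := MonoidAlgebra K (FreeSemigroup Y)

variable {K : Type u} [Field K] {Y : Type u}

variable (K) in
/-- A word, as an element of the free algebra. -/
def wordEl (w : FreeSemigroup Y) : FreeNU K Y := MonoidAlgebra.single w 1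

lemma wordEl_mul (w w' : FreeSemigroup Y) : wordEl K (w * w') = wordEl K w * wordEl K w' := by
  simp [wordEl, MonoidAlgebra.single_mul_single]

lemma single_eq (w : FreeSemigroup Y) (c : K) :
    (MonoidAlgebra.single w c : FreeNU K Y) = c • wordEl K w := by
  simp [wordEl]

@[elab_as_elim]
lemma freeNU_induction {p : FreeNU K Y → Prop} (word : ∀ w, p (wordEl K w)) (zero : p 0)
    (add : ∀ x y, p x → p y → p (x + y)) (smul : ∀ (c : K) x, p x → p (c • x))
    (b : FreeNU K Y) : p b := by
  induction b using MonoidAlgebra.induction_linear with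
  | zero => exact zero
  | add f g hf hg => exact add _ _ hf hg
  | single w c =>
    rw [single_eq]
    exact smul c _ (word w)

section Lift

variable {S : Type u} [NonUnitalRing S] [Module K S] [IsScalarTower K S S] [SMulCommClass K S S]

/-- The algebra map with prescribed values on the generators. -/
def freeLift (v : Y → S) : FreeNU K Y →ₙₐ[K] S :=
  MonoidAlgebra.liftMagma K (FreeSemigroup.lift v)

lemma freeLift_wordEl (v : Y → S) (w : FreeSemigroup Y) :
    freeLift v (wordEl K w) = FreeSemigroup.lift v w := by
  rw [freeLift, wordEl, FreeGens.liftMagma_single, one_smul]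

lemma freeLift_of (v : Y → S) (e : Y) :
    freeLift v (wordEl K (FreeSemigroup.of e)) = v e := by
  rw [freeLift_wordEl, FreeSemigroup.lift_of]

end Lift

variable (deg : Y → ℤ)

variable (K) in
/-- The graded components of the free algebra. -/
def freeGr (i : ℤ) : Submodule K (FreeNU K Y) :=
  Submodule.span K {x | ∃ w, wordDeg deg w = i ∧ x = wordEl K w}

variable {deg}

lemma wordEl_mem (w : FreeSemigroup Y) : wordEl K w ∈ freeGr K deg (wordDeg deg w) :=
  Submodule.subset_span ⟨w, rfl, rfl⟩

lemma of_mem (e : Y) : wordEl K (FreeSemigroup.of e) ∈ freeGr K deg (deg e) := by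
  rw [← wordDeg_of deg e]
  exact wordEl_mem _

@[elab_as_elim]
lemma freeGr_induction {i : ℤ} {p : FreeNU K Y → Prop}
    (word : ∀ w, wordDeg deg w = i → p (wordEl K w))
    (zero : p 0) (add : ∀ x y, p x → p y → p (x + y)) (smul : ∀ (c : K) x, p x → p (c • x))
    {b : FreeNU K Y} (hb : b ∈ freeGr K deg i) : p b := by
  refine Submodule.span_induction (p := fun x _ => p x) ?_ zero (fun x y _ _ => add x y)
    (fun c x _ => smul c x) hb
  rintro _ ⟨w, hw, rfl⟩
  exact word w hw

lemma freeGr_isInternal : DirectSum.IsInternal (freeGr K deg) := by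
  classical
  let q (i : ℤ) : FreeNU K Y →ₗ[K] FreeNU K Y :=
    (MonoidAlgebra.coeffLinearEquiv K).symm.toLinearMap ∘ₗ
      (Finsupp.lsum ℕ fun w => if wordDeg deg w = i then Finsupp.lsingle w else 0) ∘ₗ
      (MonoidAlgebra.coeffLinearEquiv K).toLinearMap
  have hq (i : ℤ) (w : FreeSemigroup Y) :
      q i (wordEl K w) = if wordDeg deg w = i then wordEl K w else 0 := by
    simp only [q, wordEl, LinearMap.comp_apply, LinearEquiv.coe_coe]
    split_ifs with h <;> simp [h]
  refine isInternal_of_proj _ (fun i => (q i).toAddMonoidHom) (fun i x hx => ?_)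
    (fun i j hj x hx => ?_) (fun x => ?_)
  · change q i x = x
    refine freeGr_induction (fun w hw => ?_) (map_zero _) (fun x y hx hy => ?_)
      (fun c x hx => ?_) hx
    · rw [hq, if_pos hw]
    · rw [map_add, hx, hy]
    · rw [map_smul, hx]
  · change q i x = 0
    refine freeGr_induction (fun w hw => ?_) (map_zero _) (fun x y hx hy => ?_)
      (fun c x hx => ?_) hx
    · rw [hq, if_neg (hw ▸ hj)]
    · rw [map_add, hx, hy, add_zero]
    · rw [map_smul, hx, smul_zero]
  · refine freeNU_induction (fun w => ?_) (zero_mem _) (fun x y hx hy => add_mem hx hy)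
      (fun c x hx => Submodule.smul_mem _ c hx) x
    exact Submodule.mem_iSup_of_mem _ (wordEl_mem w)

lemma freeGr_mul {i j : ℤ} {x y : FreeNU K Y} (hx : x ∈ freeGr K deg i)
    (hy : y ∈ freeGr K deg j) : x * y ∈ freeGr K deg (i + j) := by
  refine freeGr_induction (fun w hw => ?_) ?_ (fun x x' h h' => ?_) (fun c x h => ?_) hx
  · refine freeGr_induction (fun w' hw' => ?_) ?_ (fun y y' h h' => ?_) (fun c y h => ?_) hy
    · rw [← wordEl_mul, ← hw, ← hw', ← wordDeg_mul]
      exact wordEl_mem _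
    · rw [mul_zero]; exact zero_mem _
    · rw [mul_add]; exact add_mem h h'
    · rw [mul_smul_comm]; exact Submodule.smul_mem _ c h
  · rw [zero_mul]; exact zero_mem _
  · rw [add_mul]; exact add_mem h h'
  · rw [smul_mul_assoc]; exact Submodule.smul_mem _ c h

variable (deg) (δ : Y → FreeNU K Y)

/-- The matrix with the parity operator and the differential, on generators. -/
def diffMatGen (e : Y) : Matrix (Fin 2) (Fin 2) (FreeNU K Y) :=
  !![((deg e).negOnePow : ℤ) • wordEl K (FreeSemigroup.of e), δ e;
    0, wordEl K (FreeSemigroup.of e)]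

/-- The algebra map `x ↦ !![± x, d x; 0, x]` that encodes the differential. -/
def diffMat : FreeNU K Y →ₙₐ[K] Matrix (Fin 2) (Fin 2) (FreeNU K Y) :=
  freeLift (diffMatGen deg δ)

/-- The derivation (with signs) of the free algebra with prescribed values on the generators. -/
def freeD : FreeNU K Y →ₗ[K] FreeNU K Y :=
  (Matrix.entryLinearMap K (FreeNU K Y) (0 : Fin 2) (1 : Fin 2)) ∘ₗ
    (diffMat deg δ : FreeNU K Y →ₗ[K] Matrix (Fin 2) (Fin 2) (FreeNU K Y))

variable {deg δ}

lemma freeD_apply (x : FreeNU K Y) : freeD deg δ x = diffMat deg δ x 0 1 := rfl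

/-- The matrices are upper triangular, so their diagonal entries multiply separately: one diagonal
is the parity operator, the other the identity. Only the corner entry carries the differential. -/
lemma diffMat_wordEl (w : FreeSemigroup Y) :
    diffMat deg δ (wordEl K w) 0 0 = ((wordDeg deg w).negOnePow : ℤ) • wordEl K w ∧
      diffMat deg δ (wordEl K w) 1 0 = 0 ∧ diffMat deg δ (wordEl K w) 1 1 = wordEl K w := by
  induction w using FreeSemigroup.recOnMul with
  | ih1 e =>
    rw [diffMat, freeLift_of, wordDeg_of]
    exact ⟨rfl, rfl, rfl⟩
  | ih2 e w h1 h2 =>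
    obtain ⟨a1, a2, a3⟩ := h1
    obtain ⟨b1, b2, b3⟩ := h2
    rw [wordEl_mul, map_mul]
    simp only [Matrix.mul_apply, Fin.sum_univ_two, a1, a2, a3, b1, b2, b3, mul_zero, add_zero,
      zero_mul, zero_add, and_true]
    rw [smul_mul_smul_comm, wordDeg_mul, Int.negOnePow_add, Units.val_mul]

lemma freeD_of (e : Y) : freeD deg δ (wordEl K (FreeSemigroup.of e)) = δ e := by
  rw [freeD_apply, diffMat, freeLift_of]
  rfl

/-- The upper right entry of a product of upper triangular matrices is the Leibniz rule, with the
sign supplied by the upper left entry. -/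
lemma freeD_mul {i : ℤ} {x : FreeNU K Y} (hx : x ∈ freeGr K deg i) (y : FreeNU K Y) :
    freeD deg δ (x * y) = freeD deg δ x * y + (i.negOnePow : ℤ) • (x * freeD deg δ y) := by
  refine freeGr_induction (fun w hw => ?_) ?_ (fun x x' h h' => ?_) (fun c x h => ?_) hx
  · refine freeNU_induction (fun w' => ?_) ?_ (fun y y' h h' => ?_) (fun c y h => ?_) y
    · rw [freeD_apply, map_mul, Matrix.mul_apply, Fin.sum_univ_two, (diffMat_wordEl w).1,
        (diffMat_wordEl w').2.2, smul_mul_assoc, hw, add_comm]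
      rfl
    · simp only [mul_zero, map_zero, smul_zero, add_zero]
    · rw [mul_add, map_add, map_add, h, h', mul_add, mul_add, smul_add]
      abel
    · rw [mul_smul_comm, map_smul, map_smul, h, mul_smul_comm, mul_smul_comm, smul_add,
        smul_comm c]
  · simp only [zero_mul, map_zero, smul_zero, add_zero]
  · rw [add_mul, map_add, map_add, h, h', add_mul, add_mul, smul_add]
    abel
  · rw [smul_mul_assoc, map_smul, map_smul, h, smul_mul_assoc, smul_mul_assoc, smul_add,
      smul_comm c]

lemma freeD_mem (hδ : ∀ e, δ e ∈ freeGr K deg (deg e + 1)) {i : ℤ} {x : FreeNU K Y}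
    (hx : x ∈ freeGr K deg i) : freeD deg δ x ∈ freeGr K deg (i + 1) := by
  refine freeGr_induction (fun w hw => ?_) ?_ (fun x y h h' => ?_) (fun c x h => ?_) hx
  · clear hx
    subst hw
    induction w using FreeSemigroup.recOnMul with
    | ih1 e => rw [freeD_of, wordDeg_of]; exact hδ e
    | ih2 e w h1 h2 =>
      rw [wordEl_mul, freeD_mul (wordEl_mem (FreeSemigroup.of e)), wordDeg_mul]
      refine add_mem ?_ (Submodule.smul_of_tower_mem _ _ ?_)
      · rw [add_right_comm]
        exact freeGr_mul h1 (wordEl_mem _)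
      · rw [add_assoc]
        exact freeGr_mul (wordEl_mem _) h2
  · rw [map_zero]; exact zero_mem _
  · rw [map_add]; exact add_mem h h'
  · rw [map_smul]; exact Submodule.smul_mem _ c h

/-- On a product the two mixed terms `dx · dy` cancel, since `dx` has degree one more than `x`. So
the square of the differential vanishes once it does on generators. -/
lemma freeD_freeD (hδ : ∀ e, δ e ∈ freeGr K deg (deg e + 1)) (hd : ∀ e, freeD deg δ (δ e) = 0)
    (x : FreeNU K Y) : freeD deg δ (freeD deg δ x) = 0 := by
  refine freeNU_induction (fun w => ?_) ?_ (fun x y h h' => ?_) (fun c x h => ?_) x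
  · induction w using FreeSemigroup.recOnMul with
    | ih1 e => rw [freeD_of, hd]
    | ih2 e w h1 h2 =>
      rw [wordEl_mul, freeD_mul (wordEl_mem (FreeSemigroup.of e)), map_add, map_zsmul,
        freeD_mul (freeD_mem hδ (wordEl_mem _)), freeD_mul (wordEl_mem (FreeSemigroup.of e)), h1,
        h2, Int.negOnePow_succ]
      simp
  · simp only [map_zero]
  · simp only [map_add, h, h', add_zero]
  · simp only [map_smul, h, smul_zero]

variable (deg δ) in
/-- The dg-algebra that is free as an algebra, with prescribed differentials of the generators. -/
def freeDG (hdeg : ∀ e, deg e ≤ 0) (hδ : ∀ e, δ e ∈ freeGr K deg (deg e + 1))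
    (hd : ∀ e, freeD deg δ (δ e) = 0) : DGAlg K where
  carrier := FreeNU K Y
  gr := freeGr K deg
  isInternal := freeGr_isInternal
  gr_pos i hi := by
    rw [eq_bot_iff]
    intro x hx
    refine freeGr_induction (fun w hw => ?_) (zero_mem _) (fun x y h h' => add_mem h h')
      (fun c x h => Submodule.smul_mem _ c h) hx
    have := wordDeg_nonpos hdeg w
    omega
  mul_mem := freeGr_mul
  d := freeD deg δ
  d_mem := freeD_mem hδ
  d_d := freeD_freeD hδ hd
  d_mul := freeD_mul

lemma freeDG_isQuasifree (hdeg : ∀ e, deg e ≤ 0) (hδ : ∀ e, δ e ∈ freeGr K deg (deg e + 1))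
    (hd : ∀ e, freeD deg δ (δ e) = 0) : (freeDG deg δ hdeg hδ hd).IsQuasifree := by
  refine ⟨Y, deg, fun e => wordEl K (FreeSemigroup.of e), of_mem, ?_⟩
  suffices h : ∀ y : FreeNU K Y, freeLift (fun e => wordEl K (FreeSemigroup.of e)) y = y by
    exact (funext h : _ = id) ▸ Function.bijective_id
  refine freeNU_induction (fun w => ?_) ?_ (fun x y h h' => ?_) (fun c x h => ?_)
  · rw [freeLift_wordEl]
    induction w using FreeSemigroup.recOnMul with
    | ih1 e => rw [FreeSemigroup.lift_of]
    | ih2 e w h1 h2 => rw [map_mul, h1, h2, wordEl_mul]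
  · exact map_zero _
  · rw [map_add, h, h']
  · rw [map_smul, h]

end FreeDG

/-! ### Quasifree resolutions -/

/-- Expressions for the elements of a quasifree resolution of an algebra: the symbol
`gen n t a` is a generator of degree `-n` that bounds `t` and is mapped to `a`. -/
inductive Term (K A : Type u) : Type u
  | gen (n : ℕ) (t : Term K A) (a : A)
  | zero
  | add (s t : Term K A)
  | smul (c : K) (t : Term K A)
  | mul (s t : Term K A)

namespace Term

variable {K : Type u} [Field K]

/-- The generators. -/
abbrev Gen (K A : Type u) : Type u := ℕ × Term K A × A

/-- The degree of a generator. -/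
def deg {A : Type u} (g : Gen K A) : ℤ := -(g.1 : ℤ)

/-- The element of the free algebra that is denoted by an expression. -/
def eval {A : Type u} : Term K A → FreeNU K (Gen K A)
  | gen n t a => wordEl K (FreeSemigroup.of (n, t, a))
  | zero => 0
  | add s t => s.eval + t.eval
  | smul c t => c • t.eval
  | mul s t => s.eval * t.eval

variable {A : DGAlg K}

/-- Whether the generator of degree `-n` that is to bound `x` and to be mapped to `a` is admissible,
where `s` records the differential of `x` and its image in `A`. -/
def Admissible (n : ℕ) (x : FreeNU K (Gen K A))
    (s : Matrix (Fin 2) (Fin 2) (FreeNU K (Gen K A)) × A) (a : A) : Prop :=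
  x ∈ freeGr K deg (-(n : ℤ) + 1) ∧ a ∈ A.gr (-(n : ℤ)) ∧ s.1 0 1 = 0 ∧ s.2 = A.d a

open Classical in
/-- The matrix that encodes the differential, and the image in `A`, of the element that is denoted
by an expression. -/
def val : Term K A → Matrix (Fin 2) (Fin 2) (FreeNU K (Gen K A)) × A
  | gen n t a =>
    if Admissible n t.eval t.val a then (diffMatGen deg (fun _ => t.eval) (n, t, a), a)
    else (diffMatGen deg (fun _ => 0) (n, t, a), 0)
  | zero => 0
  | add s t => s.val + t.val
  | smul c t => c • t.val
  | mul s t => s.val * t.val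

open Classical in
/-- The differential of a generator. -/
def δ (g : Gen K A) : FreeNU K (Gen K A) :=
  if Admissible g.1 g.2.1.eval g.2.1.val g.2.2 then g.2.1.eval else 0

open Classical in
/-- The image of a generator. -/
def π (g : Gen K A) : A :=
  if Admissible g.1 g.2.1.eval g.2.1.val g.2.2 then g.2.2 else 0

/-- The loop closes here. `δ` refers to `val`, which is computed by structural recursion on
expressions without mention of `δ`; the values so computed are those of the algebra map that `δ`
determines. `lift_eval` does the same for the map to `A`. -/
lemma diffMat_eval (t : Term K A) : diffMat deg δ t.eval = t.val.1 := by
  induction t with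
  | gen n t a =>
    rw [eval, diffMat, freeLift_of, val]
    split_ifs with h
    · simp only [diffMatGen, δ, if_pos h]
    · simp only [diffMatGen, δ, if_neg h]
  | zero => exact map_zero _
  | add s t hs ht => rw [eval, val, map_add, hs, ht]; rfl
  | smul c t ht => rw [eval, val, map_smul, ht]; rfl
  | mul s t hs ht => rw [eval, val, map_mul, hs, ht]; rfl

lemma lift_eval (t : Term K A) : freeLift π t.eval = t.val.2 := by
  induction t with
  | gen n t a =>
    rw [eval, freeLift_of, val]
    split_ifs with h
    · exact if_pos h
    · exact if_neg h
  | zero => exact map_zero _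
  | add s t hs ht => rw [eval, val, map_add, hs, ht]; rfl
  | smul c t ht => rw [eval, val, map_smul, ht]; rfl
  | mul s t hs ht => rw [eval, val, map_mul, hs, ht]; rfl

/-- Needed so that every cycle of the free algebra, not only those written as expressions, is
bounded by some generator. -/
lemma eval_surjective : Function.Surjective (eval : Term K A → FreeNU K (Gen K A)) := by
  refine freeNU_induction (fun w => ?_) ⟨zero, rfl⟩ ?_ ?_
  · induction w using FreeSemigroup.recOnMul with
    | ih1 e => exact ⟨gen e.1 e.2.1 e.2.2, rfl⟩
    | ih2 e w h1 h2 =>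
      obtain ⟨s, hs⟩ := h1
      obtain ⟨t, ht⟩ := h2
      exact ⟨mul s t, by rw [eval, hs, ht, wordEl_mul]⟩
  · rintro _ _ ⟨s, rfl⟩ ⟨t, rfl⟩
    exact ⟨add s t, rfl⟩
  · rintro c _ ⟨t, rfl⟩
    exact ⟨smul c t, rfl⟩

lemma δ_mem (g : Gen K A) : δ g ∈ freeGr K deg (deg g + 1) := by
  rw [δ]
  split_ifs with h
  · exact h.1
  · exact zero_mem _

/-- Admissibility includes closedness of the prescribed boundary. Inadmissible generators get
differential and image zero, so they impose no condition. -/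
lemma freeD_δ (g : Gen K A) : freeD deg δ (δ g) = 0 := by
  rw [δ]
  split_ifs with h
  · rw [freeD_apply, diffMat_eval]
    exact h.2.2.1
  · exact map_zero _

lemma π_mem (g : Gen K A) : π g ∈ A.gr (deg g) := by
  rw [π]
  split_ifs with h
  · exact h.2.1
  · exact zero_mem _

lemma lift_δ (g : Gen K A) : freeLift π (δ g) = A.d (π g) := by
  rw [δ, π]
  split_ifs with h
  · rw [lift_eval]
    exact h.2.2.2
  · rw [map_zero, map_zero]

lemma lift_mem {i : ℤ} {x : FreeNU K (Gen K A)} (hx : x ∈ freeGr K deg i) :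
    freeLift π x ∈ A.gr i := by
  refine freeGr_induction (fun w hw => ?_) ?_ (fun x y h h' => ?_) (fun c x h => ?_) hx
  · clear hx
    subst hw
    induction w using FreeSemigroup.recOnMul with
    | ih1 e => rw [freeLift_of, wordDeg_of]; exact π_mem e
    | ih2 e w h1 h2 => rw [wordEl_mul, map_mul, wordDeg_mul]; exact A.mul_mem h1 h2
  · rw [map_zero]; exact zero_mem _
  · rw [map_add]; exact add_mem h h'
  · rw [map_smul]; exact Submodule.smul_mem _ c h

lemma lift_d (x : FreeNU K (Gen K A)) : freeLift π (freeD deg δ x) = A.d (freeLift π x) := by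
  refine freeNU_induction (fun w => ?_) ?_ (fun x y h h' => ?_) (fun c x h => ?_) x
  · induction w using FreeSemigroup.recOnMul with
    | ih1 e => rw [freeD_of, freeLift_of, lift_δ]
    | ih2 e w h1 h2 =>
      rw [wordEl_mul, freeD_mul (wordEl_mem (FreeSemigroup.of e)), map_add, map_zsmul, map_mul,
        map_mul, map_mul, h1, h2, A.isDG.d_mul (lift_mem (wordEl_mem (FreeSemigroup.of e)))]
  · simp only [map_zero]
  · simp only [map_add, h, h']
  · simp only [map_smul, h]

variable (A) in
/-- A quasifree resolution of `A`. -/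
def resolution : DGAlg K :=
  freeDG deg (δ (A := A)) (fun g => by simp [deg]) δ_mem freeD_δ

variable (A) in
/-- The augmentation of the resolution. -/
def aug : DGAlg.Hom (resolution A) A where
  toFun := (freeLift π : FreeNU K (Gen K A) →ₙₐ[K] A)
  map_mem := lift_mem
  map_d := lift_d

/-- The resolution was built for this: the generator labelled by `n`, an expression for `x` and `a`
is a solution. -/
lemma exists_bound {n : ℕ} {x : FreeNU K (Gen K A)} {a : A}
    (hx : x ∈ freeGr K deg (-(n : ℤ) + 1)) (ha : a ∈ A.gr (-(n : ℤ))) (hdx : freeD deg δ x = 0)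
    (hda : freeLift π x = A.d a) :
    ∃ y ∈ freeGr K deg (-(n : ℤ)), freeD deg δ y = x ∧ freeLift π y = a := by
  obtain ⟨t, rfl⟩ := eval_surjective x
  have h : Admissible n t.eval t.val a :=
    ⟨hx, ha, by rw [← diffMat_eval]; exact hdx, by rw [← lift_eval]; exact hda⟩
  refine ⟨wordEl K (FreeSemigroup.of (n, t, a)), of_mem (deg := deg) (n, t, a), ?_, ?_⟩
  · rw [freeD_of]
    exact if_pos h
  · rw [freeLift_of]
    exact if_pos h

/-- Both halves are instances of `exists_bound`: a cycle whose image bounds `a` is bounded by a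
generator over `a`, and a cocycle `a` is the image of a generator that bounds `0`. Positive degrees
are trivial. -/
lemma aug_isQuasiIso : (aug A).IsQuasiIso := by
  refine fun i => ⟨cohomologyMap_injective_iff.2 fun b hb hdb a ha hda => ?_,
    cohomologyMap_surjective_iff.2 fun a ha hda => ?_⟩
  · by_cases hi : 0 < i
    · rw [(resolution A).gr_pos i hi, Submodule.mem_bot] at hb
      exact ⟨0, zero_mem _, by rw [hb, map_zero]⟩
    · obtain ⟨n, hn⟩ : ∃ n : ℕ, i - 1 = -(n : ℤ) := ⟨(1 - i).toNat, by omega⟩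
      have hn' : i = -(n : ℤ) + 1 := by omega
      rw [hn] at ha ⊢
      rw [hn'] at hb
      obtain ⟨y, hy, hdy, -⟩ := exists_bound (A := A) hb ha hdb hda.symm
      exact ⟨y, hy, hdy⟩
  · by_cases hi : 0 < i
    · rw [A.gr_pos i hi, Submodule.mem_bot] at ha
      subst ha
      exact ⟨0, zero_mem _, map_zero _, 0, zero_mem _, by simp⟩
    · obtain ⟨n, rfl⟩ : ∃ n : ℕ, i = -(n : ℤ) := ⟨(-i).toNat, by omega⟩
      obtain ⟨y, hy, hdy, hay⟩ := exists_bound (A := A) (n := n) (x := 0) (a := a) (zero_mem _) ha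
        (map_zero _) (by rw [map_zero]; exact hda.symm)
      refine ⟨y, hy, hdy, 0, zero_mem _, ?_⟩
      rw [map_zero]
      exact (sub_eq_zero.2 hay.symm).symm

end Term

namespace DGAlg

/-- Every dg-algebra has a quasifree resolution. -/
theorem exists_resolution {K : Type u} [Field K] (A : DGAlg K) :
    ∃ (B : DGAlg K) (p : Hom B A), B.IsQuasifree ∧ p.IsQuasiIso :=
  ⟨Term.resolution A, Term.aug A, freeDG_isQuasifree _ _ _, Term.aug_isQuasiIso⟩

end DGAlg

/-! ### Base change along an isomorphism from the degree `0` part -/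

namespace CDGAlg

variable {K : Type u} [Field K]

lemma Hom.H_bijective_of_strict {A B : CDGAlg K} (f : Hom A B) (hf : Function.Injective f.toFun)
    (h : ∀ i, ∀ y ∈ B.gr i, ∃ a ∈ A.gr i, f.toFun a = y) (i : ℤ) :
    Function.Bijective (f.H i) := by
  refine ⟨cohomologyMap_injective_iff.2 fun a ha hda c hc hca => ?_,
    cohomologyMap_surjective_iff.2 fun c hc hdc => ?_⟩
  · obtain ⟨b, hb, rfl⟩ := h _ c hc
    exact ⟨b, hb, hf ((f.map_d b).trans hca)⟩
  · obtain ⟨a, ha, rfl⟩ := h _ c hc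
    refine ⟨a, ha, hf ?_, 0, zero_mem _, ?_⟩
    · rw [f.map_d, map_zero]
      exact hdc
    · rw [map_zero]
      exact (sub_self _).symm

section BaseChangeUnit

variable (A : CDGAlg K) (R : Type u) [CommRing R] [Algebra A.deg0 R]

/-- The morphism `a ↦ 1 ⊗ a` to the base change. -/
def bcUnit : Hom A (A.baseChange R) where
  toFun :=
    { toFun := fun a => (bc 1 a : A.BC R)
      map_one' := rfl
      map_mul' := fun a b => by
        refine Eq.trans ?_ (bc_mul 1 1 a b).symm
        rw [mul_one]
      map_zero' := bc_zero_right 1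
      map_add' := bc_add_right 1
      commutes' := fun c => by
        have h : algebraMap K (A.BC R) c = bc 1 (algebraMap K A c) := by
          rw [Algebra.algebraMap_eq_smul_one, Algebra.algebraMap_eq_smul_one, ← bc_one, K_smul_bc]
        exact h.symm }
  map_mem := bc_mem 1
  map_d _ := rfl

variable {A R}

lemma bcStr_algebraMap (a : A.deg0) :
    A.bcStr R (algebraMap A.deg0 R a) = (A.bcUnit R).toFun (a : A) := by
  have h := bc_deg0 (1 : R) a (1 : A)
  rw [mul_one, mul_one] at h
  exact h.symm

/-- When `A⁰ → R` is bijective, `R ⊗ A` is `A⁰ ⊗ A`, that is, `A`. -/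
lemma bcUnit_injective (h : Function.Bijective (algebraMap A.deg0 R)) :
    Function.Injective (A.bcUnit R).toFun := by
  let e := (TensorProduct.lid A.deg0 A).symm ≪≫ₗ
    (LinearEquiv.ofBijective (Algebra.linearMap A.deg0 R) h).rTensor A
  have he (a : A) : e a = (bc 1 a : A.BC R) := by
    change (algebraMap A.deg0 R 1) ⊗ₜ[A.deg0] a = _
    rw [map_one]
    rfl
  intro a b hab
  refine e.injective ((he a).trans (Eq.trans ?_ (he b).symm))
  exact hab

lemma bcUnit_strict (h : Function.Bijective (algebraMap A.deg0 R)) (i : ℤ)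
    (y : A.baseChange R) (hy : y ∈ (A.baseChange R).gr i) :
    ∃ a ∈ A.gr i, (A.bcUnit R).toFun a = y := by
  refine baseChange_gr_induction (p := fun y => ∃ a ∈ A.gr i, (A.bcUnit R).toFun a = y)
    (fun r a ha => ?_) (fun x y hx hy => ?_) hy
  · obtain ⟨a₀, rfl⟩ := h.2 r
    refine ⟨a₀ * a, by simpa using A.mul_mem a₀.2 ha, ?_⟩
    refine (bc_deg0 1 a₀ a).trans ?_
    rw [mul_one]
  · obtain ⟨a, ha, rfl⟩ := hx
    obtain ⟨b, hb, rfl⟩ := hy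
    exact ⟨a + b, add_mem ha hb, map_add _ _ _⟩

lemma bcUnit_H_bijective (h : Function.Bijective (algebraMap A.deg0 R)) (i : ℤ) :
    Function.Bijective ((A.bcUnit R).H i) :=
  (A.bcUnit R).H_bijective_of_strict (bcUnit_injective h) (bcUnit_strict h) i

end BaseChangeUnit

/-- By naturality of `a ↦ 1 ⊗ a`, the map on base changes sits in a commutative square with `f`,
whose other two sides are isomorphisms on cohomology. -/
lemma baseChangeMap_H_bijective {A B : CDGAlg K} (f : Hom A B) {R S : Type u} [CommRing R]
    [CommRing S] [Algebra A.deg0 R] [Algebra B.deg0 S] (g : R →+* S) (hg)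
    (hR : Function.Bijective (algebraMap A.deg0 R)) (hS : Function.Bijective (algebraMap B.deg0 S))
    {i : ℤ} (hf : Function.Bijective (f.H i)) :
    Function.Bijective ((baseChangeMap f g hg).H i) := by
  have h1 : (baseChangeMap f g hg).comp (A.bcUnit R) = (B.bcUnit S).comp f := by
    refine Hom.ext fun a => ?_
    refine (baseChangeMap_bc f g hg 1 a).trans ?_
    rw [map_one]
    rfl
  have h2 : (baseChangeMap f g hg).H i ∘ (A.bcUnit R).H i = (B.bcUnit S).H i ∘ f.H i := by
    rw [← LinearMap.coe_comp, ← LinearMap.coe_comp, ← Hom.H_comp, ← Hom.H_comp, h1]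
  rw [← Function.Bijective.of_comp_iff _ (bcUnit_H_bijective hR i), h2]
  exact (bcUnit_H_bijective hS i).comp hf

end CDGAlg

/-! ### Quasi-isomorphisms of affine dg-schemes -/

namespace DGScheme

variable {K : Type u} [Field K]

lemma specRing_top_bijective (A : CDGAlg K) :
    Function.Bijective (algebraMap A.deg0 Γ(Spec (CommRingCat.of A.deg0), ⊤)) := by
  have h : (Spec (CommRingCat.of A.deg0)).presheaf.map
      (homOfLE (le_top : (⊤ : (Spec (CommRingCat.of A.deg0)).Opens) ≤ ⊤)).op = 𝟙 _ :=
    CategoryTheory.Functor.map_id _ _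
  have h' : IsIso ((Scheme.ΓSpecIso (CommRingCat.of A.deg0)).inv ≫
      (Spec (CommRingCat.of A.deg0)).presheaf.map
        (homOfLE (le_top : (⊤ : (Spec (CommRingCat.of A.deg0)).Opens) ≤ ⊤)).op) := by
    rw [h]
    infer_instance
  exact (ConcreteCategory.isIso_iff_bijective _).1 h'

instance (A : CDGAlg K) : IsAffine (spec A).X :=
  inferInstanceAs (IsAffine (Spec (CommRingCat.of A.deg0)))

instance (A : CDGAlg K) : IsAffine (spec A).pi0 :=
  have : IsClosedImmersion (spec A).pi0ι :=
    inferInstanceAs (IsClosedImmersion (Scheme.IdealSheafData.subschemeι _))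
  isAffine_of_isAffineHom (spec A).pi0ι

/-- Over the whole of `Spec A⁰` the structure sheaf has sections `A`, so the ideal of `π₀` is the
image of `d : A⁻¹ → A⁰`. -/
lemma mem_pi0Ideal_top (A : CDGAlg K) (a : A.deg0) :
    algebraMap A.deg0 Γ(Spec (CommRingCat.of A.deg0), ⊤) a ∈
      (spec A).pi0Ideal.ideal ⟨⊤, isAffineOpen_top _⟩ ↔ ∃ y ∈ A.gr (-1), A.d y = a := by
  have hbij := specRing_top_bijective A
  have hstr := CDGAlg.bcStr_algebraMap (R := Γ(Spec (CommRingCat.of A.deg0), ⊤)) a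
  constructor
  · rintro ⟨y, hy, h⟩
    obtain ⟨z, hz, rfl⟩ := CDGAlg.bcUnit_strict hbij (-1) y hy
    refine ⟨z, hz, CDGAlg.bcUnit_injective hbij ?_⟩
    rw [(A.bcUnit _).map_d]
    exact h.trans hstr
  · rintro ⟨y, hy, h⟩
    refine ⟨(A.bcUnit _).toFun y, (A.bcUnit _).map_mem hy, ?_⟩
    refine Eq.trans ?_ hstr.symm
    rw [← h]
    exact ((A.bcUnit _).map_d y).symm

lemma specMap_appTop {A B : CDGAlg K} (f : CDGAlg.Hom A B) (a : A.deg0) :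
    (specMap f).base.appTop (algebraMap A.deg0 Γ(Spec (CommRingCat.of A.deg0), ⊤) a) =
      algebraMap B.deg0 Γ(Spec (CommRingCat.of B.deg0), ⊤) (f.deg0 a) := by
  refine Eq.trans ?_ (specRing_map f ⊤ ⊤ le_rfl a)
  change (Spec.map (CommRingCat.ofHom f.deg0)).app ⊤ _ = _
  rw [Scheme.Hom.app_eq_appLE]
  rfl

lemma pi0ι_surjective (A : CDGAlg K) (s : Γ((spec A).pi0, ⊤)) :
    ∃ a : A.deg0, (spec A).pi0ι.appTop
      (algebraMap A.deg0 Γ(Spec (CommRingCat.of A.deg0), ⊤) a) = s := by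
  obtain ⟨r, hr⟩ := (spec A).pi0Ideal.subschemeι_app_surjective ⟨⊤, isAffineOpen_top _⟩ s
  obtain ⟨a, rfl⟩ := (specRing_top_bijective A).2 r
  exact ⟨a, hr⟩

/-- Together with `pi0ι_surjective` this identifies the global functions on `π₀` with `A⁰ / d A⁻¹`,
which is the cohomology in degree `0`, as all of `A⁰` is closed. -/
lemma pi0ι_eq_zero_iff (A : CDGAlg K) (a : A.deg0) :
    (spec A).pi0ι.appTop (algebraMap A.deg0 Γ(Spec (CommRingCat.of A.deg0), ⊤) a) = 0 ↔
      ∃ y ∈ A.gr (-1), A.d y = a := by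
  rw [← mem_pi0Ideal_top, ← (spec A).pi0Ideal.ker_subschemeι_app ⟨⊤, isAffineOpen_top _⟩]
  rfl

lemma pi0_appTop {A B : CDGAlg K} (f : CDGAlg.Hom A B) (a : A.deg0) :
    (specMap f).pi0.appTop ((spec A).pi0ι.appTop
      (algebraMap A.deg0 Γ(Spec (CommRingCat.of A.deg0), ⊤) a)) =
    (spec B).pi0ι.appTop (algebraMap B.deg0 Γ(Spec (CommRingCat.of B.deg0), ⊤) (f.deg0 a)) := by
  have h : (specMap f).pi0 ≫ (spec A).pi0ι = (spec B).pi0ι ≫ (specMap f).base :=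
    Scheme.IdealSheafData.subschemeMap_subschemeι _ _ _ _
  have h' := congrArg Scheme.Hom.appTop h
  rw [Scheme.Hom.comp_appTop, Scheme.Hom.comp_appTop] at h'
  rw [← specMap_appTop]
  exact ConcreteCategory.congr_hom h' _

/-- Both truncations are affine, so it suffices to compare global functions, and there the map is
the one on cohomology in degree `0`. -/
lemma isIso_specMap_pi0 {A B : CDGAlg K} (f : CDGAlg.Hom A B)
    (hf : Function.Bijective (f.H 0)) : IsIso (specMap f).pi0 := by
  have hbij : Function.Bijective (specMap f).pi0.appTop := by
    constructor
    · refine (injective_iff_map_eq_zero (specMap f).pi0.appTop.hom).2 fun s hs => ?_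
      obtain ⟨a, rfl⟩ := pi0ι_surjective A s
      have hs' := (pi0_appTop f a).symm.trans hs
      obtain ⟨y, hy, hya⟩ := (pi0ι_eq_zero_iff B _).1 hs'
      obtain ⟨z, hz, hza⟩ := cohomologyMap_injective_iff.1 hf.1 a a.2 (A.d_deg0 a) y hy hya
      exact (pi0ι_eq_zero_iff A a).2 ⟨z, hz, hza⟩
    · intro s
      obtain ⟨b, rfl⟩ := pi0ι_surjective B s
      obtain ⟨a, ha, -, z, hz, hzb⟩ := cohomologyMap_surjective_iff.1 hf.2 b b.2 (B.d_deg0 b)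
      refine ⟨_, (pi0_appTop f ⟨a, ha⟩).trans (sub_eq_zero.1 ?_).symm⟩
      refine (map_sub (spec B).pi0ι.appTop.hom _ _).symm.trans (Eq.trans ?_
        ((pi0ι_eq_zero_iff B (b - f.deg0 ⟨a, ha⟩)).2 ⟨z, hz, hzb⟩))
      exact congrArg _ (map_sub (specRing B ⊤) _ _).symm
  have : IsIso (specMap f).pi0.appTop := (ConcreteCategory.isIso_iff_bijective _).2 hbij
  -- A morphism of affine schemes is isomorphic, as an arrow, to `Spec` of its map on global
  -- sections.
  exact (MorphismProperty.arrow_mk_iso_iff (MorphismProperty.isomorphisms _)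
    (arrowIsoSpecΓOfIsAffine (specMap f).pi0)).2
    (inferInstanceAs (IsIso (Spec.map (specMap f).pi0.appTop)))

/-- A morphism of commutative dg-algebras that induces isomorphisms on cohomology induces a
quasi-isomorphism of affine dg-schemes. -/
theorem specMap_isQuasiIso {A B : CDGAlg K} (f : CDGAlg.Hom A B)
    (hf : ∀ i, Function.Bijective (f.H i)) : (specMap f).IsQuasiIso where
  isIso_pi0 := isIso_specMap_pi0 f (hf 0)
  -- The whole spaces are affine, so a single pair of charts serves all points.
  bijective_H _ := ⟨⟨⊤, isAffineOpen_top _⟩, ⟨⊤, isAffineOpen_top _⟩, le_rfl, trivial, rfl,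
    fun i => CDGAlg.baseChangeMap_H_bijective f _ _ (specRing_top_bijective A)
      (specRing_top_bijective B) (hf i)⟩

end DGScheme

/-! ### Invariance of the space of actions and comparison of resolutions -/

namespace DGAlg

variable {K : Type u} [Field K] [CharZero K] (V : Type u) [AddCommGroup V] [Module K V]

theorem actMap_isQuasiIso {B₁ B₂ : DGAlg K} (f : Hom B₁ B₂) (h₁ : B₁.IsQuasifree)
    (h₂ : B₂.IsQuasifree) (hf : f.IsQuasiIso) : (actMap V f).IsQuasiIso :=
  DGScheme.specMap_isQuasiIso _ (actCoordMap_H_bijective h₁ h₂ hf V)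

/-- Lift `p` along `p'`. Since `p'` need not be surjective, `p' ∘ g` is only homotopic to `p`,
whence equality on cohomology alone. Two out of three makes `g` a quasi-isomorphism of quasifree
algebras, to which the invariance theorem applies. -/
theorem exists_comparison {A B B' : DGAlg K} (p : Hom B A) (p' : Hom B' A) (hB : B.IsQuasifree)
    (hp : p.IsQuasiIso) (hB' : B'.IsQuasifree) (hp' : p'.IsQuasiIso) :
    ∃ g : Hom B B', (∀ i : ℤ, p'.H i ∘ₗ g.H i = p.H i) ∧ (actMap V g).IsQuasiIso := by
  obtain ⟨g, ⟨h⟩⟩ := exists_homotopy_lift p hB hp'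
  have hg (i : ℤ) : p'.H i ∘ₗ g.H i = p.H i := by rw [← Hom.H_comp, h.H_eq]
  refine ⟨g, hg, actMap_isQuasiIso V g hB hB' fun i => ?_⟩
  rw [← Function.Bijective.of_comp_iff' (hp' i), ← LinearMap.coe_comp, hg]
  exact hp i

end DGAlg

end

end DerivedAct

theorem proposition3p3p6 (K : Type u) [Field K] [CharZero K] (V : Type u) [AddCommGroup V]
    [Module K V] [FiniteDimensional K V] :
    (∀ (B₁ B₂ : DerivedAct.DGAlg K) (f : DerivedAct.DGAlg.Hom B₁ B₂),
      B₁.IsQuasifree → B₂.IsQuasifree → f.IsQuasiIso →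
      (DerivedAct.DGAlg.actMap V f : DerivedAct.DGScheme.Hom (B₂.Act V) (B₁.Act V)).IsQuasiIso) ∧
    (∀ A : DerivedAct.DGAlg K,
      (∃ (B : DerivedAct.DGAlg K) (p : DerivedAct.DGAlg.Hom B A),
        B.IsQuasifree ∧ p.IsQuasiIso) ∧
      ∀ (B B' : DerivedAct.DGAlg K) (p : DerivedAct.DGAlg.Hom B A)
        (p' : DerivedAct.DGAlg.Hom B' A),
        B.IsQuasifree → p.IsQuasiIso → B'.IsQuasifree → p'.IsQuasiIso →
        ∃ g : DerivedAct.DGAlg.Hom B B', (∀ i : ℤ, p'.H i ∘ₗ g.H i = p.H i) ∧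
          (DerivedAct.DGAlg.actMap V g :
            DerivedAct.DGScheme.Hom (B'.Act V) (B.Act V)).IsQuasiIso) :=
  ⟨fun _ _ f h₁ h₂ hf => DerivedAct.DGAlg.actMap_isQuasiIso V f h₁ h₂ hf,
    fun A => ⟨A.exists_resolution, fun _ _ p p' hB hp hB' hp' =>
      DerivedAct.DGAlg.exists_comparison V p p' hB hp hB' hp'⟩⟩
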